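/- **Proposition 6.6 (Lie bialgebroid from two Poisson tensors).** Let $M$ be a smooth (finite-dimensional, Hausdorff, second countable) manifold. Write a Poisson tensor $U$ on $M$ also as its skew bundle map $U:T^*M\to TM$, with $U(\xi,\eta)=\langle \eta,U\xi\rangle$, and let $T^*M_U$ be the cotangent Lie algebroid: the bundle $T^*M$ with anchor $U$ and bracket $$[\xi,\eta]_U=L_{U\xi}\eta-L_{U\eta}\xi+d\langle \xi,U\eta\rangle .$$ A Lie bialgebroid is a pair of Lie algebroids $A$, $A'$ over $M$ (anchors $a$, $a_*$) together with a nondegenerate pairing of the bundles $A$ and $A'$, by which $A'$ is identified with $A^*$, such that the differential $d_*$ on $\Gamma(\wedge^\bullet A)$ coming from $A'\cong A^*$ is a derivation of the Schouten bracket on $\Gamma(\wedge^\bullet A)$ extending the bracket of $A$: $$d_*[P,Q]=[d_*P,Q]+(-1)^{p-1}[P,d_*Q]\qquad (P\in\Gamma(\wedge^pA),\ Q\in\Gamma(\wedge^qA)).$$ The Poisson tensor that it induces on $M$ is the one with bundle map $a\circ a_*^*:T^*M\to A\to TM$, where $a_*^*:T^*M\to (A')^*\cong A$ is dual to $a_*$.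 Let $U$ and $V$ be Poisson tensors on $M$ such that $U-V$ is nondegenerate at every point. Then: 1. $T^*M_U$ and $T^*M_V$ are Lie algebroids, and they form a Lie bialgebroid $(T^*M_U,T^*M_V)$ under the pairing $(\xi,\eta)=(U-V)(\xi,\eta)$, for $\xi\in T^*M_U$ and $\eta\in T^*M_V$. The Poisson tensor that it induces on $M$ is $-U(U-V)^{-1}V$. 2. They also form a Lie bialgebroid under the pairing $(\xi,\eta)=\tfrac12 (U-V)(\xi,\eta)$, and with this normalization the induced Poisson tensor on $M$ is $-2U(U-V)^{-1}V$. (In both cases it is part of the claim that the induced bundle map is a Poisson tensor.) -/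

import Mathlib

open scoped Manifold ContDiff

noncomputable section

namespace PoissonBialgebroid

/-! ### Smooth functions, sections of vector bundles, and bundle maps

Throughout, `M` is a smooth manifold without boundary modelled on `E`, and a vector bundle over `M`
with model fibre `F` is a family of fibres `A : M → Type*` with Mathlib's bundle structures. -/

section Sections

/-- The ring `C^∞(M)`. -/
abbrev Fn (E : Type*) [NormedAddCommGroup E] [NormedSpace ℝ E]
    (M : Type*) [TopologicalSpace M] [ChartedSpace E M] : Type _ :=
  C^∞⟮𝓘(ℝ, E), M; 𝓘(ℝ, ℝ), ℝ⟯

/-- The smooth sections `Γ(A)` of a vector bundle `A` over `M`. -/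
abbrev Sec (E : Type*) [NormedAddCommGroup E] [NormedSpace ℝ E]
    {M : Type*} [TopologicalSpace M] [ChartedSpace E M]
    (F : Type*) [NormedAddCommGroup F] [NormedSpace ℝ F]
    (A : M → Type*) [TopologicalSpace (Bundle.TotalSpace F A)]
    [∀ x, TopologicalSpace (A x)] [FiberBundle F A] : Type _ :=
  Cₛ^∞⟮𝓘(ℝ, E); F, A⟯

variable {E : Type*} [NormedAddCommGroup E] [NormedSpace ℝ E]
  {M : Type*} [TopologicalSpace M] [ChartedSpace E M]
  {F : Type*} [NormedAddCommGroup F] [NormedSpace ℝ F]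
  {A : M → Type*} [TopologicalSpace (Bundle.TotalSpace F A)]
  [∀ x, TopologicalSpace (A x)] [FiberBundle F A]
  [∀ x, AddCommGroup (A x)] [∀ x, Module ℝ (A x)] [VectorBundle ℝ F A]
  {F₂ : Type*} [NormedAddCommGroup F₂] [NormedSpace ℝ F₂]
  {A₂ : M → Type*} [TopologicalSpace (Bundle.TotalSpace F₂ A₂)]
  [∀ x, TopologicalSpace (A₂ x)] [FiberBundle F₂ A₂]
  [∀ x, AddCommGroup (A₂ x)] [∀ x, Module ℝ (A₂ x)] [VectorBundle ℝ F₂ A₂]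

instance Sec.instSMulFn : SMul (Fn E M) (Sec E F A) :=
  ⟨fun f s => ⟨fun x => f x • s x, f.contMDiff.smul_section s.contMDiff⟩⟩

@[simp] theorem Sec.fn_smul_apply (f : Fn E M) (s : Sec E F A) (x : M) :
    (f • s) x = f x • s x := rfl

/-- `Γ(A)` is a module over `C^∞(M)`, with pointwise operations. -/
instance Sec.instModuleFn : Module (Fn E M) (Sec E F A) where
  one_smul s := by ext x; simp
  mul_smul f g s := by ext x; simp [mul_smul]
  smul_zero f := by ext x; simp
  smul_add f s t := by ext x; simp
  add_smul f g s := by ext x; simp [add_smul]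
  zero_smul s := by ext x; simp

variable [IsManifold 𝓘(ℝ, E) ∞ M]
  [∀ x, IsTopologicalAddGroup (A₂ x)] [∀ x, ContinuousSMul ℝ (A₂ x)]
  [ContMDiffVectorBundle ∞ F A 𝓘(ℝ, E)] [ContMDiffVectorBundle ∞ F₂ A₂ 𝓘(ℝ, E)]

/-- The map on sections `Γ(A) → Γ(A₂)` induced by a smooth bundle map `A → A₂` over the
identity, the latter being a smooth section of the bundle `Hom(A, A₂)`. -/
def onSections (φ : Sec E (F →L[ℝ] F₂) (fun x : M => A x →L[ℝ] A₂ x)) :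
    Sec E F A →ₗ[Fn E M] Sec E F₂ A₂ where
  toFun s := ⟨fun x => φ x (s x), φ.contMDiff.clm_bundle_apply s.contMDiff⟩
  map_add' s t := by ext x; exact map_add (φ x) _ _
  map_smul' f s := by ext x; exact map_smul (φ x) _ _

end Sections

section Tangent

variable (E : Type*) [NormedAddCommGroup E] [NormedSpace ℝ E]
  (M : Type*) [TopologicalSpace M] [ChartedSpace E M] [IsManifold 𝓘(ℝ, E) ∞ M]

/-- The fibre `T*_x M` of the cotangent bundle. -/
abbrev Cotangent (x : M) : Type _ := TangentSpace 𝓘(ℝ, E) x →L[ℝ] ℝ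

/-- Smooth vector fields. -/
abbrev VectorFields : Type _ := Sec E E (fun x : M => TangentSpace 𝓘(ℝ, E) x)

/-- Smooth 1-forms, i.e. smooth sections of the cotangent bundle. -/
abbrev OneForms : Type _ := Sec E (E →L[ℝ] ℝ) (fun x : M => TangentSpace 𝓘(ℝ, E) x →L[ℝ] ℝ)

/-- Smooth bundle maps `T*M → TM` over the identity. -/
abbrev SharpMaps : Type _ :=
  Sec E ((E →L[ℝ] ℝ) →L[ℝ] E)
    (fun x : M => (TangentSpace 𝓘(ℝ, E) x →L[ℝ] ℝ) →L[ℝ] TangentSpace 𝓘(ℝ, E) x)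

variable {E M}

/-- The evaluation `⟨α, Y⟩ ∈ C^∞(M)` of a 1-form on vector fields. -/
def evalForm (α : OneForms E M) : VectorFields E M →ₗ[Fn E M] Fn E M where
  toFun Y := ⟨fun x => α x (Y x), by
    have h := α.contMDiff.clm_bundle_apply (F₂ := ℝ) (E₂ := Bundle.Trivial M ℝ) Y.contMDiff
    intro x
    have hx := h x
    simp only [Bundle.contMDiffAt_totalSpace] at hx
    exact hx.2⟩
  map_add' s t := by ext x; exact map_add (α x) _ _
  map_smul' f s := by ext x; exact map_smul (α x) _ _


/-- The derivative `(Y f)(x) = df_x(Y_x)` of a function along a vector field. -/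
def lieDerivFn (Y : VectorFields E M) (f : M → ℝ) (x : M) : ℝ :=
  mfderiv 𝓘(ℝ, E) 𝓘(ℝ, ℝ) f x (Y x)

/-- The Lie bracket `[X, Y]_x` of vector fields. -/
def vfBracket (X Y : VectorFields E M) (x : M) : TangentSpace 𝓘(ℝ, E) x :=
  VectorField.mlieBracket 𝓘(ℝ, E) (fun y => X y) (fun y => Y y) x

/-- The Lie derivative of a 1-form, `(L_X η)(Y) = X ⟨η, Y⟩ - ⟨η, [X, Y]⟩`, at the point `x`. -/
def lieDerivForm (X : VectorFields E M) (η : OneForms E M) (Y : VectorFields E M) (x : M) : ℝ :=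
  lieDerivFn X (evalForm η Y) x - η x (vfBracket X Y x)

/-! ### Poisson tensors -/

/-- The bracket `{f, g} = ⟨dg, U df⟩` of functions. -/
def poissonBracket (U : SharpMaps E M) (f g : M → ℝ) (x : M) : ℝ :=
  (mfderiv 𝓘(ℝ, E) 𝓘(ℝ, ℝ) g x : TangentSpace 𝓘(ℝ, E) x →L[ℝ] ℝ)
    (U x (mfderiv 𝓘(ℝ, E) 𝓘(ℝ, ℝ) f x : TangentSpace 𝓘(ℝ, E) x →L[ℝ] ℝ))

/-- A Poisson tensor on `M`, given through its bundle map `U : T*M → TM`: it is skew, i.e. a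
bivector field with `U(α, β) = ⟨β, U α⟩`, and its bracket satisfies the Jacobi identity. -/
structure IsPoisson (U : SharpMaps E M) : Prop where
  skew : ∀ (x : M) (α β : TangentSpace 𝓘(ℝ, E) x →L[ℝ] ℝ), β (U x α) = -α (U x β)
  jacobi : ∀ (f g h : Fn E M) (x : M),
    poissonBracket U f (poissonBracket U g h) x + poissonBracket U g (poissonBracket U h f) x
      + poissonBracket U h (poissonBracket U f g) x = 0

end Tangent

/-! ### Lie algebroids -/

section Algebroid

/-- A Lie algebroid structure on the vector bundle `A` over `M`. -/
structure LieAlgebroid (E : Type*) [NormedAddCommGroup E] [NormedSpace ℝ E]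
    {M : Type*} [TopologicalSpace M] [ChartedSpace E M] [IsManifold 𝓘(ℝ, E) ∞ M]
    (F : Type*) [NormedAddCommGroup F] [NormedSpace ℝ F]
    (A : M → Type*) [TopologicalSpace (Bundle.TotalSpace F A)]
    [∀ x, TopologicalSpace (A x)] [FiberBundle F A]
    [∀ x, AddCommGroup (A x)] [∀ x, Module ℝ (A x)] [VectorBundle ℝ F A]
    [ContMDiffVectorBundle ∞ F A 𝓘(ℝ, E)] where
  /-- The anchor, a smooth bundle map `A → TM`. -/
  anchor : Sec E (F →L[ℝ] E) (fun x : M => A x →L[ℝ] TangentSpace 𝓘(ℝ, E) x)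
  /-- The bracket on sections. -/
  bracket : Sec E F A → Sec E F A → Sec E F A
  bracket_add : ∀ X Y Z, bracket X (Y + Z) = bracket X Y + bracket X Z
  bracket_smul : ∀ (c : ℝ) (X Y), bracket X (c • Y) = c • bracket X Y
  bracket_skew : ∀ X Y, bracket X Y = -bracket Y X
  bracket_jacobi : ∀ X Y Z,
    bracket X (bracket Y Z) + bracket Y (bracket Z X) + bracket Z (bracket X Y) = 0
  anchor_bracket : ∀ (X Y) (x : M),
    anchor x (bracket X Y x) = vfBracket (onSections anchor X) (onSections anchor Y) x
  bracket_fn_smul : ∀ (X) (f : Fn E M) (Y) (x : M),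
    bracket X (f • Y) x = f x • bracket X Y x + lieDerivFn (onSections anchor X) f x • Y x

variable {E : Type*} [NormedAddCommGroup E] [NormedSpace ℝ E]
  {M : Type*} [TopologicalSpace M] [ChartedSpace E M] [IsManifold 𝓘(ℝ, E) ∞ M]
  {F : Type*} [NormedAddCommGroup F] [NormedSpace ℝ F]
  {A : M → Type*} [TopologicalSpace (Bundle.TotalSpace F A)]
  [∀ x, TopologicalSpace (A x)] [FiberBundle F A]
  [∀ x, AddCommGroup (A x)] [∀ x, Module ℝ (A x)] [VectorBundle ℝ F A]
  [ContMDiffVectorBundle ∞ F A 𝓘(ℝ, E)]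
  {F' : Type*} [NormedAddCommGroup F'] [NormedSpace ℝ F']
  {A' : M → Type*} [TopologicalSpace (Bundle.TotalSpace F' A')]
  [∀ x, TopologicalSpace (A' x)] [FiberBundle F' A']
  [∀ x, AddCommGroup (A' x)] [∀ x, Module ℝ (A' x)] [VectorBundle ℝ F' A']
  [ContMDiffVectorBundle ∞ F' A' 𝓘(ℝ, E)]

/-- The derivative `a(X) f` of a function along the anchor of a section `X`. -/
def LieAlgebroid.deriv (𝒜 : LieAlgebroid E F A) (X : Sec E F A) (f : M → ℝ) (x : M) : ℝ :=
  lieDerivFn (onSections 𝒜.anchor X) f x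

/-! ### The differential and the Schouten bracket on `Γ(∧^• A)`

Let `B : Γ(A) × Γ(A') → C^∞(M)` be a `C^∞(M)`-bilinear perfect pairing, which identifies `A'` with
`A*`. A section of `∧^k A` is then the same thing as an alternating `C^∞(M)`-multilinear map
`Γ(A')^k → C^∞(M)`: the section `X₁ ∧ ⋯ ∧ X_k` is the map `(ξ₁, …, ξ_k) ↦ det (B(X_i, ξ_j))`. -/

/-- `Γ(∧^k A)`, for the dual bundle `A'` of `A`. -/
abbrev Multi (E : Type*) [NormedAddCommGroup E] [NormedSpace ℝ E]
    {M : Type*} [TopologicalSpace M] [ChartedSpace E M]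
    (F' : Type*) [NormedAddCommGroup F'] [NormedSpace ℝ F']
    (A' : M → Type*) [TopologicalSpace (Bundle.TotalSpace F' A')]
    [∀ x, TopologicalSpace (A' x)] [FiberBundle F' A']
    [∀ x, AddCommGroup (A' x)] [∀ x, Module ℝ (A' x)] [VectorBundle ℝ F' A']
    (k : ℕ) : Type _ :=
  Sec E F' A' [⋀^Fin k]→ₗ[Fn E M] Fn E M

/-- The value at `(ξ₀, …, ξ_k)` and `x` of the Lie algebroid differential `d_* P` of `P ∈ Γ(∧^k A)`,
where `d_*` comes from the Lie algebroid structure on `A' = A*`: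
`∑ᵢ (-1)ⁱ a'(ξᵢ) P(…ξ̂ᵢ…) + ∑_{i<j} (-1)^{i+j} P([ξᵢ, ξⱼ], …ξ̂ᵢ…ξ̂ⱼ…)`.
In the second sum `l` enumerates the indices `j > i`, as `j = l + 1` with `i ≤ l`. -/
def differentialValue (𝒜' : LieAlgebroid E F' A') :
    {k : ℕ} → Multi E F' A' k → (Fin (k + 1) → Sec E F' A') → M → ℝ
  | 0, P, ξ, x => 𝒜'.deriv (ξ 0) (P ![]) x
  | k + 1, P, ξ, x =>
    (∑ i : Fin (k + 2), (-1 : ℝ) ^ (i : ℕ) * 𝒜'.deriv (ξ i) (P (i.removeNth ξ)) x)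
    + ∑ i : Fin (k + 2), ∑ l : Fin (k + 1),
        if (i : ℕ) ≤ (l : ℕ) then
          (-1 : ℝ) ^ ((i : ℕ) + ((l : ℕ) + 1)) *
            P (Fin.cons (𝒜'.bracket (ξ i) (ξ l.succ)) (l.removeNth (i.removeNth ξ))) x
        else 0

variable (B : Sec E F A →ₗ[Fn E M] Sec E F' A' →ₗ[Fn E M] Fn E M)

/-- For `P ∈ Γ(∧^{p+1} A)`, the section `X` of `A` with `B(X, η) = P(ξ₀, …, η, …, ξ_p)`, where `η`
stands in the slot `i` (and the entry `ξ_i` is ignored). -/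
def sharp [B.IsPerfPair] {p : ℕ} (P : Multi E F' A' (p + 1)) (i : Fin (p + 1))
    (ξ : Fin (p + 1) → Sec E F' A') : Sec E F A :=
  B.toPerfPair.symm (P.toMultilinearMap.toLinearMap ξ i)

/-- The differential of `ξ ∈ Γ(A*)` on two sections of `A`:
`(dξ)(X, Y) = a(X) ⟨ξ, Y⟩ - a(Y) ⟨ξ, X⟩ - ⟨ξ, [X, Y]⟩`. -/
def dTwo (𝒜 : LieAlgebroid E F A) (ξ : Sec E F' A') (X Y : Sec E F A) (x : M) : ℝ :=
  𝒜.deriv X (B Y ξ) x - 𝒜.deriv Y (B X ξ) x - B (𝒜.bracket X Y) ξ x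

/-- The value at `(ξ₀, …, ξ_{n-1})` and `x` of the Schouten bracket `[P, Q] ∈ Γ(∧^n A)` of
`P ∈ Γ(∧^p A)` and `Q ∈ Γ(∧^q A)`, `n = p + q - 1`, i.e. of the extension of the Lie algebroid
bracket of `A` that is a graded biderivation of `∧`, with `[X, f] = a(X) f` and the conventions
`[P, Q] = -(-1)^{(p-1)(q-1)} [Q, P]`, `[P, Q ∧ R] = [P, Q] ∧ R + (-1)^{(p-1)q} Q ∧ [P, R]`.
In a local frame `e_i` of `A` with dual frame `e^i` and `[e_i, e_j] = c_{ij}^k e_k` it reads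
`(ι^R_{e^i} P) ∧ a(e_i)(Q) - a(e_i)(P) ∧ (ι_{e^i} Q) + (ι^R_{e^i} P) ∧ c_{ij}^k e_k ∧ (ι_{e^j} Q)`,
with `a(e_i)` acting on components and `ι`, `ι^R` inserting into the first and the last slot;
below it is written without frames. -/
def schoutenValue (𝒜 : LieAlgebroid E F A) [B.IsPerfPair] :
    {p q n : ℕ} → n + 1 = p + q → Multi E F' A' p → Multi E F' A' q →
      (Fin n → Sec E F' A') → M → ℝ
  | 0, 0, _, h, _, _, _, _ => by omega
  | 0, q + 1, n, h, f, Q, ξ, x =>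
      -- `[f, Q] = - ι_{df} Q`
      -𝒜.deriv (sharp B Q 0 (Fin.cons 0 fun j : Fin q => ξ ⟨j, by omega⟩)) (f ![]) x
  | p + 1, 0, n, h, P, g, ξ, x =>
      𝒜.deriv (sharp B P (Fin.last p) (Fin.snoc (fun i : Fin p => ξ ⟨i, by omega⟩) 0)) (g ![]) x
  | p + 1, q + 1, n, h, P, Q, ξ, x =>
      ∑ σ : Equiv.Perm (Fin n),
        let v : Fin n → Sec E F' A' := fun i => ξ (σ i)
        -- the first `p + 1` and the last `q + 1` of the `p + q + 1` arguments: they share `v_p`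
        let v₁ : Fin (p + 1) → Sec E F' A' := fun i => v ⟨i, by omega⟩
        let v₂ : Fin (q + 1) → Sec E F' A' := fun j => v ⟨p + j, by omega⟩
        let X : Sec E F A := sharp B P (Fin.last p) v₁
        let Y : Sec E F A := sharp B Q 0 v₂
        ((Equiv.Perm.sign σ : ℤ) : ℝ) *
          (𝒜.deriv X (Q v₂) x / (p.factorial * (q + 1).factorial)
            - 𝒜.deriv Y (P v₁) x / ((p + 1).factorial * q.factorial)
            - dTwo B 𝒜 (v₂ 0) X Y x / (p.factorial * q.factorial))

/-! ### Lie bialgebroids -/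

/-- Lie algebroids `𝒜` on `A` and `𝒜'` on `A'` form a Lie bialgebroid under the pairing `B`:
`B` is perfect, so that `A'` is the dual of `A`, and the differential `d_*` on `Γ(∧^• A)` coming
from `𝒜'` is a derivation of the Schouten bracket on `Γ(∧^• A)` coming from `𝒜`,
`d_* [P, Q] = [d_* P, Q] + (-1)^{p-1} [P, d_* Q]` for `P ∈ Γ(∧^p A)`. -/
structure IsLieBialgebroid (𝒜 : LieAlgebroid E F A) (𝒜' : LieAlgebroid E F' A') : Prop where
  perfect : B.IsPerfPair
  derivation :
    ∃ (d : ∀ {k : ℕ}, Multi E F' A' k → Multi E F' A' (k + 1))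
      (S : ∀ {p q n : ℕ}, n + 1 = p + q → Multi E F' A' p → Multi E F' A' q → Multi E F' A' n),
      -- `d` is the differential of `𝒜'` and `S` is the Schouten bracket of `𝒜`
      (∀ (k : ℕ) (P : Multi E F' A' k) ξ x, d P ξ x = differentialValue 𝒜' P ξ x) ∧
      (∀ (p q n : ℕ) (h : n + 1 = p + q) (P : Multi E F' A' p) (Q : Multi E F' A' q) ξ x,
        S h P Q ξ x = schoutenValue B 𝒜 h P Q ξ x) ∧
      (∀ (p q n : ℕ) (h : n + 1 = p + q) (P : Multi E F' A' p) (Q : Multi E F' A' q),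
        d (S h P Q) =
          S (by omega : n + 1 + 1 = (p + 1) + q) (d P) Q
            + (-1 : Fn E M) ^ (p + 1) • S (by omega : n + 1 + 1 = p + (q + 1)) P (d Q)) ∧
      -- the remaining case `p = q = 0`, where `[f, g] = 0`
      (∀ f g : Multi E F' A' 0,
        0 = S (by omega : 0 + 1 = (0 + 1) + 0) (d f) g
            + (-1 : Fn E M) ^ (0 + 1) • S (by omega : 0 + 1 = 0 + (0 + 1)) f (d g))

variable {B}

/-- The map `a ∘ a_*^* : Ω¹(M) → 𝔛(M)` of a Lie bialgebroid, where `a_*^* : T*M → (A')* ≅ A` is the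
dual of the anchor `a_*` of `A'`, i.e. `B(a_*^* α, ζ) = ⟨α, a_* ζ⟩` for all `ζ`. -/
def IsLieBialgebroid.inducedMap {𝒜 : LieAlgebroid E F A} {𝒜' : LieAlgebroid E F' A'}
    (h : IsLieBialgebroid B 𝒜 𝒜') (α : OneForms E M) : VectorFields E M :=
  haveI := h.perfect
  onSections 𝒜.anchor (B.toPerfPair.symm (evalForm α ∘ₗ onSections 𝒜'.anchor))

/-- `π` is the Poisson tensor induced on the base by a Lie bialgebroid: its bundle map
`T*M → TM` is `a ∘ a_*^*`, and it is a Poisson tensor. -/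
structure IsLieBialgebroid.IsInducedPoisson {𝒜 : LieAlgebroid E F A} {𝒜' : LieAlgebroid E F' A'}
    (h : IsLieBialgebroid B 𝒜 𝒜') (π : SharpMaps E M) : Prop where
  eq_inducedMap : ∀ α : OneForms E M, onSections π α = h.inducedMap α
  isPoisson : IsPoisson π

end Algebroid

/-! ### Cotangent Lie algebroids -/

section CotangentAlgebroid

variable {E : Type*} [NormedAddCommGroup E] [NormedSpace ℝ E]
  {M : Type*} [TopologicalSpace M] [ChartedSpace E M] [IsManifold 𝓘(ℝ, E) ∞ M]

/-- `𝒜` is the cotangent Lie algebroid `T*M_U`: its anchor is `U`, and its bracket is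
`[ξ, η] = L_{Uξ} η - L_{Uη} ξ + d ⟨ξ, Uη⟩`. (This determines anchor and bracket.) -/
structure IsCotangentAlgebroid (U : SharpMaps E M)
    (𝒜 : LieAlgebroid E (M := M) (E →L[ℝ] ℝ) (fun x => TangentSpace 𝓘(ℝ, E) x →L[ℝ] ℝ)) :
    Prop where
  anchor_eq : 𝒜.anchor = U
  bracket_eq : ∀ (ξ η : OneForms E M) (Y : VectorFields E M) (x : M),
    𝒜.bracket ξ η x (Y x) =
      lieDerivForm (onSections U ξ) η Y x - lieDerivForm (onSections U η) ξ Y x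
        + lieDerivFn Y (evalForm ξ (onSections U η)) x

/-- The pairing `(ξ, η) ↦ W(ξ, η) = ⟨η, W ξ⟩` of 1-forms. -/
def bivectorPairing (W : SharpMaps E M) :
    OneForms E M →ₗ[Fn E M] OneForms E M →ₗ[Fn E M] Fn E M :=
  LinearMap.mk₂ (Fn E M) (fun ξ η => evalForm η (onSections W ξ))
    (fun ξ ξ' η => by simp) (fun f ξ η => by simp)
    (fun ξ η η' => rfl) (fun f ξ η => rfl)

end CotangentAlgebroid

end PoissonBialgebroid

end

set_option linter.unusedSectionVars false

noncomputable section

namespace PoissonBialgebroid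

/-! ### Grassmann-valued generating functions of alternating maps -/

section Grassmann

open scoped TensorProduct

/-! The geometric core is the standard Courant algebroid TM ⊕ T*M, with its symmetric pairing
multiplied by a constant c. A skew bundle map P has an isotropic graph. The graph is closed under
the Dorfman bracket as soon as P is Poisson (`CartanCalculus.torsion_eq_zero`), and projecting it to
T*M then gives the cotangent Lie algebroid. If U − V is invertible, the graphs of U and V are
transversal, so they form a Manin triple (`CartanCalculus.maninTriple`). The pairing between them is
c(U − V) (`CartanCalculus.pair_diracGraph`). The Dorfman bracket does not depend on c, so the two
normalisations are the cases c = 1 and c = 1/2 of a single statement.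

It remains to see that a Manin triple is a Lie bialgebroid. The differential d and the operator [P,
·] are both graded derivations of the wedge product. Hence the defect d[P, Q] − [dP, Q] − (−1)^(p−1)
[P, dQ] is a graded derivation in Q (`DualAnchoredBracket.gevDefect_of_gev_eq`), and by graded
skewness also in P. Multivectors are locally generated by functions and sections, so the defect
vanishes once it does in degrees (0,0), (1,0) and (1,1) (`DualAnchoredBracket.gevDefect_eq_zero`).
In a Manin triple these three cases follow from the Courant axioms: isotropy of exact sections,
invariance of the pairing together with compatibility of the anchor, and the Jacobi identity of the
Dorfman bracket (`ManinTriple.gevDefect_eq_zero`).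

Signs and shuffles are handled by generating functions. An alternating map is evaluated at ∑ θᵢ ξᵢ
with Grassmann variables θᵢ. Wedge products then become products, insertion into a slot becomes a
derivative, and d and the Schouten bracket become the short formulas `AnchoredBracket.gev_d` and
`DualAnchoredBracket.gev_schouten`. Taking as many variables as arguments recovers the map from its
top coefficient (`topX_gev`).

The bracket of functions {f, g} of the triple is the derivative of g along the U-component of the
exact section of f. Its skewness and Jacobi identity are again Courant identities
(`ManinTriple.poisson_skew`, `ManinTriple.poisson_jacobi`). Computing that component gives the
bundle map −c⁻¹ U (U − V)⁻¹ V.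

On the manifold, a frame and coframe that are dual up to a function nonzero at a given point
(`exists_frame`) show that vector fields and 1-forms are each other's duals over the smooth
functions. The same functions localise the reduction to low degree. -/

/-- The Grassmann algebra on `m` generators. -/
abbrev Grass (m : ℕ) : Type := ExteriorAlgebra ℝ (Fin m → ℝ)

/-- The product of generators indexed by `I`. -/
def theta {m p : ℕ} (I : Fin p → Fin m) : Grass m :=
  ExteriorAlgebra.ιMulti ℝ p fun j => Pi.single (I j) (1 : ℝ)

/-- A single generator. -/
def gen {m : ℕ} (i : Fin m) : Grass m := ExteriorAlgebra.ι ℝ (Pi.single i (1 : ℝ))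

theorem theta_comp_perm {m p : ℕ} (I : Fin p → Fin m) (σ : Equiv.Perm (Fin p)) :
    theta (I ∘ σ) = ((Equiv.Perm.sign σ : ℤ) : ℝ) • theta I := by
  have := (ExteriorAlgebra.ιMulti ℝ p).map_perm (fun j => (Pi.single (I j) (1 : ℝ) : Fin m → ℝ)) σ
  rw [theta, theta]
  refine Eq.trans this ?_
  rw [Units.smul_def, ← Int.cast_smul_eq_zsmul ℝ]

theorem theta_append {m p q : ℕ} (I : Fin p → Fin m) (J : Fin q → Fin m) :
    theta (Fin.append I J) = theta I * theta J := by
  rw [theta, theta, theta, ExteriorAlgebra.ιMulti_mul_ιMulti]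
  congr 1
  ext j
  refine Fin.addCases (fun i => ?_) (fun i => ?_) j <;> simp

theorem theta_cons {m p : ℕ} (i : Fin m) (I : Fin p → Fin m) :
    theta (Fin.cons i I : Fin (p + 1) → Fin m) = gen i * theta I := by
  rw [theta, ExteriorAlgebra.ιMulti_succ_apply]
  rfl

theorem theta_insertNth {m p : ℕ} (j : Fin (p + 1)) (i : Fin m) (I : Fin p → Fin m) :
    theta (j.insertNth i I : Fin (p + 1) → Fin m) = (-1 : ℝ) ^ (j : ℕ) • (gen i * theta I) := by
  have := (ExteriorAlgebra.ιMulti ℝ (p + 1)).map_insertNth j (Pi.single i (1 : ℝ) : Fin m → ℝ)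
    (fun k => (Pi.single (I k) (1 : ℝ) : Fin m → ℝ))
  rw [← theta_cons, theta, theta]
  have e : (fun k => (Pi.single ((j.insertNth i I : Fin (p + 1) → Fin m) k) (1 : ℝ) :
      Fin m → ℝ)) =
      (j.insertNth (Pi.single i (1 : ℝ)) (fun k => Pi.single (I k) (1 : ℝ)) :
        Fin (p + 1) → Fin m → ℝ) := by
    ext k
    refine j.succAboveCases ?_ (fun i => ?_) k <;> simp
  rw [e, this, ← Int.cast_smul_eq_zsmul ℝ]
  push_cast
  congr 2
  ext k
  refine Fin.cases ?_ (fun i => ?_) k <;> simp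

theorem ιMulti_mul_ι {m p : ℕ} (a : Fin m → ℝ) (v : Fin p → Fin m → ℝ) :
    ExteriorAlgebra.ι ℝ a * ExteriorAlgebra.ιMulti ℝ p v =
      (-1 : ℝ) ^ p • (ExteriorAlgebra.ιMulti ℝ p v * ExteriorAlgebra.ι ℝ a) := by
  induction p with
  | zero => simp
  | succ p ih =>
    rw [ExteriorAlgebra.ιMulti_succ_apply, ← mul_assoc,
      eq_neg_of_add_eq_zero_left (ExteriorAlgebra.ι_add_mul_swap a (v 0)), neg_mul, mul_assoc,
      ih, mul_smul_comm, pow_succ, mul_neg_one, neg_smul, mul_assoc]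

theorem gen_mul_theta {m p : ℕ} (i : Fin m) (I : Fin p → Fin m) :
    gen i * theta I = (-1 : ℝ) ^ p • (theta I * gen i) := ιMulti_mul_ι _ _

theorem theta_mul_theta {m p q : ℕ} (I : Fin p → Fin m) (J : Fin q → Fin m) :
    theta I * theta J = (-1 : ℝ) ^ (p * q) • (theta J * theta I) := by
  induction p with
  | zero => simp [theta]
  | succ p ih =>
    have e : I = Fin.cons (I 0) (Fin.tail I) := (Fin.cons_self_tail I).symm
    rw [e, theta_cons, mul_assoc, ih, mul_smul_comm, ← mul_assoc, gen_mul_theta, smul_mul_assoc,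
      smul_smul, ← pow_add, mul_assoc]
    congr 2
    ring

/-- The coefficient of the product of all generators. -/
def top (m : ℕ) : Grass m →ₗ[ℝ] ℝ :=
  ExteriorAlgebra.liftAlternating (R := ℝ) (M := Fin m → ℝ) (N := ℝ)
    (fun i => if h : i = m then
      (Matrix.detRowAlternating (R := ℝ) (n := Fin m)).domDomCongr (finCongr h.symm) else 0)

theorem top_theta {m : ℕ} (I : Fin m → Fin m) :
    top m (theta I) = Matrix.det (fun i j => (Pi.single (I i) (1 : ℝ) : Fin m → ℝ) j) := by
  rw [top, theta, ExteriorAlgebra.liftAlternating_apply_ιMulti]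
  simp
  rfl

theorem top_theta_perm {m : ℕ} (σ : Equiv.Perm (Fin m)) :
    top m (theta σ) = ((Equiv.Perm.sign σ : ℤ) : ℝ) := by
  have h := theta_comp_perm (id : Fin m → Fin m) σ
  rw [Function.id_comp] at h
  rw [h, map_smul, top_theta]
  have : (fun i j => (Pi.single (id i) (1 : ℝ) : Fin m → ℝ) j) =
      (1 : Matrix (Fin m) (Fin m) ℝ) := by
    ext i j
    simp [Matrix.one_apply, Pi.single_apply, eq_comm]
  rw [this, Matrix.det_one, smul_eq_mul, mul_one]

theorem theta_of_not_injective {m p : ℕ} {I : Fin p → Fin m} (h : ¬ Function.Injective I) :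
    theta I = 0 := by
  refine ExteriorAlgebra.ιMulti_eq_zero_of_not_inj fun h' => h fun a b hab => h' ?_
  simp [hab]

variable {N : Type*} {X : Type*} [AddCommGroup X] [Module ℝ X]

/-- The generating function of a (typically alternating) function of `p` arguments, evaluated at
`∑ θᵢ ξᵢ`. -/
def gev {m p : ℕ} (ξ : Fin m → N) (F : (Fin p → N) → X) : X ⊗[ℝ] Grass m :=
  ∑ I : Fin p → Fin m, ((p.factorial : ℝ)⁻¹) • (F (ξ ∘ I) ⊗ₜ[ℝ] theta I)

/-- A repeated index kills the product of generators, and an injective multi-index of full length is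
a permutation. -/
theorem sum_sign_eq_sum_perm {m : ℕ} (F : (Fin m → Fin m) → X) :
    ∑ I : Fin m → Fin m, top m (theta I) • F I =
      ∑ σ : Equiv.Perm (Fin m), ((Equiv.Perm.sign σ : ℤ) : ℝ) • F σ := by
  refine (Fintype.sum_of_injective (fun σ : Equiv.Perm (Fin m) => (σ : Fin m → Fin m))
    DFunLike.coe_injective _ _ (fun I hI => ?_) (fun σ => ?_)).symm
  · rw [theta_of_not_injective, map_zero, zero_smul]
    intro h
    exact hI ⟨Equiv.ofBijective I (Finite.injective_iff_bijective.mp h), rfl⟩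
  · rw [top_theta_perm]

/-- The top coefficient of the generating function. -/
def topX (X : Type*) [AddCommGroup X] [Module ℝ X] (m : ℕ) : X ⊗[ℝ] Grass m →ₗ[ℝ] X :=
  TensorProduct.lift ((LinearMap.lsmul ℝ X).flip.compl₂ (top m))

@[simp] theorem topX_tmul {m : ℕ} (x : X) (a : Grass m) :
    topX X m (x ⊗ₜ a) = top m a • x := by
  simp [topX]

/-- With as many generators as arguments, only permutations reach the top degree. By alternation
each of the m! of them contributes F ξ, and the factor 1/m! in `gev` removes the multiplicity. -/
theorem topX_gev {m : ℕ} (ξ : Fin m → N) (F : (Fin m → N) → X)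
    (hF : ∀ (σ : Equiv.Perm (Fin m)) v, F (v ∘ σ) = ((Equiv.Perm.sign σ : ℤ) : ℝ) • F v) :
    topX X m (gev ξ F) = F ξ := by
  rw [gev, map_sum]
  simp only [map_smul, topX_tmul]
  rw [← Finset.smul_sum, sum_sign_eq_sum_perm (fun I => F (ξ ∘ I))]
  have : ∀ σ : Equiv.Perm (Fin m), ((Equiv.Perm.sign σ : ℤ) : ℝ) • F (ξ ∘ σ) = F ξ := by
    intro σ
    rw [hF, smul_smul, ← Int.cast_mul, ← Units.val_mul, Int.units_mul_self]
    simp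
  rw [Finset.sum_congr rfl fun σ _ => this σ, Finset.sum_const, Finset.card_univ,
    Fintype.card_perm, Fintype.card_fin, ← Nat.cast_smul_eq_nsmul ℝ, smul_smul,
    inv_mul_cancel₀ (by positivity), one_smul]

theorem gev_map {Y : Type*} [AddCommGroup Y] [Module ℝ Y] {m p : ℕ} (ξ : Fin m → N)
    (F : (Fin p → N) → X) (f : X →ₗ[ℝ] Y) :
    f.rTensor (Grass m) (gev ξ F) = gev ξ fun v => f (F v) := by
  simp [gev, map_sum]

theorem gev_smul {m p : ℕ} (ξ : Fin m → N) (F : (Fin p → N) → X) (c : ℝ) :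
    gev ξ (fun v => c • F v) = c • gev ξ F := by
  simp only [gev, Finset.smul_sum]
  refine Finset.sum_congr rfl fun I _ => ?_
  rw [← TensorProduct.smul_tmul', smul_comm]

theorem gev_add {m p : ℕ} (ξ : Fin m → N) (F G : (Fin p → N) → X) :
    gev ξ (fun v => F v + G v) = gev ξ F + gev ξ G := by
  simp only [gev, ← Finset.sum_add_distrib]
  refine Finset.sum_congr rfl fun I _ => ?_
  rw [TensorProduct.add_tmul, smul_add]

theorem gev_zero {m p : ℕ} (ξ : Fin m → N) : gev ξ (fun _ : Fin p → N => (0 : X)) = 0 := by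
  simp [gev]

/-- The antisymmetrisation of a function, without normalising factor. -/
def antisymm {n : ℕ} (G : (Fin n → N) → X) (v : Fin n → N) : X :=
  ∑ σ : Equiv.Perm (Fin n), ((Equiv.Perm.sign σ : ℤ) : ℝ) • G (v ∘ σ)

theorem antisymm_perm {n : ℕ} (G : (Fin n → N) → X) (τ : Equiv.Perm (Fin n)) (v : Fin n → N) :
    antisymm G (v ∘ τ) = ((Equiv.Perm.sign τ : ℤ) : ℝ) • antisymm G v := by
  rw [antisymm, antisymm, Finset.smul_sum]
  refine Fintype.sum_equiv (Equiv.mulLeft τ) _ _ fun σ => ?_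
  rw [smul_smul, Equiv.coe_mulLeft, Equiv.Perm.sign_mul, Units.val_mul, Int.cast_mul, ← mul_assoc,
    ← Int.cast_mul, ← Units.val_mul, Int.units_mul_self]
  simp only [Units.val_one, Int.cast_one, one_mul]
  rfl

/-- Reindexing the sum over I by σ absorbs the sign of σ, so the n! summands of `antisymm` agree and
cancel the 1/n! of `gev`. -/
theorem gev_antisymm {m n : ℕ} (ξ : Fin m → N) (G : (Fin n → N) → X) :
    gev ξ (antisymm G) = ∑ I : Fin n → Fin m, G (ξ ∘ I) ⊗ₜ[ℝ] theta I := by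
  have h1 : ∀ σ : Equiv.Perm (Fin n),
      ∑ I : Fin n → Fin m, (((Equiv.Perm.sign σ : ℤ) : ℝ) • G ((ξ ∘ I) ∘ σ)) ⊗ₜ[ℝ] theta I =
        ∑ I : Fin n → Fin m, G (ξ ∘ I) ⊗ₜ[ℝ] theta I := by
    intro σ
    rw [← (Equiv.arrowCongr σ⁻¹ (Equiv.refl (Fin m))).sum_comp
      (fun I => G (ξ ∘ I) ⊗ₜ[ℝ] theta I)]
    refine Finset.sum_congr rfl fun I _ => ?_
    have : (Equiv.arrowCongr σ⁻¹ (Equiv.refl (Fin m))) I = I ∘ σ := by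
      ext j; rfl
    rw [this, theta_comp_perm, TensorProduct.smul_tmul, Function.comp_assoc]
  simp only [gev, antisymm, TensorProduct.sum_tmul]
  rw [← Finset.smul_sum, Finset.sum_comm, Finset.sum_congr rfl fun σ _ => h1 σ, Finset.sum_const,
    Finset.card_univ, Fintype.card_perm, Fintype.card_fin, ← Nat.cast_smul_eq_nsmul ℝ, smul_smul,
    inv_mul_cancel₀ (by positivity), one_smul]

end Grassmann

section Grassmann

open scoped TensorProduct

/-! ### Products of Grassmann-valued quantities and their signs. -/

section Products

variable {m : ℕ} {X Y Z W V : Type*} [AddCommGroup X] [Module ℝ X] [AddCommGroup Y] [Module ℝ Y]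
  [AddCommGroup Z] [Module ℝ Z] [AddCommGroup W] [Module ℝ W] [AddCommGroup V] [Module ℝ V]

/-- The product of Grassmann-valued quantities that extends a bilinear map of coefficients. -/
def gmul (b : X →ₗ[ℝ] Y →ₗ[ℝ] Z) :
    X ⊗[ℝ] Grass m →ₗ[ℝ] Y ⊗[ℝ] Grass m →ₗ[ℝ] Z ⊗[ℝ] Grass m :=
  TensorProduct.map₂ b (LinearMap.mul ℝ (Grass m))

@[simp] theorem gmul_tmul (b : X →ₗ[ℝ] Y →ₗ[ℝ] Z) (x : X) (y : Y) (a c : Grass m) :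
    gmul b (x ⊗ₜ a) (y ⊗ₜ c) = b x y ⊗ₜ (a * c) := by
  simp [gmul]

/-- The elements that are homogeneous of degree `p` in the generators. -/
def homog (X : Type*) [AddCommGroup X] [Module ℝ X] (m p : ℕ) : Submodule ℝ (X ⊗[ℝ] Grass m) :=
  Submodule.span ℝ {z | ∃ (x : X) (I : Fin p → Fin m), z = x ⊗ₜ theta I}

theorem gev_mem_homog {N : Type*} {p : ℕ} (ξ : Fin m → N) (F : (Fin p → N) → X) :
    gev ξ F ∈ homog X m p :=
  Submodule.sum_mem _ fun I _ => Submodule.smul_mem _ _ (Submodule.subset_span ⟨_, I, rfl⟩)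

/-- Only the generators anticommute, so the sign depends on the degrees alone. Homogeneity is
tracked for this purpose. -/
theorem gmul_comm {p q : ℕ} (b : X →ₗ[ℝ] Y →ₗ[ℝ] Z) {x : X ⊗[ℝ] Grass m} {y : Y ⊗[ℝ] Grass m}
    (hx : x ∈ homog X m p) (hy : y ∈ homog Y m q) :
    gmul b x y = (-1 : ℝ) ^ (p * q) • gmul b.flip y x := by
  induction hx, hy using Submodule.span_induction₂ with
  | mem_mem x y hx hy =>
    obtain ⟨x, I, rfl⟩ := hx
    obtain ⟨y, J, rfl⟩ := hy
    rw [gmul_tmul, gmul_tmul, theta_mul_theta, TensorProduct.tmul_smul, LinearMap.flip_apply]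
  | zero_left y hy => simp
  | zero_right x hx => simp
  | add_left x y z _ _ _ hx hy => simp only [map_add, LinearMap.add_apply, hx, hy, smul_add]
  | add_right x y z _ _ _ hx hy => simp only [map_add, LinearMap.add_apply, hx, hy, smul_add]
  | smul_left r x y _ _ h => simp only [map_smul, LinearMap.smul_apply, h, smul_comm r]
  | smul_right r x y _ _ h => simp only [map_smul, LinearMap.smul_apply, h, smul_comm r]

theorem gmul_assoc (b₁ : X →ₗ[ℝ] Y →ₗ[ℝ] V) (b₂ : V →ₗ[ℝ] Z →ₗ[ℝ] W)
    {V' : Type*} [AddCommGroup V'] [Module ℝ V']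
    (b₃ : Y →ₗ[ℝ] Z →ₗ[ℝ] V') (b₄ : X →ₗ[ℝ] V' →ₗ[ℝ] W)
    (h : ∀ x y z, b₂ (b₁ x y) z = b₄ x (b₃ y z))
    (x : X ⊗[ℝ] Grass m) (y : Y ⊗[ℝ] Grass m) (z : Z ⊗[ℝ] Grass m) :
    gmul b₂ (gmul b₁ x y) z = gmul b₄ x (gmul b₃ y z) := by
  induction x using TensorProduct.induction_on with
  | zero => simp
  | add x x' hx hx' => simp only [map_add, LinearMap.add_apply, hx, hx']
  | tmul x a =>
  induction y using TensorProduct.induction_on with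
  | zero => simp
  | add x x' hx hx' => simp only [map_add, LinearMap.add_apply, hx, hx']
  | tmul y c =>
  induction z using TensorProduct.induction_on with
  | zero => simp
  | add x x' hx hx' => simp only [map_add, hx, hx']
  | tmul z d => simp [h, mul_assoc]

/-- A linear map of coefficients acting as a derivation with respect to products of coefficients
acts as a derivation. -/
theorem rTensor_gmul {X' Y' Z' : Type*} [AddCommGroup X'] [Module ℝ X'] [AddCommGroup Y']
    [Module ℝ Y'] [AddCommGroup Z'] [Module ℝ Z'] (b : X →ₗ[ℝ] Y →ₗ[ℝ] Z)
    (b₁ : X' →ₗ[ℝ] Y →ₗ[ℝ] Z') (b₂ : X →ₗ[ℝ] Y' →ₗ[ℝ] Z')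
    (f : Z →ₗ[ℝ] Z') (f₁ : X →ₗ[ℝ] X') (f₂ : Y →ₗ[ℝ] Y')
    (h : ∀ x y, f (b x y) = b₁ (f₁ x) y + b₂ x (f₂ y))
    (x : X ⊗[ℝ] Grass m) (y : Y ⊗[ℝ] Grass m) :
    f.rTensor _ (gmul b x y) = gmul b₁ (f₁.rTensor _ x) y + gmul b₂ x (f₂.rTensor _ y) := by
  induction x using TensorProduct.induction_on with
  | zero => simp
  | add x x' hx hx' => simp only [map_add, LinearMap.add_apply, hx, hx']; abel
  | tmul x a =>
  induction y using TensorProduct.induction_on with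
  | zero => simp
  | add x x' hx hx' => simp only [map_add, hx, hx']; abel
  | tmul y c => simp [h, TensorProduct.add_tmul]

/-- A linear map of coefficients compatible with products. -/
theorem rTensor_gmul_left {X' Z' : Type*} [AddCommGroup X'] [Module ℝ X']
    [AddCommGroup Z'] [Module ℝ Z'] (b : X →ₗ[ℝ] Y →ₗ[ℝ] Z)
    (b₁ : X' →ₗ[ℝ] Y →ₗ[ℝ] Z') (f : Z →ₗ[ℝ] Z') (f₁ : X →ₗ[ℝ] X')
    (h : ∀ x y, f (b x y) = b₁ (f₁ x) y) (x : X ⊗[ℝ] Grass m) (y : Y ⊗[ℝ] Grass m) :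
    f.rTensor _ (gmul b x y) = gmul b₁ (f₁.rTensor _ x) y := by
  induction x using TensorProduct.induction_on with
  | zero => simp
  | add x x' hx hx' => simp only [map_add, LinearMap.add_apply, hx, hx']
  | tmul x a =>
  induction y using TensorProduct.induction_on with
  | zero => simp
  | add x x' hx hx' => simp only [map_add, hx, hx']
  | tmul y c => simp [h]

theorem rTensor_gmul_right {Y' Z' : Type*} [AddCommGroup Y'] [Module ℝ Y']
    [AddCommGroup Z'] [Module ℝ Z'] (b : X →ₗ[ℝ] Y →ₗ[ℝ] Z)
    (b₁ : X →ₗ[ℝ] Y' →ₗ[ℝ] Z') (f : Z →ₗ[ℝ] Z') (f₁ : Y →ₗ[ℝ] Y')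
    (h : ∀ x y, f (b x y) = b₁ x (f₁ y)) (x : X ⊗[ℝ] Grass m) (y : Y ⊗[ℝ] Grass m) :
    f.rTensor _ (gmul b x y) = gmul b₁ x (f₁.rTensor _ y) := by
  induction x using TensorProduct.induction_on with
  | zero => simp
  | add x x' hx hx' => simp only [map_add, LinearMap.add_apply, hx, hx']
  | tmul x a =>
  induction y using TensorProduct.induction_on with
  | zero => simp
  | add x x' hx hx' => simp only [map_add, hx, hx']
  | tmul y c => simp [h]

/-- Left multiplication by a generator. -/
def lgen (X : Type*) [AddCommGroup X] [Module ℝ X] {m : ℕ} (i : Fin m) :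
    X ⊗[ℝ] Grass m →ₗ[ℝ] X ⊗[ℝ] Grass m :=
  (LinearMap.mulLeft ℝ (gen i)).lTensor X

/-- Right multiplication by a generator. -/
def rgen (X : Type*) [AddCommGroup X] [Module ℝ X] {m : ℕ} (i : Fin m) :
    X ⊗[ℝ] Grass m →ₗ[ℝ] X ⊗[ℝ] Grass m :=
  (LinearMap.mulRight ℝ (gen i)).lTensor X

@[simp] theorem lgen_tmul (i : Fin m) (x : X) (a : Grass m) :
    lgen X i (x ⊗ₜ a) = x ⊗ₜ (gen i * a) := by simp [lgen]

@[simp] theorem rgen_tmul (i : Fin m) (x : X) (a : Grass m) :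
    rgen X i (x ⊗ₜ a) = x ⊗ₜ (a * gen i) := by simp [rgen]

theorem lgen_eq_rgen {p : ℕ} (i : Fin m) {x : X ⊗[ℝ] Grass m} (hx : x ∈ homog X m p) :
    lgen X i x = (-1 : ℝ) ^ p • rgen X i x := by
  induction hx using Submodule.span_induction with
  | mem x hx =>
    obtain ⟨x, I, rfl⟩ := hx
    rw [lgen_tmul, rgen_tmul, gen_mul_theta, TensorProduct.tmul_smul]
  | zero => simp
  | add x y _ _ hx hy => simp only [map_add, hx, hy, smul_add]
  | smul r x _ h => simp only [map_smul, h, smul_comm r]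

theorem lgen_mem {p : ℕ} (i : Fin m) {x : X ⊗[ℝ] Grass m} (hx : x ∈ homog X m p) :
    lgen X i x ∈ homog X m (p + 1) := by
  induction hx using Submodule.span_induction with
  | mem x hx =>
    obtain ⟨x, I, rfl⟩ := hx
    rw [lgen_tmul, ← theta_cons]
    exact Submodule.subset_span ⟨_, _, rfl⟩
  | zero => simp
  | add x y _ _ hx hy => simp only [map_add, add_mem hx hy]
  | smul r x _ h => simp only [map_smul, Submodule.smul_mem _ _ h]

theorem lgen_gmul (b : X →ₗ[ℝ] Y →ₗ[ℝ] Z) (i : Fin m) (x : X ⊗[ℝ] Grass m)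
    (y : Y ⊗[ℝ] Grass m) : lgen Z i (gmul b x y) = gmul b (lgen X i x) y := by
  induction x using TensorProduct.induction_on with
  | zero => simp
  | add x x' hx hx' => simp only [map_add, LinearMap.add_apply, hx, hx']
  | tmul x a =>
  induction y using TensorProduct.induction_on with
  | zero => simp
  | add x x' hx hx' => simp only [map_add, hx, hx']
  | tmul y c => simp [mul_assoc]

/-- A generator standing between two factors may be counted with either of them. -/
theorem rgen_gmul (b : X →ₗ[ℝ] Y →ₗ[ℝ] Z) (i : Fin m) (x : X ⊗[ℝ] Grass m)
    (y : Y ⊗[ℝ] Grass m) : gmul b (rgen X i x) y = gmul b x (lgen Y i y) := by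
  induction x using TensorProduct.induction_on with
  | zero => simp
  | add x x' hx hx' => simp only [map_add, LinearMap.add_apply, hx, hx']
  | tmul x a =>
  induction y using TensorProduct.induction_on with
  | zero => simp
  | add x x' hx hx' => simp only [map_add, hx, hx']
  | tmul y c => simp [mul_assoc]

theorem lgen_gmul' (b : X →ₗ[ℝ] Y →ₗ[ℝ] Z) (i : Fin m) {p : ℕ} {x : X ⊗[ℝ] Grass m}
    (hx : x ∈ homog X m p) (y : Y ⊗[ℝ] Grass m) :
    lgen Z i (gmul b x y) = (-1 : ℝ) ^ p • gmul b x (lgen Y i y) := by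
  rw [lgen_gmul, lgen_eq_rgen i hx, map_smul, LinearMap.smul_apply, rgen_gmul]

/-- Elements with coefficients in a dual module are determined by their values. -/
theorem eq_zero_of_forall_rTensor {K : Type*} (e : K → X →ₗ[ℝ] Y)
    (he : ∀ x, (∀ k, e k x = 0) → x = 0) (z : X ⊗[ℝ] Grass m)
    (hz : ∀ k, (e k).rTensor _ z = 0) : z = 0 := by
  -- In a basis of the Grassmann algebra, z is a finite family of coefficients in X, on which `e k`
  -- acts one coefficient at a time.
  let 𝒞 := Module.Free.chooseBasis ℝ (Grass m)
  apply (TensorProduct.equivFinsuppOfBasisRight (M := X) 𝒞).injective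
  rw [map_zero]
  ext j
  refine he _ fun k => ?_
  have h : ∀ z : X ⊗[ℝ] Grass m, e k (TensorProduct.equivFinsuppOfBasisRight (M := X) 𝒞 z j) =
      TensorProduct.equivFinsuppOfBasisRight (M := Y) 𝒞 ((e k).rTensor _ z) j := by
    intro z
    induction z using TensorProduct.induction_on with
    | zero => simp
    | add x x' hx hx' => simp only [map_add, hx, hx', Finsupp.add_apply]
    | tmul x a => simp
  rw [h, hz]
  simp

end Products

/-! ### Differentiation in the first Grassmann variable. -/

section Contraction

variable {m : ℕ}

/-- Setting the first generator to zero. -/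
def dropGen (m : ℕ) : Grass (m + 1) →ₐ[ℝ] Grass m :=
  ExteriorAlgebra.map (LinearMap.funLeft ℝ ℝ (Fin.succ : Fin m → Fin (m + 1)))

/-- The derivative with respect to the first generator, followed by setting that generator to
zero. -/
def derGen (m : ℕ) : Grass (m + 1) →ₗ[ℝ] Grass m :=
  (dropGen m).toLinearMap ∘ₗ CliffordAlgebra.contractLeft (LinearMap.proj (0 : Fin (m + 1)))

theorem funLeft_single_zero : LinearMap.funLeft ℝ ℝ (Fin.succ : Fin m → Fin (m + 1))
    (Pi.single 0 1) = 0 := by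
  ext j; simp [LinearMap.funLeft_apply]

theorem funLeft_single_succ (i : Fin m) : LinearMap.funLeft ℝ ℝ (Fin.succ : Fin m → Fin (m + 1))
    (Pi.single i.succ 1) = Pi.single i 1 := by
  ext j; simp [LinearMap.funLeft_apply, Pi.single_apply]

theorem dropGen_theta_succ {p : ℕ} (I : Fin p → Fin m) :
    dropGen m (theta (fun j => (I j).succ)) = theta I := by
  rw [dropGen, theta, ExteriorAlgebra.map_apply_ιMulti, theta]
  congr 1
  ext1 j
  exact funLeft_single_succ _

theorem dropGen_theta_of_zero {p : ℕ} (I : Fin p → Fin (m + 1)) {j : Fin p} (hj : I j = 0) :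
    dropGen m (theta I) = 0 := by
  rw [dropGen, theta, ExteriorAlgebra.map_apply_ιMulti]
  apply AlternatingMap.map_coord_zero _ j
  simp only [Function.comp_apply, hj, funLeft_single_zero]

theorem dropGen_gen_zero : dropGen m (gen 0) = 0 := by
  rw [dropGen, gen, ExteriorAlgebra.map_apply_ι, funLeft_single_zero, map_zero]

theorem derGen_one : derGen m 1 = 0 := by
  have : CliffordAlgebra.contractLeft (LinearMap.proj (0 : Fin (m + 1))) (1 : Grass (m + 1)) = 0 :=
    CliffordAlgebra.contractLeft_one _ _
  simp [derGen, this]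

/-- Clifford contraction for the zero quadratic form is the left derivative, an antiderivation.
Setting the generator to zero afterwards turns every undifferentiated factor into its image under
`dropGen`. -/
theorem derGen_gen_mul (i : Fin (m + 1)) (a : Grass (m + 1)) :
    derGen m (gen i * a) =
      (if i = 0 then dropGen m a else 0) - dropGen m (gen i) * derGen m a := by
  have := CliffordAlgebra.contractLeft_ι_mul (Q := (0 : QuadraticForm ℝ (Fin (m + 1) → ℝ)))
    (LinearMap.proj (0 : Fin (m + 1))) (Pi.single i 1) a
  have h : derGen m (gen i * a) = dropGen m
      ((LinearMap.proj (R := ℝ) (φ := fun _ : Fin (m + 1) => ℝ) 0) (Pi.single i 1) • a - gen i *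
        CliffordAlgebra.contractLeft (LinearMap.proj (0 : Fin (m + 1))) a) :=
    congrArg (dropGen m) this
  rw [h, map_sub, map_smul, map_mul]
  congr 1
  by_cases h : i = 0 <;> simp [h, eq_comm]

theorem derGen_theta_mul {p : ℕ} (I : Fin p → Fin (m + 1)) (a : Grass (m + 1)) :
    derGen m (theta I * a) = derGen m (theta I) * dropGen m a +
      (-1 : ℝ) ^ p • (dropGen m (theta I) * derGen m a) := by
  induction p with
  | zero => simp [theta, derGen_one]
  | succ p ih =>
    have e : I = Fin.cons (I 0) (Fin.tail I) := (Fin.cons_self_tail I).symm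
    rw [e, theta_cons, mul_assoc, derGen_gen_mul, ih, derGen_gen_mul]
    by_cases h : I 0 = 0
    · simp [h, dropGen_gen_zero]
    · simp only [h, if_false, zero_sub, map_mul, mul_add, mul_smul_comm, pow_succ, mul_neg_one,
        neg_smul, neg_mul, mul_assoc, neg_add]

theorem derGen_theta_succ {p : ℕ} (I : Fin p → Fin m) :
    derGen m (theta fun j => (I j).succ) = 0 := by
  induction p with
  | zero =>
    have : theta (fun j => (I j).succ) = (1 : Grass (m + 1)) := by simp [theta]
    rw [this, derGen_one]
  | succ p ih =>
    have e : (fun j => (I j).succ) = Fin.cons (I 0).succ (fun j => ((Fin.tail I) j).succ) := by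
      ext1 j; refine Fin.cases ?_ (fun i => ?_) j <;> rfl
    rw [e, theta_cons, derGen_gen_mul, ih]
    simp

end Contraction

end Grassmann

section Grassmann

open scoped TensorProduct

/-! ### Contraction of generating functions. -/

section Contraction

variable {m : ℕ} {X Y Z : Type*} [AddCommGroup X] [Module ℝ X] [AddCommGroup Y] [Module ℝ Y]
  [AddCommGroup Z] [Module ℝ Z] {N : Type*}

/-- Setting the first generator to zero, with coefficients in `X`. -/
def dropX (X : Type*) [AddCommGroup X] [Module ℝ X] (m : ℕ) :
    X ⊗[ℝ] Grass (m + 1) →ₗ[ℝ] X ⊗[ℝ] Grass m :=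
  (dropGen m).toLinearMap.lTensor X

/-- The derivative with respect to the first generator, with coefficients in `X`. -/
def derX (X : Type*) [AddCommGroup X] [Module ℝ X] (m : ℕ) :
    X ⊗[ℝ] Grass (m + 1) →ₗ[ℝ] X ⊗[ℝ] Grass m :=
  (derGen m).lTensor X

@[simp] theorem dropX_tmul (x : X) (a : Grass (m + 1)) :
    dropX X m (x ⊗ₜ a) = x ⊗ₜ dropGen m a := by simp [dropX]

@[simp] theorem derX_tmul (x : X) (a : Grass (m + 1)) :
    derX X m (x ⊗ₜ a) = x ⊗ₜ derGen m a := by simp [derX]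

theorem derX_gmul (b : X →ₗ[ℝ] Y →ₗ[ℝ] Z) {p : ℕ} {x : X ⊗[ℝ] Grass (m + 1)}
    (hx : x ∈ homog X (m + 1) p) (y : Y ⊗[ℝ] Grass (m + 1)) :
    derX Z m (gmul b x y) = gmul b (derX X m x) (dropX Y m y) +
      (-1 : ℝ) ^ p • gmul b (dropX X m x) (derX Y m y) := by
  induction hx using Submodule.span_induction with
  | mem x hx =>
    obtain ⟨x, I, rfl⟩ := hx
    induction y using TensorProduct.induction_on with
    | zero => simp
    | add y y' hy hy' => simp only [map_add, hy, hy', smul_add]; abel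
    | tmul y c => simp [derGen_theta_mul, TensorProduct.tmul_add]
  | zero => simp
  | add x x' _ _ hx hx' => simp only [map_add, LinearMap.add_apply, hx, hx', smul_add]; abel
  | smul r x _ h => simp only [map_smul, LinearMap.smul_apply, h, smul_add, smul_comm r]

/-- Multi-indices that meet 0 are killed by `dropGen`; the others are shifted multi-indices in `Fin
m`. -/
theorem sum_dropGen {p : ℕ} (H : (Fin p → Fin (m + 1)) → X) :
    ∑ I : Fin p → Fin (m + 1), H I ⊗ₜ[ℝ] dropGen m (theta I) =
      ∑ I : Fin p → Fin m, H (fun j => (I j).succ) ⊗ₜ[ℝ] theta I := by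
  refine (Fintype.sum_of_injective (fun (I : Fin p → Fin m) j => (I j).succ) (fun I J h => ?_) _ _
    (fun I hI => ?_) (fun I => ?_)).symm
  · ext1 j
    exact Fin.succ_injective _ (congrFun h j)
  · by_cases h : ∃ j, I j = 0
    · obtain ⟨j, hj⟩ := h
      rw [dropGen_theta_of_zero I hj, TensorProduct.tmul_zero]
    · push Not at h
      exact absurd ⟨fun j => (I j).pred (h j), by ext1 j; simp⟩ hI
  · rw [dropGen_theta_succ]

/-- The argument ζ is attached to the first generator, so it disappears when that generator is set
to zero. -/
theorem dropX_gev {p : ℕ} (ζ : N) (ξ : Fin m → N) (F : (Fin p → N) → X) :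
    dropX X m (gev (Fin.cons ζ ξ : Fin (m + 1) → N) F) = gev ξ F := by
  simp only [gev, map_sum, map_smul, dropX_tmul]
  rw [← Finset.smul_sum, sum_dropGen (fun I => F ((Fin.cons ζ ξ : Fin (m + 1) → N) ∘ I)),
    Finset.smul_sum]
  refine Finset.sum_congr rfl fun I _ => ?_
  congr 3

theorem theta_zero_arg (I : Fin 0 → Fin m) : theta I = 1 := by simp [theta]

theorem derX_gev_zero (ξ : Fin (m + 1) → N) (F : (Fin 0 → N) → X) :
    derX X m (gev ξ F) = 0 := by
  simp [gev, theta_zero_arg, derGen_one]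

/-- A sum over multi-indices, split according to the index in slot `j`. -/
theorem sum_insertNth {m p : ℕ} {Z : Type*} [AddCommMonoid Z] (j : Fin (p + 1))
    (H : (Fin (p + 1) → Fin m) → Z) :
    ∑ I, H I = ∑ a : Fin m, ∑ J : Fin p → Fin m, H (j.insertNth a J) := by
  rw [← Fintype.sum_prod_type']
  exact (Fintype.sum_equiv (Fin.insertNthEquiv (fun _ => Fin m) j) _ _ fun x => rfl).symm

theorem comp_insertNth {A B : Type*} {p : ℕ} (f : A → B) (j : Fin (p + 1)) (a : A)
    (J : Fin p → A) :
    f ∘ (j.insertNth a J : Fin (p + 1) → A) = j.insertNth (f a) (f ∘ J) := by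
  ext k
  refine j.succAboveCases ?_ (fun i => ?_) k <;> simp

/-- Contraction with respect to the first generator inserts into the first slot. -/
theorem derX_gev_succ {p : ℕ} (ζ : N) (ξ : Fin m → N) (F : (Fin (p + 1) → N) → X)
    (hF : ∀ (j : Fin (p + 1)) x v, F (j.insertNth x v) = (-1 : ℝ) ^ (j : ℕ) • F (Fin.cons x v)) :
    derX X m (gev (Fin.cons ζ ξ : Fin (m + 1) → N) F) = gev ξ fun v => F (Fin.cons ζ v) := by
  rw [← dropX_gev ζ ξ (fun v => F (Fin.cons ζ v))]
  set ξ' : Fin (m + 1) → N := Fin.cons ζ ξ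
  -- the derivative of a product of generators, slot by slot
  have key : ∀ I : Fin (p + 1) → Fin (m + 1), derGen m (theta I) =
      ∑ j : Fin (p + 1), if I j = 0 then (-1 : ℝ) ^ (j : ℕ) • dropGen m (theta (j.removeNth I))
        else 0 := by
    intro I
    by_cases h : ∃ j, I j = 0
    · obtain ⟨j, hj⟩ := h
      rw [Finset.sum_eq_single j]
      · have e : I = j.insertNth 0 (j.removeNth I) := by
          rw [← hj, Fin.insertNth_self_removeNth]
        rw [if_pos hj]
        conv_lhs => rw [e, theta_insertNth, map_smul, derGen_gen_mul]
        simp [dropGen_gen_zero]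
      · intro k _ hk
        obtain ⟨l, rfl⟩ := Fin.exists_succAbove_eq (Ne.symm hk)
        split_ifs with h0
        · rw [dropGen_theta_of_zero _ (j := l) (by simpa [Fin.removeNth] using hj), smul_zero]
        · rfl
      · simp
    · push Not at h
      rw [Finset.sum_eq_zero fun j _ => if_neg (h j)]
      have e : I = fun j => ((I j).pred (h j)).succ := by ext1 j; simp
      rw [e, derGen_theta_succ]
  simp only [gev, map_sum, map_smul, derX_tmul, dropX_tmul, key, TensorProduct.tmul_sum]
  simp only [← Finset.smul_sum]
  rw [Finset.sum_comm]
  have h2 : ∀ j : Fin (p + 1), ∑ I : Fin (p + 1) → Fin (m + 1), F (ξ' ∘ I) ⊗ₜ[ℝ]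
      (if I j = 0 then (-1 : ℝ) ^ (j : ℕ) • dropGen m (theta (j.removeNth I)) else 0) =
      ∑ J : Fin p → Fin (m + 1), F (Fin.cons ζ (ξ' ∘ J)) ⊗ₜ[ℝ] dropGen m (theta J) := by
    intro j
    rw [sum_insertNth j, Finset.sum_eq_single 0]
    · refine Finset.sum_congr rfl fun J _ => ?_
      rw [Fin.insertNth_apply_same, if_pos rfl, Fin.removeNth_insertNth, comp_insertNth, hF,
        TensorProduct.smul_tmul, smul_smul, ← pow_add, Even.neg_one_pow ⟨_, rfl⟩, one_smul]
      rfl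
    · intro a _ ha
      refine Finset.sum_eq_zero fun J _ => ?_
      rw [Fin.insertNth_apply_same, if_neg ha, TensorProduct.tmul_zero]
    · simp
  -- Each of the p + 1 slots contributes the same sum, and (p + 1)/(p + 1)! = 1/p!.
  rw [Finset.sum_congr rfl fun j _ => h2 j, Finset.sum_const, Finset.card_univ, Fintype.card_fin,
    ← Nat.cast_smul_eq_nsmul ℝ, smul_smul]
  congr 1
  rw [Nat.factorial_succ]
  push_cast
  have : (p.factorial : ℝ) ≠ 0 := by positivity
  field_simp

end Contraction

/-! ### Alternating maps over a commutative algebra -/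

section Alternating

variable {R N : Type*} [CommRing R] [Algebra ℝ R] [AddCommGroup N] [Module R N]

theorem alternating_perm {p : ℕ} (P : N [⋀^Fin p]→ₗ[R] R) (σ : Equiv.Perm (Fin p))
    (v : Fin p → N) : P (v ∘ σ) = ((Equiv.Perm.sign σ : ℤ) : ℝ) • P v := by
  rw [P.map_perm, Units.smul_def, Int.cast_smul_eq_zsmul]

theorem alternating_insertNth {p : ℕ} (P : N [⋀^Fin (p + 1)]→ₗ[R] R) (j : Fin (p + 1)) (x : N)
    (v : Fin p → N) : P (j.insertNth x v) = (-1 : ℝ) ^ (j : ℕ) • P (Fin.cons x v) := by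
  rw [P.map_insertNth, ← Int.cast_smul_eq_zsmul ℝ]
  push_cast
  rfl

/-- The values of an alternating map are the top coefficients of its generating functions, by
`topX_gev`. Every identity of multivectors below is proved through this. -/
theorem alternating_ext_gev {p : ℕ} {P Q : N [⋀^Fin p]→ₗ[R] R}
    (h : ∀ ξ : Fin p → N, gev ξ P = gev ξ Q) : P = Q := by
  ext ξ
  rw [← topX_gev ξ P (alternating_perm P), h, topX_gev ξ Q (alternating_perm Q)]

/-- The first slot of an alternating map. -/
def slot {p : ℕ} (P : N [⋀^Fin (p + 1)]→ₗ[R] R) (v : Fin p → N) : Module.Dual R N where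
  toFun ζ := P (Fin.cons ζ v)
  map_add' x y := congrArg (fun f => f v) (map_add P.curryLeft x y)
  map_smul' c x := congrArg (fun f => f v) (map_smul P.curryLeft c x)

@[simp] theorem slot_apply {p : ℕ} (P : N [⋀^Fin (p + 1)]→ₗ[R] R) (v : Fin p → N) (ζ : N) :
    slot P v ζ = P (Fin.cons ζ v) := rfl

/-- Evaluation of linear forms. -/
def evalAt (R : Type*) {N : Type*} [CommRing R] [Algebra ℝ R] [AddCommGroup N] [Module R N]
    (ζ : N) : Module.Dual R N →ₗ[ℝ] R where
  toFun φ := φ ζ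
  map_add' _ _ := rfl
  map_smul' _ _ := rfl

@[simp] theorem evalAt_apply (ζ : N) (φ : Module.Dual R N) : evalAt R ζ φ = φ ζ := rfl

/-- The generating function of an alternating map whose first slot is left free. -/
def gevL {m : ℕ} (ξ : Fin m → N) :
    {p : ℕ} → (N [⋀^Fin p]→ₗ[R] R) → Module.Dual R N ⊗[ℝ] Grass m
  | 0, _ => 0
  | _ + 1, P => gev ξ (slot P)

/-- The free slot is tested on an extra argument ζ carried by an extra generator. Contraction
thereby becomes a derivative and inherits the product rule `derX_gmul`. -/
theorem rTensor_gevL {m p : ℕ} (ξ : Fin m → N) (P : N [⋀^Fin p]→ₗ[R] R) (ζ : N) :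
    (evalAt R ζ).rTensor _ (gevL ξ P) = derX R m (gev (Fin.cons ζ ξ : Fin (m + 1) → N) P) := by
  cases p with
  | zero => simp [gevL, derX_gev_zero]
  | succ p =>
    rw [gevL, gev_map, derX_gev_succ ζ ξ P (alternating_insertNth P)]
    rfl

/-- The product of scalars and linear forms. -/
def smulDual (R N : Type*) [CommRing R] [Algebra ℝ R] [AddCommGroup N] [Module R N] :
    R →ₗ[ℝ] Module.Dual R N →ₗ[ℝ] Module.Dual R N :=
  LinearMap.mk₂ ℝ (fun f φ => f • φ) (fun _ _ _ => add_smul _ _ _) (fun _ _ _ => smul_assoc _ _ _)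
    (fun _ _ _ => smul_add _ _ _) (fun _ _ _ => smul_comm _ _ _)

@[simp] theorem smulDual_apply (f : R) (φ : Module.Dual R N) : smulDual R N f φ = f • φ := rfl

theorem gevL_ext {m : ℕ} {x y : Module.Dual R N ⊗[ℝ] Grass m}
    (h : ∀ ζ, (evalAt R ζ).rTensor _ x = (evalAt R ζ).rTensor _ y) : x = y := by
  refine sub_eq_zero.mp (eq_zero_of_forall_rTensor (evalAt R) (fun φ hφ => ?_) _ fun ζ => ?_)
  · ext ζ; exact hφ ζ
  · rw [map_sub, h, sub_self]

theorem gevL_mem_homog {m p : ℕ} (ξ : Fin m → N) (P : N [⋀^Fin (p + 1)]→ₗ[R] R) :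
    gevL ξ P ∈ homog _ m p := gev_mem_homog ξ _

/-- Insertion into the first slot is an antiderivation of the wedge product. -/
theorem gevL_of_gev_eq {n p₁ q₁ p₂ q₂ : ℕ} (Z : N [⋀^Fin n]→ₗ[R] R) (A₁ : N [⋀^Fin p₁]→ₗ[R] R)
    (B₁ : N [⋀^Fin q₁]→ₗ[R] R) (A₂ : N [⋀^Fin p₂]→ₗ[R] R) (B₂ : N [⋀^Fin q₂]→ₗ[R] R)
    (c₁ c₂ : ℝ)
    (h : ∀ (m : ℕ) (ξ : Fin m → N), gev ξ Z =
      c₁ • gmul (LinearMap.mul ℝ R) (gev ξ A₁) (gev ξ B₁) +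
      c₂ • gmul (LinearMap.mul ℝ R) (gev ξ A₂) (gev ξ B₂)) {m : ℕ} (ξ : Fin m → N) :
    gevL ξ Z =
      c₁ • (gmul (smulDual R N).flip (gevL ξ A₁) (gev ξ B₁) +
        (-1 : ℝ) ^ p₁ • gmul (smulDual R N) (gev ξ A₁) (gevL ξ B₁)) +
      c₂ • (gmul (smulDual R N).flip (gevL ξ A₂) (gev ξ B₂) +
        (-1 : ℝ) ^ p₂ • gmul (smulDual R N) (gev ξ A₂) (gevL ξ B₂)) := by
  refine gevL_ext fun ζ => ?_
  have e1 : ∀ x : Module.Dual R N ⊗[ℝ] Grass m, ∀ y,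
      (evalAt R ζ).rTensor _ (gmul (smulDual R N).flip x y) =
        gmul (LinearMap.mul ℝ R) ((evalAt R ζ).rTensor _ x) y :=
    rTensor_gmul_left _ _ _ _ fun x y => by simp [mul_comm]
  have e2 : ∀ x, ∀ y : Module.Dual R N ⊗[ℝ] Grass m,
      (evalAt R ζ).rTensor _ (gmul (smulDual R N) x y) =
        gmul (LinearMap.mul ℝ R) x ((evalAt R ζ).rTensor _ y) :=
    rTensor_gmul_right _ _ _ _ fun x y => by simp
  simp only [map_add, map_smul, e1, e2, rTensor_gevL]
  -- The hypothesis is applied to the m + 1 arguments ζ, ξ; this is why it is required for every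
  -- number of arguments.
  rw [h, map_add, map_smul, map_smul, derX_gmul _ (gev_mem_homog _ _),
    derX_gmul _ (gev_mem_homog _ _)]
  simp only [dropX_gev]

end Alternating

end Grassmann

/-! ### The differential of an algebraic Lie algebroid -/

section Differential

open scoped TensorProduct

variable {R N : Type*} [CommRing R] [Algebra ℝ R] [AddCommGroup N] [Module R N]

/-- An anchor and a skew bracket that satisfy the Leibniz rule. -/
structure AnchoredBracket (R N : Type*) [CommRing R] [Algebra ℝ R] [AddCommGroup N] [Module R N]
    [Module ℝ N] where
  /-- The anchor. -/
  anchor : N →ₗ[R] Derivation ℝ R R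
  /-- The bracket. -/
  bracket : N →ₗ[ℝ] N →ₗ[ℝ] N
  skew : ∀ x y, bracket x y = -bracket y x
  leibniz : ∀ x (f : R) y, bracket x (f • y) = f • bracket x y + anchor x f • y

/-- An alternating map over `ℝ` that is homogeneous over `R` in its first slot. -/
def AlternatingMap.ofHomogeneous [Module ℝ N] {n : ℕ} (F : N [⋀^Fin (n + 1)]→ₗ[ℝ] R)
    (h : ∀ (g : R) (x : N) (w : Fin n → N),
      F (Fin.cons (g • x) w : Fin (n + 1) → N) = g * F (Fin.cons x w : Fin (n + 1) → N)) :
    N [⋀^Fin (n + 1)]→ₗ[R] R where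
  toFun := F
  map_update_add' := by
    intro _ v i x y
    exact F.map_update_add v i x y
  map_update_smul' := by
    intro inst v i c x
    obtain rfl : inst = instDecidableEqFin (n + 1) := Subsingleton.elim _ _
    -- Alternation moves slot i to the front up to a sign, so homogeneity in the first slot is
    -- enough.
    have e : ∀ y : N, F (Function.update v i y) =
        (-1 : ℤ) ^ (i : ℕ) • F (Fin.cons y (i.removeNth v) : Fin (n + 1) → N) := by
      intro y
      have := F.map_insertNth i y (i.removeNth v)
      rw [Fin.insertNth_removeNth] at this
      exact this
    change F _ = c • F _
    rw [e, e, h, smul_eq_mul, mul_smul_comm]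
  map_eq_zero_of_eq' := F.map_eq_zero_of_eq'

@[simp] theorem AlternatingMap.coe_ofHomogeneous [Module ℝ N] {n : ℕ}
    (F : N [⋀^Fin (n + 1)]→ₗ[ℝ] R) (h) : ⇑(AlternatingMap.ofHomogeneous F h) = F := rfl

variable [Module ℝ N] [IsScalarTower ℝ R N]

/-- An alternating map over `R`, considered over `ℝ`. -/
def altReal {p : ℕ} (P : N [⋀^Fin p]→ₗ[R] R) : N [⋀^Fin p]→ₗ[ℝ] R where
  toMultilinearMap := P.toMultilinearMap.restrictScalars ℝ
  map_eq_zero_of_eq' := P.map_eq_zero_of_eq'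

@[simp] theorem altReal_apply {p : ℕ} (P : N [⋀^Fin p]→ₗ[R] R) (v) : altReal P v = P v := rfl

namespace AnchoredBracket

variable (𝒜 : AnchoredBracket R N)

/-- The derivative of the values of an alternating map. -/
def lieAlt {p : ℕ} (P : N [⋀^Fin p]→ₗ[R] R) : N →ₗ[ℝ] N [⋀^Fin p]→ₗ[ℝ] R where
  toFun ζ := (𝒜.anchor ζ).toLinearMap.compAlternatingMap (altReal P)
  map_add' x y := by ext v; simp
  map_smul' c x := by
    ext v
    have : 𝒜.anchor (c • x) = c • 𝒜.anchor x := by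
      rw [← algebraMap_smul R c x, map_smul, algebraMap_smul]
    simp [this]

@[simp] theorem lieAlt_apply {p : ℕ} (P : N [⋀^Fin p]→ₗ[R] R) (ζ : N) (v : Fin p → N) :
    𝒜.lieAlt P ζ v = 𝒜.anchor ζ (P v) := rfl

/-- The insertion of brackets into the first slot of an alternating map. -/
def brAlt {k : ℕ} (P : N [⋀^Fin (k + 1)]→ₗ[R] R) : N →ₗ[ℝ] N →ₗ[ℝ] N [⋀^Fin k]→ₗ[ℝ] R :=
  𝒜.bracket.compr₂ (altReal P).curryLeft

@[simp] theorem brAlt_apply {k : ℕ} (P : N [⋀^Fin (k + 1)]→ₗ[R] R) (ζ η : N) (v : Fin k → N) :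
    𝒜.brAlt P ζ η v = P (Fin.cons (𝒜.bracket ζ η) v) := rfl

/-- The differential, as an alternating map over `ℝ`. -/
def dReal : {p : ℕ} → (N [⋀^Fin p]→ₗ[R] R) → N [⋀^Fin (p + 1)]→ₗ[ℝ] R
  | 0, P => AlternatingMap.alternatizeUncurryFin (𝒜.lieAlt P)
  -- The double alternatisation meets each pair of slots in both orders. For a skew bracket this
  -- doubles the usual sum, hence the factor 1/2.
  | _ + 1, P => AlternatingMap.alternatizeUncurryFin (𝒜.lieAlt P) -
      (1 / 2 : ℝ) • AlternatingMap.alternatizeUncurryFin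
        (AlternatingMap.alternatizeUncurryFinLM ∘ₗ 𝒜.brAlt P)

/-- The index j stands for slot j + 1, so j ≥ i runs over the pairs i < j + 1. The leading minus
sign turns (−1)^(i+j) into the customary (−1)^(i+(j+1)). -/
theorem dReal_succ_apply {k : ℕ} (P : N [⋀^Fin (k + 1)]→ₗ[R] R) (v : Fin (k + 2) → N) :
    𝒜.dReal P v =
      ∑ i : Fin (k + 2), (-1 : ℝ) ^ (i : ℕ) • 𝒜.anchor (v i) (P (i.removeNth v)) -
      ∑ i : Fin (k + 1), ∑ j ≥ i, (-1 : ℝ) ^ (i + j : ℕ) •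
        P (Fin.cons (𝒜.bracket (v i.castSucc) (v j.succ))
          (j.removeNth (i.castSucc.removeNth v))) := by
  have hz : ∀ (n : ℕ) (x : R), (-1 : ℤ) ^ n • x = (-1 : ℝ) ^ n • x := by
    intro n x
    rw [← Int.cast_smul_eq_zsmul ℝ]
    push_cast
    rfl
  rw [dReal, AlternatingMap.sub_apply, AlternatingMap.smul_apply,
    AlternatingMap.alternatizeUncurryFin_alternatizeUncurryFinLM_comp_apply,
    AlternatingMap.alternatizeUncurryFin_apply]
  simp only [hz, lieAlt_apply, brAlt_apply]
  congr 1
  simp only [Finset.smul_sum]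
  refine Finset.sum_congr rfl fun i _ => Finset.sum_congr rfl fun j _ => ?_
  have : P (Fin.cons (𝒜.bracket (v j.succ) (v i.castSucc))
      (j.removeNth (i.castSucc.removeNth v))) = -P (Fin.cons (𝒜.bracket (v i.castSucc) (v j.succ))
      (j.removeNth (i.castSucc.removeNth v))) := by
    rw [𝒜.skew]
    exact map_neg (slot P _) _
  rw [this, sub_neg_eq_add, ← two_smul ℝ, smul_comm _ (2 : ℝ), smul_smul]
  norm_num

theorem leibniz_left (x y : N) (f : R) :
    𝒜.bracket (f • x) y = f • 𝒜.bracket x y - 𝒜.anchor y f • x := by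
  rw [𝒜.skew, 𝒜.leibniz, 𝒜.skew y x]
  module

/-- The factor g is differentiated in two places: by the anchors of the other arguments, and in the
brackets of g • x with them. The two contributions cancel. This is what makes the differential
function-linear; the Jacobi identity plays no role. -/
theorem dReal_homogeneous {p : ℕ} (P : N [⋀^Fin p]→ₗ[R] R) (g : R) (x : N) (w : Fin p → N) :
    𝒜.dReal P (Fin.cons (g • x) w : Fin (p + 1) → N) =
      g * 𝒜.dReal P (Fin.cons x w : Fin (p + 1) → N) := by
  cases p with
  | zero =>
    have h : ∀ v : Fin 0 → N, P v = P ![] := fun v => congrArg P (Subsingleton.elim _ _)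
    simp [dReal, AlternatingMap.alternatizeUncurryFin_apply, h]
  | succ k =>
    have h1 : ∀ (i : Fin (k + 1)) (y : N), i.succ.removeNth (Fin.cons y w : Fin (k + 2) → N) =
        Fin.cons y (i.removeNth w) := by
      intro i y
      ext l
      refine Fin.cases ?_ (fun l => ?_) l <;> simp [Fin.removeNth]
    have h2 : ∀ (y z : N) (u : Fin k → N), P (Fin.cons (g • y) u) = g * P (Fin.cons y u) :=
      fun y z u => map_smul (slot P u) g y
    -- When the bracket does not involve slot 0, the element x survives as the first of the
    -- remaining arguments, where P is function-linear.
    have h3 : ∀ (i : Fin k) (j : Fin (k + 1)), i.succ ≤ j → ∀ b,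
        P (Fin.cons b (j.removeNth (i.succ.castSucc.removeNth (Fin.cons (g • x) w :
          Fin (k + 2) → N)))) =
        g * P (Fin.cons b (j.removeNth (i.succ.castSucc.removeNth (Fin.cons x w :
          Fin (k + 2) → N)))) := by
      intro i j hij b
      cases k with
      | zero => exact i.elim0
      | succ k =>
        have hj : j ≠ 0 := fun h => by rw [h] at hij; exact absurd hij (by simp)
        have e : ∀ y : N, j.removeNth (i.succ.castSucc.removeNth (Fin.cons y w :
            Fin (k + 3) → N)) =
            Function.update (j.removeNth (i.succ.castSucc.removeNth (Fin.cons x w :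
              Fin (k + 3) → N))) 0 y := by
          intro y
          ext l
          by_cases hl : l = 0
          · subst hl
            have e1 : j.succAbove 0 = 0 := Fin.succAbove_ne_zero_zero hj
            have e2 : i.succ.castSucc.succAbove 0 = 0 := Fin.succAbove_ne_zero_zero (by simp)
            change (Fin.cons y w : Fin (k + 3) → N)
              (i.succ.castSucc.succAbove (j.succAbove 0)) = _
            rw [e1, e2]
            simp
          · rw [Function.update_of_ne hl]
            have e1 : j.succAbove l ≠ 0 := Fin.succAbove_ne_zero hj hl
            have e2 : i.succ.castSucc.succAbove (j.succAbove l) ≠ 0 :=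
              Fin.succAbove_ne_zero (by simp) e1
            obtain ⟨t, ht⟩ := Fin.exists_succ_eq.mpr e2
            change (Fin.cons y w : Fin (k + 3) → N) (i.succ.castSucc.succAbove (j.succAbove l)) =
              (Fin.cons x w : Fin (k + 3) → N) (i.succ.castSucc.succAbove (j.succAbove l))
            rw [← ht]
            simp
        have e3 := (P.curryLeft b).map_update_smul
          (j.removeNth (i.succ.castSucc.removeNth (Fin.cons x w : Fin (k + 3) → N))) 0 g x
        rw [← e, ← e] at e3
        exact e3
    have hI : Finset.Ici (0 : Fin (k + 1)) = Finset.univ := by ext; simp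
    have h4 : ∀ i : Fin (k + 1), (-1 : ℝ) ^ ((i.succ : Fin (k + 2)) : ℕ) •
        𝒜.anchor ((Fin.cons (g • x) w : Fin (k + 2) → N) i.succ)
          (P (i.succ.removeNth (Fin.cons (g • x) w : Fin (k + 2) → N))) =
        g * ((-1 : ℝ) ^ ((i.succ : Fin (k + 2)) : ℕ) •
          𝒜.anchor ((Fin.cons x w : Fin (k + 2) → N) i.succ)
          (P (i.succ.removeNth (Fin.cons x w : Fin (k + 2) → N)))) -
        (-1 : ℝ) ^ (i : ℕ) • (𝒜.anchor (w i) g * P (Fin.cons x (i.removeNth w))) := by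
      intro i
      rw [h1, h1, h2 x x]
      simp only [Fin.cons_succ, Derivation.leibniz, Fin.val_succ, pow_succ, smul_eq_mul]
      rw [mul_neg_one, neg_smul, neg_smul, smul_add, mul_neg, mul_smul_comm, mul_comm (P _)]
      abel
    -- The correction term is the one found in `h4`. The bracket sum is subtracted in the
    -- differential, so the corrections cancel.
    have h5 : ∀ j : Fin (k + 1), (-1 : ℝ) ^ (((0 : Fin (k + 1)) : ℕ) + j : ℕ) •
        P (Fin.cons (𝒜.bracket ((Fin.cons (g • x) w : Fin (k + 2) → N) (0 : Fin (k + 1)).castSucc)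
          ((Fin.cons (g • x) w : Fin (k + 2) → N) j.succ))
          (j.removeNth ((0 : Fin (k + 1)).castSucc.removeNth
            (Fin.cons (g • x) w : Fin (k + 2) → N)))) =
        g * ((-1 : ℝ) ^ (((0 : Fin (k + 1)) : ℕ) + j : ℕ) •
        P (Fin.cons (𝒜.bracket ((Fin.cons x w : Fin (k + 2) → N) (0 : Fin (k + 1)).castSucc)
          ((Fin.cons x w : Fin (k + 2) → N) j.succ))
          (j.removeNth ((0 : Fin (k + 1)).castSucc.removeNth
            (Fin.cons x w : Fin (k + 2) → N))))) -
        (-1 : ℝ) ^ (j : ℕ) • (𝒜.anchor (w j) g * P (Fin.cons x (j.removeNth w))) := by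
      intro j
      have e0 : ∀ y : N, (0 : Fin (k + 2)).removeNth (Fin.cons y w : Fin (k + 2) → N) = w := by
        intro y; ext l; simp [Fin.removeNth]
      simp only [Fin.castSucc_zero, Fin.cons_zero, Fin.cons_succ, Fin.val_zero, zero_add, e0,
        leibniz_left]
      have e1 := map_sub (slot P (j.removeNth w)) (g • 𝒜.bracket x (w j)) (𝒜.anchor (w j) g • x)
      rw [map_smul, map_smul] at e1
      simp only [slot_apply, smul_eq_mul] at e1
      rw [e1, smul_sub, mul_smul_comm]
    have h6 : ∀ i : Fin k, ∀ j ∈ Finset.Ici i.succ, (-1 : ℝ) ^ (((i.succ : Fin (k + 1)) : ℕ) + j) •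
        P (Fin.cons (𝒜.bracket ((Fin.cons (g • x) w : Fin (k + 2) → N) i.succ.castSucc)
          ((Fin.cons (g • x) w : Fin (k + 2) → N) j.succ))
          (j.removeNth (i.succ.castSucc.removeNth (Fin.cons (g • x) w : Fin (k + 2) → N)))) =
        g * ((-1 : ℝ) ^ (((i.succ : Fin (k + 1)) : ℕ) + j) •
        P (Fin.cons (𝒜.bracket ((Fin.cons x w : Fin (k + 2) → N) i.succ.castSucc)
          ((Fin.cons x w : Fin (k + 2) → N) j.succ))
          (j.removeNth (i.succ.castSucc.removeNth (Fin.cons x w : Fin (k + 2) → N))))) := by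
      intro i j hj
      rw [h3 i j (Finset.mem_Ici.mp hj), ← Fin.succ_castSucc]
      simp only [Fin.cons_succ, mul_smul_comm]
    have hs : ∀ y : N, 𝒜.dReal P (Fin.cons y w : Fin (k + 2) → N) =
        (-1 : ℝ) ^ (((0 : Fin (k + 2))) : ℕ) • 𝒜.anchor ((Fin.cons y w : Fin (k + 2) → N) 0)
            (P ((0 : Fin (k + 2)).removeNth (Fin.cons y w : Fin (k + 2) → N))) +
        ∑ i : Fin (k + 1), (-1 : ℝ) ^ ((i.succ : Fin (k + 2)) : ℕ) •
          𝒜.anchor ((Fin.cons y w : Fin (k + 2) → N) i.succ)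
            (P (i.succ.removeNth (Fin.cons y w : Fin (k + 2) → N))) -
        (∑ j : Fin (k + 1), (-1 : ℝ) ^ (((0 : Fin (k + 1)) : ℕ) + j : ℕ) •
          P (Fin.cons (𝒜.bracket ((Fin.cons y w : Fin (k + 2) → N) (0 : Fin (k + 1)).castSucc)
            ((Fin.cons y w : Fin (k + 2) → N) j.succ))
            (j.removeNth ((0 : Fin (k + 1)).castSucc.removeNth
              (Fin.cons y w : Fin (k + 2) → N)))) +
        ∑ i : Fin k, ∑ j ≥ i.succ, (-1 : ℝ) ^ (((i.succ : Fin (k + 1)) : ℕ) + j) •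
          P (Fin.cons (𝒜.bracket ((Fin.cons y w : Fin (k + 2) → N) i.succ.castSucc)
            ((Fin.cons y w : Fin (k + 2) → N) j.succ))
            (j.removeNth (i.succ.castSucc.removeNth (Fin.cons y w : Fin (k + 2) → N))))) := by
      intro y
      rw [dReal_succ_apply, Fin.sum_univ_succ (n := k + 1)]
      congr 1
      rw [Fin.sum_univ_succ (n := k), hI]
    rw [hs, hs, Finset.sum_congr rfl fun i _ => h4 i, Finset.sum_congr rfl fun j _ => h5 j,
      Finset.sum_congr rfl fun i _ => Finset.sum_congr rfl (h6 i)]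
    have e0 : ∀ y : N, (0 : Fin (k + 2)).removeNth (Fin.cons y w : Fin (k + 2) → N) = w := by
      intro y; ext l; simp [Fin.removeNth]
    simp only [Finset.sum_sub_distrib, ← Finset.mul_sum, e0, Fin.cons_zero, map_smul,
      Derivation.smul_apply, Fin.val_zero, pow_zero, one_smul, smul_eq_mul]
    ring

/-- The differential of alternating maps. -/
def d {p : ℕ} (P : N [⋀^Fin p]→ₗ[R] R) : N [⋀^Fin (p + 1)]→ₗ[R] R :=
  AlternatingMap.ofHomogeneous (𝒜.dReal P) (𝒜.dReal_homogeneous P)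

theorem coe_d {p : ℕ} (P : N [⋀^Fin p]→ₗ[R] R) : ⇑(𝒜.d P) = 𝒜.dReal P := rfl

end AnchoredBracket

end Differential

/-! ### The differential on generating functions, and its Leibniz rule. -/

section Differential

open scoped TensorProduct

/-- The p + 1 positions of the inserted argument give equal contributions, which turns 1/(p + 1)!
into 1/p!. Alternatisation is thus multiplication by the generator that carries the argument. -/
theorem gev_alternatizeUncurryFin {N X : Type*} [AddCommGroup N] [Module ℝ N] [AddCommGroup X]
    [Module ℝ X] {m p : ℕ} (ξ : Fin m → N) (f : N →ₗ[ℝ] N [⋀^Fin p]→ₗ[ℝ] X) :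
    gev ξ (AlternatingMap.alternatizeUncurryFin f) = ∑ k, lgen X k (gev ξ (f (ξ k))) := by
  have h : ∀ i : Fin (p + 1), ∑ I : Fin (p + 1) → Fin m,
      ((-1 : ℝ) ^ (i : ℕ) • f ((ξ ∘ I) i) (i.removeNth (ξ ∘ I))) ⊗ₜ[ℝ] theta I =
      ∑ k, ∑ J : Fin p → Fin m, f (ξ k) (ξ ∘ J) ⊗ₜ[ℝ] (gen k * theta J) := by
    intro i
    rw [sum_insertNth i]
    refine Finset.sum_congr rfl fun k _ => Finset.sum_congr rfl fun J _ => ?_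
    rw [comp_insertNth, Fin.insertNth_apply_same, Fin.removeNth_insertNth, theta_insertNth,
      TensorProduct.smul_tmul, smul_smul, ← pow_add, Even.neg_one_pow ⟨_, rfl⟩, one_smul]
  have hz : ∀ (n : ℕ) (x : X), (-1 : ℤ) ^ n • x = (-1 : ℝ) ^ n • x := by
    intro n x
    rw [← Int.cast_smul_eq_zsmul ℝ]
    push_cast
    rfl
  simp only [gev, AlternatingMap.alternatizeUncurryFin_apply, TensorProduct.sum_tmul, map_sum,
    map_smul, lgen_tmul, hz]
  simp only [← Finset.smul_sum]
  rw [Finset.sum_comm, Finset.sum_congr rfl fun i _ => h i, Finset.sum_const, Finset.card_univ,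
    Fintype.card_fin, ← Nat.cast_smul_eq_nsmul ℝ, smul_smul]
  congr 1
  rw [Nat.factorial_succ]
  push_cast
  have : (p.factorial : ℝ) ≠ 0 := by positivity
  field_simp

variable {R N : Type*} [CommRing R] [Algebra ℝ R] [AddCommGroup N] [Module R N]
  [Module ℝ N] [IsScalarTower ℝ R N]

namespace AnchoredBracket

variable (𝒜 : AnchoredBracket R N)

/-- In Grassmann variables d is ∑ θᵢ a(ξᵢ) − ½ ∑ θᵢ θⱼ ι_{[ξᵢ, ξⱼ]}: an odd operator whose first
part differentiates coefficients and whose second part contracts. Both parts visibly obey a product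
rule. -/
theorem gev_d {m p : ℕ} (ξ : Fin m → N) (P : N [⋀^Fin p]→ₗ[R] R) :
    gev ξ (𝒜.d P) =
      ∑ i, lgen R i ((𝒜.anchor (ξ i)).toLinearMap.rTensor _ (gev ξ P)) -
      (1 / 2 : ℝ) • ∑ i, ∑ j, lgen R i (lgen R j
        ((evalAt R (𝒜.bracket (ξ i) (ξ j))).rTensor _ (gevL ξ P))) := by
  have h1 : gev ξ (AlternatingMap.alternatizeUncurryFin (𝒜.lieAlt P)) =
      ∑ i, lgen R i ((𝒜.anchor (ξ i)).toLinearMap.rTensor _ (gev ξ P)) := by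
    rw [gev_alternatizeUncurryFin]
    refine Finset.sum_congr rfl fun i _ => ?_
    rw [gev_map]
    rfl
  rw [coe_d]
  cases p with
  | zero => simp [dReal, h1, gevL]
  | succ k =>
    have h2 : gev ξ (𝒜.dReal P) = gev ξ (AlternatingMap.alternatizeUncurryFin (𝒜.lieAlt P)) -
        (1 / 2 : ℝ) • gev ξ (AlternatingMap.alternatizeUncurryFin
          (AlternatingMap.alternatizeUncurryFinLM ∘ₗ 𝒜.brAlt P)) := by
      rw [sub_eq_add_neg, ← neg_smul, ← gev_smul, ← gev_add]
      congr 1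
      ext v
      simp [dReal, sub_eq_add_neg]
    rw [h2, h1, gev_alternatizeUncurryFin]
    congr 2
    refine Finset.sum_congr rfl fun i _ => ?_
    rw [LinearMap.comp_apply, AlternatingMap.alternatizeUncurryFinLM_apply,
      gev_alternatizeUncurryFin, map_sum]
    refine Finset.sum_congr rfl fun j _ => ?_
    rw [gevL, gev_map]
    rfl

/-- The differential is an antiderivation of the wedge product. -/
theorem gev_d_of_gev_eq {n p₁ q₁ p₂ q₂ : ℕ} (Z : N [⋀^Fin n]→ₗ[R] R) (A₁ : N [⋀^Fin p₁]→ₗ[R] R)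
    (B₁ : N [⋀^Fin q₁]→ₗ[R] R) (A₂ : N [⋀^Fin p₂]→ₗ[R] R) (B₂ : N [⋀^Fin q₂]→ₗ[R] R)
    (c₁ c₂ : ℝ)
    (h : ∀ (m : ℕ) (ξ : Fin m → N), gev ξ Z =
      c₁ • gmul (LinearMap.mul ℝ R) (gev ξ A₁) (gev ξ B₁) +
      c₂ • gmul (LinearMap.mul ℝ R) (gev ξ A₂) (gev ξ B₂)) {m : ℕ} (ξ : Fin m → N) :
    gev ξ (𝒜.d Z) =
      c₁ • (gmul (LinearMap.mul ℝ R) (gev ξ (𝒜.d A₁)) (gev ξ B₁) +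
        (-1 : ℝ) ^ p₁ • gmul (LinearMap.mul ℝ R) (gev ξ A₁) (gev ξ (𝒜.d B₁))) +
      c₂ • (gmul (LinearMap.mul ℝ R) (gev ξ (𝒜.d A₂)) (gev ξ B₂) +
        (-1 : ℝ) ^ p₂ • gmul (LinearMap.mul ℝ R) (gev ξ A₂) (gev ξ (𝒜.d B₂))) := by
  have e1 : ∀ (ζ : N) (x : Module.Dual R N ⊗[ℝ] Grass m) (y),
      (evalAt R ζ).rTensor _ (gmul (smulDual R N).flip x y) =
        gmul (LinearMap.mul ℝ R) ((evalAt R ζ).rTensor _ x) y := fun ζ =>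
    rTensor_gmul_left _ _ _ _ fun x y => by simp [mul_comm]
  have e2 : ∀ (ζ : N) (x) (y : Module.Dual R N ⊗[ℝ] Grass m),
      (evalAt R ζ).rTensor _ (gmul (smulDual R N) x y) =
        gmul (LinearMap.mul ℝ R) x ((evalAt R ζ).rTensor _ y) := fun ζ =>
    rTensor_gmul_right _ _ _ _ fun x y => by simp
  have e3 : ∀ (D : Derivation ℝ R R) (x y : R ⊗[ℝ] Grass m),
      D.toLinearMap.rTensor _ (gmul (LinearMap.mul ℝ R) x y) =
        gmul (LinearMap.mul ℝ R) (D.toLinearMap.rTensor _ x) y +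
        gmul (LinearMap.mul ℝ R) x (D.toLinearMap.rTensor _ y) := fun D =>
    rTensor_gmul _ _ _ _ _ _ fun x y => by simp [mul_comm, add_comm]
  have e4 : ∀ {p : ℕ} (A : N [⋀^Fin p]→ₗ[R] R) (i : Fin m) (y : R ⊗[ℝ] Grass m),
      lgen R i (gmul (LinearMap.mul ℝ R) (gev ξ A) y) =
        (-1 : ℝ) ^ p • gmul (LinearMap.mul ℝ R) (gev ξ A) (lgen R i y) := fun A i y =>
    lgen_gmul' _ _ (gev_mem_homog _ _) _
  -- Moving θᵢ past A costs (−1)^p in the anchor part. In the bracket part θᵢ θⱼ is even, and the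
  -- sign (−1)^p is already that of the contraction.
  have key : ∀ {p q : ℕ} (A : N [⋀^Fin p]→ₗ[R] R) (B : N [⋀^Fin q]→ₗ[R] R),
      gmul (LinearMap.mul ℝ R) (gev ξ (𝒜.d A)) (gev ξ B) +
        (-1 : ℝ) ^ p • gmul (LinearMap.mul ℝ R) (gev ξ A) (gev ξ (𝒜.d B)) =
      ∑ i, lgen R i ((𝒜.anchor (ξ i)).toLinearMap.rTensor _
        (gmul (LinearMap.mul ℝ R) (gev ξ A) (gev ξ B))) -
      (1 / 2 : ℝ) • ∑ i, ∑ j, lgen R i (lgen R j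
        ((evalAt R (𝒜.bracket (ξ i) (ξ j))).rTensor _
          (gmul (smulDual R N).flip (gevL ξ A) (gev ξ B) +
        (-1 : ℝ) ^ p • gmul (smulDual R N) (gev ξ A) (gevL ξ B)))) := by
    intro p q A B
    simp only [gev_d, e1, e2, e3, e4, map_add, map_sub, map_smul, map_sum, LinearMap.sub_apply,
      LinearMap.smul_apply, LinearMap.sum_apply, ← lgen_gmul, Finset.sum_add_distrib, smul_sub,
      Finset.smul_sum, smul_add]
    have hs : ((-1 : ℝ) ^ p) * (-1) ^ p = 1 := by
      rw [← pow_add, Even.neg_one_pow ⟨_, rfl⟩]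
    have e5 : ∀ x : R ⊗[ℝ] Grass m, (-1 : ℝ) ^ p • (-1 : ℝ) ^ p • x = x := by
      intro x; rw [smul_smul, hs, one_smul]
    simp only [e5, smul_comm ((-1 : ℝ) ^ p) (1 / 2 : ℝ)]
    abel
  rw [key, key, gev_d, h, gevL_of_gev_eq Z A₁ B₁ A₂ B₂ c₁ c₂ h]
  simp only [map_add, map_smul, Finset.sum_add_distrib, smul_sub, smul_add, ← Finset.smul_sum,
    smul_comm c₁ (1 / 2 : ℝ), smul_comm c₂ (1 / 2 : ℝ)]
  abel

end AnchoredBracket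

end Differential

/-! ### The Schouten bracket of an algebraic Lie algebroid on the dual module -/

section Schouten

open scoped TensorProduct

variable {R N : Type*} [CommRing R] [Algebra ℝ R] [AddCommGroup N] [Module R N]

/-- The first slot of an alternating map, as an alternating map of the other slots. -/
def slotAlt {p : ℕ} (P : N [⋀^Fin (p + 1)]→ₗ[R] R) : N [⋀^Fin p]→ₗ[R] Module.Dual R N where
  toFun := slot P
  map_update_add' v i x y := by
    ext ζ
    exact (P.curryLeft ζ).map_update_add v i x y
  map_update_smul' v i c x := by
    ext ζ
    exact (P.curryLeft ζ).map_update_smul v i c x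
  map_eq_zero_of_eq' v i j h hij := by
    ext ζ
    exact (P.curryLeft ζ).map_eq_zero_of_eq v h hij

@[simp] theorem slotAlt_apply {p : ℕ} (P : N [⋀^Fin (p + 1)]→ₗ[R] R) (v : Fin p → N) :
    slotAlt P v = slot P v := rfl

/-- An alternating map, from its values and their linearity in the first slot. -/
def AlternatingMap.ofPerm {n : ℕ} (F : (Fin (n + 1) → N) → R)
    (hperm : ∀ (σ : Equiv.Perm (Fin (n + 1))) v, F (v ∘ σ) = ((Equiv.Perm.sign σ : ℤ) : ℝ) • F v)
    (hadd : ∀ x y (w : Fin n → N), F (Fin.cons (x + y) w : Fin (n + 1) → N) =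
      F (Fin.cons x w : Fin (n + 1) → N) + F (Fin.cons y w : Fin (n + 1) → N))
    (hsmul : ∀ (g : R) x (w : Fin n → N), F (Fin.cons (g • x) w : Fin (n + 1) → N) =
      g * F (Fin.cons x w : Fin (n + 1) → N)) :
    N [⋀^Fin (n + 1)]→ₗ[R] R :=
  have e : ∀ (v : Fin (n + 1) → N) i y, F (Function.update v i y) =
      ((Equiv.Perm.sign i.cycleRange : ℤ) : ℝ) •
        F (Fin.cons y (i.removeNth v) : Fin (n + 1) → N) := by
    intro v i y
    have := hperm i.cycleRange (Fin.cons y (i.removeNth v) : Fin (n + 1) → N)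
    rw [Fin.cons_comp_cycleRange, Fin.insertNth_removeNth] at this
    exact this
  { toFun := F
    map_update_add' := by
      intro inst v i x y
      obtain rfl : inst = instDecidableEqFin (n + 1) := Subsingleton.elim _ _
      change F _ = F _ + F _
      rw [e, e, e, hadd, smul_add]
    map_update_smul' := by
      intro inst v i c x
      obtain rfl : inst = instDecidableEqFin (n + 1) := Subsingleton.elim _ _
      change F _ = c • F _
      rw [e, e, hsmul, smul_eq_mul, mul_smul_comm]
    map_eq_zero_of_eq' := by
      intro v i j hv hij
      change F v = 0
      have h := hperm (Equiv.swap i j) v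
      have hs : v ∘ Equiv.swap i j = v := by
        ext k
        by_cases h1 : k = i
        · subst h1; simp [hv]
        · by_cases h2 : k = j
          · subst h2; simp [hv]
          · simp [Equiv.swap_apply_of_ne_of_ne h1 h2]
      rw [hs, Equiv.Perm.sign_swap hij] at h
      simp only [Units.val_neg, Units.val_one, Int.cast_neg, Int.cast_one, neg_smul,
        one_smul] at h
      have h2 : (2 : ℝ) • F v = 0 := by
        rw [two_smul]
        nth_rewrite 2 [h]
        exact add_neg_cancel _
      simpa using h2 }

@[simp] theorem AlternatingMap.coe_ofPerm {n : ℕ} (F : (Fin (n + 1) → N) → R) (h1 h2 h3) :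
    ⇑(AlternatingMap.ofPerm F h1 h2 h3) = F := rfl

/-- Antisymmetrising terms that only differ by the position of a marked argument, with weights
whose sum vanishes, gives zero. -/
theorem sum_sign_eq_zero {A : Type*} {n : ℕ} (E : (Fin n → A) → R) (c : Fin n → ℝ) (j₀ k : Fin n)
    (hE : ∀ j, c j ≠ 0 → j ≠ j₀ → ∀ v, E (v ∘ Equiv.swap j j₀) = -E v) (hc : ∑ j, c j = 0)
    (v : Fin n → A) :
    ∑ σ : Equiv.Perm (Fin n), ((Equiv.Perm.sign σ : ℤ) : ℝ) • c (σ⁻¹ k) • E (v ∘ σ) = 0 := by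
  have h1 : ∀ σ : Equiv.Perm (Fin n), ((Equiv.Perm.sign σ : ℤ) : ℝ) • c (σ⁻¹ k) • E (v ∘ σ) =
      ∑ j, if σ j = k then ((Equiv.Perm.sign σ : ℤ) : ℝ) • c j • E (v ∘ σ) else 0 := by
    intro σ
    rw [Finset.sum_eq_single (σ⁻¹ k)]
    · simp
    · intro j _ hj
      rw [if_neg]
      rintro rfl
      simp at hj
    · simp
  -- Exchanging the positions j and j₀ changes the sign of both σ and E. Hence the marked argument
  -- can be brought to position j₀, and only the sum of the weights remains.
  have h2 : ∀ j, ∑ σ : Equiv.Perm (Fin n),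
      (if σ j = k then ((Equiv.Perm.sign σ : ℤ) : ℝ) • c j • E (v ∘ σ) else 0) =
      c j • ∑ σ : Equiv.Perm (Fin n),
        (if σ j₀ = k then ((Equiv.Perm.sign σ : ℤ) : ℝ) • E (v ∘ σ) else 0) := by
    intro j
    rw [Finset.smul_sum]
    by_cases hj : j = j₀
    · subst hj
      refine Finset.sum_congr rfl fun σ _ => ?_
      split_ifs
      · rw [smul_comm]
      · rw [smul_zero]
    · refine Fintype.sum_equiv (Equiv.mulRight (Equiv.swap j j₀)) _ _ fun σ => ?_
      by_cases hcj : c j = 0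
      · simp [hcj]
      have e1 : (Equiv.mulRight (Equiv.swap j j₀) σ) j₀ = σ j := by simp
      have e2 : v ∘ (Equiv.mulRight (Equiv.swap j j₀) σ) = (v ∘ σ) ∘ Equiv.swap j j₀ := rfl
      have e3 : Equiv.Perm.sign (Equiv.mulRight (Equiv.swap j j₀) σ) = -Equiv.Perm.sign σ := by
        rw [Equiv.coe_mulRight, Equiv.Perm.sign_mul, Equiv.Perm.sign_swap hj, mul_neg_one]
      rw [e1, e2, e3, hE j hcj hj]
      split_ifs
      · rw [smul_comm]
        congr 1
        push_cast
        rw [neg_smul, smul_neg, neg_neg]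
      · rw [smul_zero]
  rw [Finset.sum_congr rfl fun σ _ => h1 σ, Finset.sum_comm, Finset.sum_congr rfl fun j _ => h2 j,
    ← Finset.sum_smul, hc, zero_smul]

variable [Module ℝ N]

/-- The anchor of a Lie algebroid on the dual of `N`, and its differential on `N`. -/
structure DualAnchoredBracket (R N : Type*) [CommRing R] [Algebra ℝ R] [AddCommGroup N]
    [Module R N] [Module ℝ N] where
  /-- The anchor. -/
  anchor : Module.Dual R N →ₗ[R] Derivation ℝ R R
  /-- The differential. -/
  diff : N →ₗ[ℝ] Module.Dual R N →ₗ[R] Module.Dual R N →ₗ[R] R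
  skew : ∀ ξ φ ψ, diff ξ φ ψ = -diff ξ ψ φ
  leibniz : ∀ (g : R) ξ φ ψ,
    diff (g • ξ) φ ψ = g * diff ξ φ ψ + anchor φ g * ψ ξ - anchor ψ g * φ ξ

namespace DualAnchoredBracket

variable (𝓓 : DualAnchoredBracket R N)

/-- The summands of the Schouten bracket, for the last slot `φ` of `P` and the first slot `ψ`
of `Q`. -/
def core (a b c : ℝ) (φ ψ : Module.Dual R N) (ζ : N) : R :=
  a • 𝓓.anchor φ (ψ ζ) - b • 𝓓.anchor ψ (φ ζ) - c • 𝓓.diff ζ φ ψ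

theorem core_add_left (a b c : ℝ) (φ φ' ψ : Module.Dual R N) (ζ : N) :
    𝓓.core a b c (φ + φ') ψ ζ = 𝓓.core a b c φ ψ ζ + 𝓓.core a b c φ' ψ ζ := by
  simp only [core, map_add, LinearMap.add_apply, Derivation.add_apply, smul_add]
  ring

theorem core_add_right (a b c : ℝ) (φ ψ ψ' : Module.Dual R N) (ζ : N) :
    𝓓.core a b c φ (ψ + ψ') ζ = 𝓓.core a b c φ ψ ζ + 𝓓.core a b c φ ψ' ζ := by
  simp only [core, map_add, LinearMap.add_apply, Derivation.add_apply, smul_add]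
  ring

theorem core_add_mid (a b c : ℝ) (φ ψ : Module.Dual R N) (ζ ζ' : N) :
    𝓓.core a b c φ ψ (ζ + ζ') = 𝓓.core a b c φ ψ ζ + 𝓓.core a b c φ ψ ζ' := by
  simp only [core, map_add, LinearMap.add_apply, smul_add]
  ring

/-- Homogeneity fails only by multiples of ψ(ζ) a(φ)g and φ(ζ) a(ψ)g. For a factor g on φ, ψ and ζ
the first has weights 0, a, a − c and the second −b, 0, c − b. -/
theorem core_smul_left (a b c : ℝ) (g : R) (φ ψ : Module.Dual R N) (ζ : N) :
    𝓓.core a b c (g • φ) ψ ζ = g * 𝓓.core a b c φ ψ ζ - b • (φ ζ * 𝓓.anchor ψ g) := by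
  simp only [core, map_smul, LinearMap.smul_apply, Derivation.smul_apply, smul_eq_mul,
    Derivation.leibniz, mul_sub, mul_smul_comm, smul_add]
  ring

theorem core_smul_right (a b c : ℝ) (g : R) (φ ψ : Module.Dual R N) (ζ : N) :
    𝓓.core a b c φ (g • ψ) ζ = g * 𝓓.core a b c φ ψ ζ + a • (ψ ζ * 𝓓.anchor φ g) := by
  simp only [core, map_smul, LinearMap.smul_apply, Derivation.smul_apply, smul_eq_mul,
    Derivation.leibniz, mul_sub, mul_smul_comm, smul_add]
  ring

theorem core_smul_mid (a b c : ℝ) (g : R) (φ ψ : Module.Dual R N) (ζ : N) :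
    𝓓.core a b c φ ψ (g • ζ) = g * 𝓓.core a b c φ ψ ζ + (a - c) • (ψ ζ * 𝓓.anchor φ g) +
      (c - b) • (φ ζ * 𝓓.anchor ψ g) := by
  simp only [core, map_smul, smul_eq_mul, 𝓓.leibniz,
    Derivation.leibniz, mul_sub, mul_smul_comm, smul_add, sub_smul, smul_sub]
  rw [mul_comm (𝓓.anchor φ g), mul_comm (𝓓.anchor ψ g)]
  ring

/-- The Schouten bracket of alternating maps before antisymmetrisation. -/
def pre {p q : ℕ} (P : N [⋀^Fin (p + 1)]→ₗ[R] R) (Q : N [⋀^Fin (q + 1)]→ₗ[R] R)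
    (v : Fin (p + 1 + q) → N) : R :=
  𝓓.core (p.factorial * (q + 1).factorial : ℝ)⁻¹ ((p + 1).factorial * q.factorial : ℝ)⁻¹
    (p.factorial * q.factorial : ℝ)⁻¹
    ((-1 : ℝ) ^ p • slot P fun i => v (Fin.castAdd q i.castSucc))
    (slot Q fun j => v (Fin.natAdd (p + 1) j)) (v (Fin.castAdd q (Fin.last p)))

/-- The arguments of `pre` form three blocks: p of them belong to P, one is shared, and q belong to
Q. An update touches one block only. -/
theorem update_castAdd_castSucc {p q : ℕ} (v : Fin (p + 1 + q) → N) (i : Fin p) (x : N) :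
    (fun k : Fin p => Function.update v (Fin.castAdd q i.castSucc) x (Fin.castAdd q k.castSucc)) =
      Function.update (fun k => v (Fin.castAdd q k.castSucc)) i x ∧
    (fun k : Fin q => Function.update v (Fin.castAdd q i.castSucc) x (Fin.natAdd (p + 1) k)) =
      (fun k => v (Fin.natAdd (p + 1) k)) ∧
    Function.update v (Fin.castAdd q i.castSucc) x (Fin.castAdd q (Fin.last p)) =
      v (Fin.castAdd q (Fin.last p)) := by
  refine ⟨?_, ?_, ?_⟩
  · ext k
    by_cases h : k = i
    · subst h; simp
    · rw [Function.update_of_ne h, Function.update_of_ne]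
      simpa [Fin.ext_iff] using h
  · ext k
    rw [Function.update_of_ne]
    simp only [ne_eq, Fin.ext_iff, Fin.val_natAdd, Fin.val_castAdd, Fin.val_castSucc]
    omega
  · rw [Function.update_of_ne]
    simp only [ne_eq, Fin.ext_iff, Fin.val_castAdd, Fin.val_castSucc, Fin.val_last]
    omega

theorem update_last {p q : ℕ} (v : Fin (p + 1 + q) → N) (x : N) :
    (fun k : Fin p => Function.update v (Fin.castAdd q (Fin.last p)) x
      (Fin.castAdd q k.castSucc)) = (fun k => v (Fin.castAdd q k.castSucc)) ∧
    (fun k : Fin q => Function.update v (Fin.castAdd q (Fin.last p)) x (Fin.natAdd (p + 1) k)) =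
      (fun k => v (Fin.natAdd (p + 1) k)) ∧
    Function.update v (Fin.castAdd q (Fin.last p)) x (Fin.castAdd q (Fin.last p)) = x := by
  refine ⟨?_, ?_, ?_⟩
  · ext k
    rw [Function.update_of_ne]
    simp only [ne_eq, Fin.ext_iff, Fin.val_castAdd, Fin.val_castSucc, Fin.val_last]
    omega
  · ext k
    rw [Function.update_of_ne]
    simp only [ne_eq, Fin.ext_iff, Fin.val_natAdd, Fin.val_castAdd, Fin.val_last]
    omega
  · simp

theorem update_natAdd {p q : ℕ} (v : Fin (p + 1 + q) → N) (j : Fin q) (x : N) :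
    (fun k : Fin p => Function.update v (Fin.natAdd (p + 1) j) x (Fin.castAdd q k.castSucc)) =
      (fun k => v (Fin.castAdd q k.castSucc)) ∧
    (fun k : Fin q => Function.update v (Fin.natAdd (p + 1) j) x (Fin.natAdd (p + 1) k)) =
      Function.update (fun k => v (Fin.natAdd (p + 1) k)) j x ∧
    Function.update v (Fin.natAdd (p + 1) j) x (Fin.castAdd q (Fin.last p)) =
      v (Fin.castAdd q (Fin.last p)) := by
  refine ⟨?_, ?_, ?_⟩
  · ext k
    rw [Function.update_of_ne]
    simp only [ne_eq, Fin.ext_iff, Fin.val_natAdd, Fin.val_castAdd, Fin.val_castSucc]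
    omega
  · ext k
    by_cases h : k = j
    · subst h; simp
    · rw [Function.update_of_ne h, Function.update_of_ne]
      simpa [Fin.ext_iff] using h
  · rw [Function.update_of_ne]
    simp only [ne_eq, Fin.ext_iff, Fin.val_natAdd, Fin.val_castAdd, Fin.val_last]
    omega

/-- Case distinction on the three blocks of arguments. -/
theorem block_cases {p q : ℕ} {C : Fin (p + 1 + q) → Prop}
    (h1 : ∀ i : Fin p, C (Fin.castAdd q i.castSucc)) (h2 : C (Fin.castAdd q (Fin.last p)))
    (h3 : ∀ j : Fin q, C (Fin.natAdd (p + 1) j)) (j : Fin (p + 1 + q)) : C j := by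
  refine Fin.addCases (fun i => ?_) h3 j
  exact Fin.lastCases h2 h1 i

section

variable {p q : ℕ} (P : N [⋀^Fin (p + 1)]→ₗ[R] R) (Q : N [⋀^Fin (q + 1)]→ₗ[R] R)

theorem pre_update_add (v : Fin (p + 1 + q) → N) (j : Fin (p + 1 + q)) (x y : N) :
    𝓓.pre P Q (Function.update v j (x + y)) =
      𝓓.pre P Q (Function.update v j x) + 𝓓.pre P Q (Function.update v j y) := by
  induction j using block_cases with
  | h1 i =>
    simp only [pre, update_castAdd_castSucc, ← slotAlt_apply, (slotAlt P).map_update_add,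
      smul_add, core_add_left]
  | h2 => simp only [pre, update_last, core_add_mid]
  | h3 j =>
    simp only [pre, update_natAdd, ← slotAlt_apply, (slotAlt Q).map_update_add, core_add_right]

/-- The failure of homogeneity in `P`-arguments. -/
def defectQ (g : R) (v : Fin (p + 1 + q) → N) : R :=
  slot Q (fun j => v (Fin.natAdd (p + 1) j)) (v (Fin.castAdd q (Fin.last p))) *
    𝓓.anchor ((-1 : ℝ) ^ p • slot P fun i => v (Fin.castAdd q i.castSucc)) g

/-- The failure of homogeneity in `Q`-arguments. -/
def defectP (g : R) (v : Fin (p + 1 + q) → N) : R :=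
  ((-1 : ℝ) ^ p • slot P fun i => v (Fin.castAdd q i.castSucc)) (v (Fin.castAdd q (Fin.last p))) *
    𝓓.anchor (slot Q fun j => v (Fin.natAdd (p + 1) j)) g

/-- Weights of `defectQ`. -/
def weightQ (p q : ℕ) (j : Fin (p + 1 + q)) : ℝ :=
  Fin.addCases (fun i : Fin (p + 1) => Fin.lastCases
    ((p.factorial * (q + 1).factorial : ℝ)⁻¹ - (p.factorial * q.factorial : ℝ)⁻¹)
    (fun _ => 0) i) (fun _ : Fin q => (p.factorial * (q + 1).factorial : ℝ)⁻¹) j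

/-- Weights of `defectP`. -/
def weightP (p q : ℕ) (j : Fin (p + 1 + q)) : ℝ :=
  Fin.addCases (fun i : Fin (p + 1) => Fin.lastCases
    ((p.factorial * q.factorial : ℝ)⁻¹ - ((p + 1).factorial * q.factorial : ℝ)⁻¹)
    (fun _ => -((p + 1).factorial * q.factorial : ℝ)⁻¹) i) (fun _ : Fin q => 0) j

/-- The q slots of Q contribute q/(p!(q+1)!), the shared slot 1/(p!(q+1)!) − 1/(p! q!), and the
slots of P nothing. This cancellation reflects the choice of the factorials in `pre`. -/
theorem sum_weightQ (p q : ℕ) : ∑ j, weightQ p q j = 0 := by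
  rw [Fin.sum_univ_add, Fin.sum_univ_castSucc]
  simp only [weightQ, Fin.addCases_left, Fin.addCases_right, Fin.lastCases_castSucc,
    Fin.lastCases_last, Finset.sum_const_zero, Finset.sum_const, Finset.card_univ,
    Fintype.card_fin, nsmul_eq_mul, Nat.factorial_succ]
  push_cast
  have h1 : (p.factorial : ℝ) ≠ 0 := by positivity
  have h2 : (q.factorial : ℝ) ≠ 0 := by positivity
  field_simp
  ring

theorem sum_weightP (p q : ℕ) : ∑ j, weightP p q j = 0 := by
  rw [Fin.sum_univ_add, Fin.sum_univ_castSucc]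
  simp only [weightP, Fin.addCases_left, Fin.addCases_right, Fin.lastCases_castSucc,
    Fin.lastCases_last, Finset.sum_const_zero, Finset.sum_const, Finset.card_univ,
    Fintype.card_fin, nsmul_eq_mul, Nat.factorial_succ]
  push_cast
  have h1 : (p.factorial : ℝ) ≠ 0 := by positivity
  have h2 : (q.factorial : ℝ) ≠ 0 := by positivity
  field_simp
  ring

/-- The same two defect expressions occur whichever slot carries the factor g; only their weights
depend on the block. -/
theorem pre_update_smul (v : Fin (p + 1 + q) → N) (j : Fin (p + 1 + q)) (g : R) (x : N) :
    𝓓.pre P Q (Function.update v j (g • x)) =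
      g * 𝓓.pre P Q (Function.update v j x) +
      weightQ p q j • 𝓓.defectQ P Q g (Function.update v j x) +
      weightP p q j • 𝓓.defectP P Q g (Function.update v j x) := by
  induction j using block_cases with
  | h1 i =>
    simp only [pre, defectP, defectQ, weightP, weightQ, update_castAdd_castSucc, ← slotAlt_apply,
      (slotAlt P).map_update_smul, smul_comm _ g, core_smul_left, Fin.addCases_left,
      Fin.lastCases_castSucc, zero_smul, add_zero, neg_smul, sub_eq_add_neg]
  | h2 =>
    simp only [pre, defectP, defectQ, weightP, weightQ, update_last, core_smul_mid,
      Fin.addCases_left, Fin.lastCases_last]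
  | h3 j =>
    simp only [pre, defectP, defectQ, weightP, weightQ, update_natAdd, ← slotAlt_apply,
      (slotAlt Q).map_update_smul, core_smul_right, Fin.addCases_right, zero_smul, add_zero]

/-- The shared argument and the last q arguments all enter through the alternating map Q, and the
anchor factor does not see them. `weightQ` vanishes on the other slots, so no further symmetry is
needed. -/
theorem defectQ_swap (g : R) (j : Fin q) (v : Fin (p + 1 + q) → N) :
    𝓓.defectQ P Q g (v ∘ Equiv.swap (Fin.natAdd (p + 1) j) (Fin.castAdd q (Fin.last p))) =
      -𝓓.defectQ P Q g v := by
  set s := Equiv.swap (Fin.natAdd (p + 1) j) (Fin.castAdd q (Fin.last p)) with hs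
  have e1 : (fun i : Fin p => (v ∘ s) (Fin.castAdd q i.castSucc)) =
      fun i => v (Fin.castAdd q i.castSucc) := by
    ext i
    rw [Function.comp_apply, hs, Equiv.swap_apply_of_ne_of_ne]
    · simp only [ne_eq, Fin.ext_iff, Fin.val_natAdd, Fin.val_castAdd, Fin.val_castSucc]
      omega
    · simp only [ne_eq, Fin.ext_iff, Fin.val_castAdd, Fin.val_castSucc, Fin.val_last]
      omega
  have e2 : (Fin.cons ((v ∘ s) (Fin.castAdd q (Fin.last p)))
      (fun k => (v ∘ s) (Fin.natAdd (p + 1) k)) : Fin (q + 1) → N) =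
      (Fin.cons (v (Fin.castAdd q (Fin.last p))) (fun k => v (Fin.natAdd (p + 1) k)) :
        Fin (q + 1) → N) ∘ Equiv.swap j.succ 0 := by
    ext k
    refine Fin.cases ?_ (fun k => ?_) k
    · simp [hs]
    · by_cases hk : k = j
      · subst hk; simp [hs]
      · have hne : Equiv.swap j.succ 0 k.succ = k.succ :=
          Equiv.swap_apply_of_ne_of_ne (by simpa using hk) (Fin.succ_ne_zero k)
        simp only [Function.comp_apply, hne, Fin.cons_succ]
        rw [hs, Equiv.swap_apply_of_ne_of_ne]
        · simpa [Fin.ext_iff] using hk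
        · simp only [ne_eq, Fin.ext_iff, Fin.val_natAdd, Fin.val_castAdd, Fin.val_last]
          omega
  rw [defectQ, defectQ, e1, slot_apply, e2, Q.map_swap _ (Fin.succ_ne_zero j), slot_apply, neg_mul]

theorem defectP_swap (g : R) (i : Fin p) (v : Fin (p + 1 + q) → N) :
    𝓓.defectP P Q g (v ∘ Equiv.swap (Fin.castAdd q i.castSucc) (Fin.castAdd q (Fin.last p))) =
      -𝓓.defectP P Q g v := by
  set s := Equiv.swap (Fin.castAdd q i.castSucc) (Fin.castAdd q (Fin.last p)) with hs
  have e1 : (fun k : Fin q => (v ∘ s) (Fin.natAdd (p + 1) k)) =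
      fun k => v (Fin.natAdd (p + 1) k) := by
    ext k
    rw [Function.comp_apply, hs, Equiv.swap_apply_of_ne_of_ne]
    · simp only [ne_eq, Fin.ext_iff, Fin.val_natAdd, Fin.val_castAdd, Fin.val_castSucc]
      omega
    · simp only [ne_eq, Fin.ext_iff, Fin.val_natAdd, Fin.val_castAdd, Fin.val_last]
      omega
  have e2 : (Fin.cons ((v ∘ s) (Fin.castAdd q (Fin.last p)))
      (fun k : Fin p => (v ∘ s) (Fin.castAdd q k.castSucc)) : Fin (p + 1) → N) =
      (Fin.cons (v (Fin.castAdd q (Fin.last p))) (fun k => v (Fin.castAdd q k.castSucc)) :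
        Fin (p + 1) → N) ∘ Equiv.swap i.succ 0 := by
    ext k
    refine Fin.cases ?_ (fun k => ?_) k
    · simp [hs]
    · by_cases hk : k = i
      · subst hk; simp [hs]
      · have hne : Equiv.swap i.succ 0 k.succ = k.succ :=
          Equiv.swap_apply_of_ne_of_ne (by simpa using hk) (Fin.succ_ne_zero k)
        simp only [Function.comp_apply, hne, Fin.cons_succ]
        rw [hs, Equiv.swap_apply_of_ne_of_ne]
        · simpa [Fin.ext_iff] using hk
        · simp only [ne_eq, Fin.ext_iff, Fin.val_castAdd, Fin.val_castSucc, Fin.val_last]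
          omega
  rw [defectP, defectP, e1, LinearMap.smul_apply, slot_apply, e2,
    P.map_swap _ (Fin.succ_ne_zero i), LinearMap.smul_apply, slot_apply, smul_neg, neg_mul]

/-- The element x is a placeholder: its position σ⁻¹ 0 is overwritten. -/
theorem cons_comp_perm {n : ℕ} (σ : Equiv.Perm (Fin (n + 1))) (w : Fin n → N) (x y : N) :
    (Fin.cons y w : Fin (n + 1) → N) ∘ σ =
      Function.update ((Fin.cons x w : Fin (n + 1) → N) ∘ σ) (σ⁻¹ 0) y := by
  ext k
  by_cases h : σ k = 0
  · have : k = σ⁻¹ 0 := by rw [← h]; simp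
    rw [Function.comp_apply, h, this]; simp
  · have : k ≠ σ⁻¹ 0 := by rintro rfl; simp at h
    rw [Function.update_of_ne this]
    obtain ⟨t, ht⟩ := Fin.exists_succ_eq.mpr h
    simp [← ht]

theorem update_comp_cast {a b : ℕ} (h : a = b) (v : Fin b → N) (j : Fin b) (y : N) :
    Function.update v j y ∘ Fin.cast h =
      Function.update (v ∘ Fin.cast h) (Fin.cast h.symm j) y := by
  subst h
  rfl

theorem antisymm_pre_cons {n : ℕ} (h : p + 1 + q = n + 1) (w : Fin n → N) (y : N) :
    antisymm (fun v : Fin (n + 1) → N => 𝓓.pre P Q (v ∘ Fin.cast h))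
        (Fin.cons y w : Fin (n + 1) → N) =
      ∑ σ : Equiv.Perm (Fin (n + 1)), ((Equiv.Perm.sign σ : ℤ) : ℝ) •
        𝓓.pre P Q (Function.update (((Fin.cons 0 w : Fin (n + 1) → N) ∘ σ) ∘ Fin.cast h)
          (Fin.cast h.symm (σ⁻¹ 0)) y) := by
  unfold antisymm
  refine Finset.sum_congr rfl fun σ _ => ?_
  rw [cons_comp_perm σ w 0 y]
  beta_reduce
  rw [update_comp_cast]

theorem antisymm_pre_cons_add {n : ℕ} (h : p + 1 + q = n + 1) (x y : N) (w : Fin n → N) :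
    antisymm (fun v : Fin (n + 1) → N => 𝓓.pre P Q (v ∘ Fin.cast h))
        (Fin.cons (x + y) w : Fin (n + 1) → N) =
      antisymm (fun v : Fin (n + 1) → N => 𝓓.pre P Q (v ∘ Fin.cast h))
        (Fin.cons x w : Fin (n + 1) → N) +
      antisymm (fun v : Fin (n + 1) → N => 𝓓.pre P Q (v ∘ Fin.cast h))
        (Fin.cons y w : Fin (n + 1) → N) := by
  simp only [antisymm_pre_cons, pre_update_add, smul_add, Finset.sum_add_distrib]

/-- Before antisymmetrisation the expression is not function-linear. Its defects are odd under the
exchanges of `defectQ_swap` and `defectP_swap` and their weights sum to zero, so `sum_sign_eq_zero`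
removes them. -/
theorem antisymm_pre_cons_smul {n : ℕ} (h : p + 1 + q = n + 1) (g : R) (x : N) (w : Fin n → N) :
    antisymm (fun v : Fin (n + 1) → N => 𝓓.pre P Q (v ∘ Fin.cast h))
        (Fin.cons (g • x) w : Fin (n + 1) → N) =
      g * antisymm (fun v : Fin (n + 1) → N => 𝓓.pre P Q (v ∘ Fin.cast h))
        (Fin.cons x w : Fin (n + 1) → N) := by
  have hu : ∀ σ : Equiv.Perm (Fin (n + 1)),
      Function.update (((Fin.cons 0 w : Fin (n + 1) → N) ∘ σ) ∘ Fin.cast h)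
        (Fin.cast h.symm (σ⁻¹ 0)) x = (Fin.cons x w ∘ σ) ∘ Fin.cast h := by
    intro σ
    rw [cons_comp_perm σ w 0 x, update_comp_cast]
  have hsw : ∀ (v : Fin (n + 1) → N) (j j' : Fin (n + 1)),
      (v ∘ Equiv.swap j j') ∘ Fin.cast h =
        (v ∘ Fin.cast h) ∘ Equiv.swap (Fin.cast h.symm j) (Fin.cast h.symm j') := by
    intro v j j'
    ext k
    simp only [Function.comp_apply]
    congr 1
    simp only [Equiv.swap_apply_def, Fin.ext_iff, Fin.val_cast]
    split_ifs <;> simp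
  have hsum : ∀ c : Fin (p + 1 + q) → ℝ, ∑ j : Fin (n + 1), c (Fin.cast h.symm j) = ∑ j, c j :=
    fun c => Fintype.sum_equiv (finCongr h.symm) _ _ fun _ => rfl
  have hQ := sum_sign_eq_zero (fun v : Fin (n + 1) → N => 𝓓.defectQ P Q g (v ∘ Fin.cast h))
    (fun j => weightQ p q (Fin.cast h.symm j)) (Fin.cast h (Fin.castAdd q (Fin.last p))) 0
    (fun j hj hne v => by
      rw [hsw]
      obtain ⟨j, rfl⟩ : ∃ k, j = Fin.cast h k := ⟨Fin.cast h.symm j, by simp⟩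
      simp only [Fin.cast_cast, Fin.cast_eq_self] at hj ⊢
      induction j using block_cases with
      | h1 i => simp [weightQ] at hj
      | h2 => exact absurd rfl hne
      | h3 i => exact 𝓓.defectQ_swap P Q g i _) ((hsum _).trans (sum_weightQ p q))
    (Fin.cons x w)
  have hP := sum_sign_eq_zero (fun v : Fin (n + 1) → N => 𝓓.defectP P Q g (v ∘ Fin.cast h))
    (fun j => weightP p q (Fin.cast h.symm j)) (Fin.cast h (Fin.castAdd q (Fin.last p))) 0
    (fun j hj hne v => by
      rw [hsw]
      obtain ⟨j, rfl⟩ : ∃ k, j = Fin.cast h k := ⟨Fin.cast h.symm j, by simp⟩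
      simp only [Fin.cast_cast, Fin.cast_eq_self] at hj ⊢
      induction j using block_cases with
      | h1 i => exact 𝓓.defectP_swap P Q g i _
      | h2 => exact absurd rfl hne
      | h3 i => simp [weightP] at hj) ((hsum _).trans (sum_weightP p q))
    (Fin.cons x w)
  simp only [antisymm_pre_cons, pre_update_smul, smul_add, Finset.sum_add_distrib, hu]
  rw [hP, hQ, add_zero, add_zero, Finset.mul_sum]
  exact Finset.sum_congr rfl fun σ _ => (mul_smul_comm _ _ _).symm

/-- The Schouten bracket in positive degrees. -/
def schoutenPos {n : ℕ} (h : p + 1 + q = n + 1) : N [⋀^Fin (n + 1)]→ₗ[R] R :=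
  AlternatingMap.ofPerm (antisymm fun v => 𝓓.pre P Q (v ∘ Fin.cast h))
    (antisymm_perm _) (𝓓.antisymm_pre_cons_add P Q h) (𝓓.antisymm_pre_cons_smul P Q h)

end

/-- The derivative of a scalar along linear forms. -/
def derivAt (f : R) : Module.Dual R N →ₗ[R] R where
  toFun φ := 𝓓.anchor φ f
  map_add' _ _ := by simp
  map_smul' _ _ := by simp

/-- The Schouten bracket of alternating maps. -/
def schouten : {p q n : ℕ} → n + 1 = p + q → (N [⋀^Fin p]→ₗ[R] R) → (N [⋀^Fin q]→ₗ[R] R) →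
    N [⋀^Fin n]→ₗ[R] R
  | 0, 0, _, h, _, _ => by omega
  | 0, _ + 1, _, h, f, Q =>
    (-(𝓓.derivAt (f ![])).compAlternatingMap (slotAlt Q)).domDomCongr (finCongr (by omega))
  | p + 1, 0, _, h, P, g =>
    ((𝓓.derivAt (g ![])).compAlternatingMap ((-1 : ℝ) ^ p • slotAlt P)).domDomCongr
      (finCongr (by omega))
  | _ + 1, _ + 1, 0, h, _, _ => by omega
  | _ + 1, _ + 1, _ + 1, h, P, Q => 𝓓.schoutenPos P Q (by omega)

end DualAnchoredBracket

end Schouten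

/-! ### The generating function of the Schouten bracket. -/

section SchoutenGenerating

open scoped TensorProduct

theorem gmul_one_left {m : ℕ} {X Y Z : Type*} [AddCommGroup X] [Module ℝ X] [AddCommGroup Y]
    [Module ℝ Y] [AddCommGroup Z] [Module ℝ Z] (b : X →ₗ[ℝ] Y →ₗ[ℝ] Z) (x : X)
    (y : Y ⊗[ℝ] Grass m) : gmul b (x ⊗ₜ 1) y = (b x).rTensor _ y := by
  induction y using TensorProduct.induction_on with
  | zero => simp
  | add y y' hy hy' => simp only [map_add, hy, hy']
  | tmul y c => simp

theorem gmul_one_right {m : ℕ} {X Y Z : Type*} [AddCommGroup X] [Module ℝ X] [AddCommGroup Y]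
    [Module ℝ Y] [AddCommGroup Z] [Module ℝ Z] (b : X →ₗ[ℝ] Y →ₗ[ℝ] Z) (y : Y)
    (x : X ⊗[ℝ] Grass m) : gmul b x (y ⊗ₜ 1) = (b.flip y).rTensor _ x := by
  induction x using TensorProduct.induction_on with
  | zero => simp
  | add x x' hx hx' => simp only [map_add, LinearMap.add_apply, hx, hx']
  | tmul x c => simp

theorem gev_zero_deg {m : ℕ} {X N : Type*} [AddCommGroup X] [Module ℝ X] (ξ : Fin m → N)
    (F : (Fin 0 → N) → X) : gev ξ F = F ![] ⊗ₜ 1 := by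
  rw [gev, Fintype.sum_unique, theta_zero_arg, Nat.factorial_zero, Nat.cast_one, inv_one, one_smul]
  congr 2
  exact Subsingleton.elim _ _

theorem theta_insertNth_last {m p : ℕ} (i : Fin m) (I : Fin p → Fin m) :
    theta ((Fin.last p).insertNth i I : Fin (p + 1) → Fin m) = theta I * gen i := by
  have : gen i = theta (fun _ : Fin 1 => i) := by
    rw [theta, ExteriorAlgebra.ιMulti_succ_apply]; simp [gen]
  rw [theta_insertNth, this, theta_mul_theta _ (fun _ : Fin 1 => i), mul_one, Fin.val_last]

theorem sum_append {m p q : ℕ} {Z : Type*} [AddCommMonoid Z]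
    (H : (Fin (p + q) → Fin m) → Z) :
    ∑ J, H J = ∑ I : Fin p → Fin m, ∑ K : Fin q → Fin m, H (Fin.append I K) := by
  rw [← Fintype.sum_prod_type']
  exact (Fintype.sum_equiv (Fin.appendEquiv p q) _ _ fun x => rfl).symm

variable {R N : Type*} [CommRing R] [Algebra ℝ R] [AddCommGroup N] [Module R N] [Module ℝ N]

namespace DualAnchoredBracket

variable (𝓓 : DualAnchoredBracket R N)

/-- The action of linear forms on scalars, as a real bilinear map. -/
def act : Module.Dual R N →ₗ[ℝ] R →ₗ[ℝ] R :=
  LinearMap.mk₂ ℝ (fun φ f => 𝓓.anchor φ f) (fun _ _ _ => by simp)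
    (fun c φ f => by rw [LinearMap.map_smul_of_tower]; rfl)
    (fun _ _ _ => map_add _ _ _) (fun _ _ _ => Derivation.map_smul _ _ _)

@[simp] theorem act_apply (φ : Module.Dual R N) (f : R) : 𝓓.act φ f = 𝓓.anchor φ f := rfl

/-- The differential of a fixed element, as a real bilinear map. -/
def diffR (ζ : N) : Module.Dual R N →ₗ[ℝ] Module.Dual R N →ₗ[ℝ] R :=
  LinearMap.mk₂ ℝ (fun φ ψ => 𝓓.diff ζ φ ψ) (fun _ _ _ => by simp)
    (fun c φ ψ => by rw [LinearMap.map_smul_of_tower]; rfl)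
    (fun _ _ _ => map_add _ _ _) (fun _ _ _ => LinearMap.map_smul_of_tower _ _ _)

@[simp] theorem diffR_apply (ζ : N) (φ ψ : Module.Dual R N) : 𝓓.diffR ζ φ ψ = 𝓓.diff ζ φ ψ := rfl

/-- The generating function of the Schouten bracket. -/
def gevS {m p q : ℕ} (ξ : Fin m → N) (P : N [⋀^Fin p]→ₗ[R] R) (Q : N [⋀^Fin q]→ₗ[R] R) :
    R ⊗[ℝ] Grass m :=
  gmul 𝓓.act ((-1 : ℝ) ^ (p + 1) • gevL ξ P) (gev ξ Q) - gmul 𝓓.act.flip (gev ξ P) (gevL ξ Q) -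
    ∑ i, gmul (𝓓.diffR (ξ i)) (rgen _ i ((-1 : ℝ) ^ (p + 1) • gevL ξ P)) (gevL ξ Q)

/-- The sum over multi-indices is split at the shared argument. Its generator joins those of Q in
the first term and those of P in the second, and in the third it stays between the two contractions
as `rgen`. The three factorial weights are exactly the normalisations of the resulting products. -/
theorem gev_schoutenPos {m p q n : ℕ} (ξ : Fin m → N) (P : N [⋀^Fin (p + 1)]→ₗ[R] R)
    (Q : N [⋀^Fin (q + 1)]→ₗ[R] R) (h : p + 1 + q = n + 1) :
    gev ξ (𝓓.schoutenPos P Q h) = 𝓓.gevS ξ P Q := by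
  have hcast : ∀ {k : ℕ} (h : p + 1 + q = k),
      gev ξ (antisymm fun v => 𝓓.pre P Q (v ∘ Fin.cast h)) =
        ∑ J : Fin (p + 1 + q) → Fin m, 𝓓.pre P Q (ξ ∘ J) ⊗ₜ[ℝ] theta J := by
    rintro k rfl
    exact gev_antisymm ξ _
  have hpre : ∀ (i : Fin m) (I : Fin p → Fin m) (K : Fin q → Fin m),
      𝓓.pre P Q (ξ ∘ Fin.append ((Fin.last p).insertNth i I : Fin (p + 1) → Fin m) K) =
      𝓓.core (p.factorial * (q + 1).factorial : ℝ)⁻¹ ((p + 1).factorial * q.factorial : ℝ)⁻¹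
        (p.factorial * q.factorial : ℝ)⁻¹
        ((-1 : ℝ) ^ p • slot P (ξ ∘ I)) (slot Q (ξ ∘ K)) (ξ i) := by
    intro i I K
    rw [pre]
    congr 2
    · congr 1
      ext1 k
      simp
    · ext1 k
      simp
    · simp
  refine (hcast h).trans ?_
  rw [sum_append, sum_insertNth (Fin.last p)]
  simp only [hpre, theta_append, theta_insertNth_last, core, TensorProduct.sub_tmul,
    Finset.sum_sub_distrib, gevS]
  congr 1
  congr 1
  · rw [gevL, gev, gev]
    simp only [map_smul, map_sum, LinearMap.smul_apply, LinearMap.sum_apply, gmul_tmul,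
      Finset.smul_sum, act_apply, slot_apply]
    conv_rhs => rw [sum_insertNth 0]
    refine Finset.sum_congr rfl fun i _ => ?_
    rw [Finset.sum_comm]
    refine Finset.sum_congr rfl fun K _ => ?_
    refine Finset.sum_congr rfl fun I _ => ?_
    rw [comp_insertNth, Fin.insertNth_zero', Fin.insertNth_zero', theta_cons, ← mul_assoc,
      LinearMap.map_smul_of_tower, Derivation.smul_apply, mul_inv]
    simp only [← TensorProduct.smul_tmul', smul_smul]
    congr 1
    ring
  · rw [gevL, gev, gev]
    simp only [map_smul, map_sum, LinearMap.smul_apply, LinearMap.sum_apply, gmul_tmul,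
      Finset.smul_sum, act_apply, slot_apply, LinearMap.flip_apply]
    conv_rhs => rw [Finset.sum_comm, sum_insertNth (Fin.last p)]
    refine Finset.sum_congr rfl fun i _ => ?_
    refine Finset.sum_congr rfl fun I _ => ?_
    refine Finset.sum_congr rfl fun K _ => ?_
    rw [comp_insertNth, alternating_insertNth, theta_insertNth_last, Fin.val_last, mul_inv]
    simp only [Derivation.map_smul, ← TensorProduct.smul_tmul', smul_smul]
    congr 1
    ring
  · refine Finset.sum_congr rfl fun i _ => ?_
    rw [gevL, gev, gevL, gev]
    simp only [map_smul, map_sum, LinearMap.smul_apply, LinearMap.sum_apply, gmul_tmul,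
      Finset.smul_sum, rgen_tmul, diffR_apply]
    conv_rhs => rw [Finset.sum_comm]
    refine Finset.sum_congr rfl fun I _ => ?_
    refine Finset.sum_congr rfl fun K _ => ?_
    rw [LinearMap.map_smul_of_tower, LinearMap.smul_apply, mul_inv]
    simp only [← TensorProduct.smul_tmul', smul_smul]
    congr 1
    ring

/-- The formula of positive degree persists in degree zero, because the contraction of a function is
zero. The later arguments therefore need no case distinction. -/
theorem gev_schouten : ∀ {m p q n : ℕ} (ξ : Fin m → N) (h : n + 1 = p + q)
    (P : N [⋀^Fin p]→ₗ[R] R) (Q : N [⋀^Fin q]→ₗ[R] R),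
    gev ξ (𝓓.schouten h P Q) = 𝓓.gevS ξ P Q
  | _, 0, 0, _, _, h, _, _ => by omega
  | m, 0, q + 1, n, ξ, h, f, Q => by
    obtain rfl : n = q := by omega
    rw [gevS, gev_zero_deg ξ f, gmul_one_left, gevL, gevL, gev_map]
    simp only [smul_zero, map_zero, LinearMap.zero_apply, Finset.sum_const_zero, sub_zero, zero_sub]
    rw [← neg_one_smul ℝ, ← gev_smul]
    congr 1
    ext1 v
    simp only [neg_smul, one_smul]
    rfl
  | m, p + 1, 0, n, ξ, h, P, g => by
    obtain rfl : n = p := by omega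
    rw [gevS, gev_zero_deg ξ g, gmul_one_right, gevL, gevL, map_smul, gev_map]
    simp only [map_zero, Finset.sum_const_zero, sub_zero]
    rw [← gev_smul]
    congr 1
    ext1 v
    change 𝓓.anchor ((-1 : ℝ) ^ n • slot P v) (g ![]) = _
    rw [LinearMap.map_smul_of_tower, Derivation.smul_apply, pow_add, pow_add]
    simp
  | _, _ + 1, _ + 1, 0, _, h, _, _ => by omega
  | m, p + 1, q + 1, n + 1, ξ, h, P, Q => 𝓓.gev_schoutenPos ξ P Q (by omega)

end DualAnchoredBracket

end SchoutenGenerating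

/-! ### Leibniz rule and graded skewness of the Schouten bracket. -/

section SchoutenLeibniz

open scoped TensorProduct

section Products

variable {m : ℕ} {X Y Z W V V' : Type*} [AddCommGroup X] [Module ℝ X] [AddCommGroup Y] [Module ℝ Y]
  [AddCommGroup Z] [Module ℝ Z] [AddCommGroup W] [Module ℝ W] [AddCommGroup V] [Module ℝ V]
  [AddCommGroup V'] [Module ℝ V']

theorem rgen_mem {p : ℕ} (i : Fin m) {x : X ⊗[ℝ] Grass m} (hx : x ∈ homog X m p) :
    rgen X i x ∈ homog X m (p + 1) := by
  have h : rgen X i x = (-1 : ℝ) ^ p • lgen X i x := by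
    rw [lgen_eq_rgen i hx, smul_smul, ← pow_add, Even.neg_one_pow ⟨_, rfl⟩, one_smul]
  rw [h]
  exact Submodule.smul_mem _ _ (lgen_mem i hx)

theorem gmul_neg_left (b : X →ₗ[ℝ] Y →ₗ[ℝ] Z) (x : X ⊗[ℝ] Grass m) (y : Y ⊗[ℝ] Grass m) :
    gmul (-b) x y = -gmul b x y := by
  induction x using TensorProduct.induction_on with
  | zero => simp
  | add x x' hx hx' => simp only [map_add, LinearMap.add_apply, hx, hx', neg_add]
  | tmul x a =>
  induction y using TensorProduct.induction_on with
  | zero => simp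
  | add y y' hy hy' => simp only [map_add, hy, hy', neg_add]
  | tmul y c => simp [TensorProduct.neg_tmul]

/-- The sign is the cost of moving the generators of x past those of y, which happens only in the
second term. -/
theorem gmul_leibniz (b₁ : X →ₗ[ℝ] V →ₗ[ℝ] W) (b₂ : Y →ₗ[ℝ] Z →ₗ[ℝ] V)
    {U U' : Type*} [AddCommGroup U] [Module ℝ U] [AddCommGroup U'] [Module ℝ U']
    (b₃ : U →ₗ[ℝ] Z →ₗ[ℝ] W) (b₄ : X →ₗ[ℝ] Y →ₗ[ℝ] U) (b₅ : Y →ₗ[ℝ] U' →ₗ[ℝ] W)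
    (b₆ : X →ₗ[ℝ] Z →ₗ[ℝ] U')
    (h : ∀ x y z, b₁ x (b₂ y z) = b₃ (b₄ x y) z + b₅ y (b₆ x z)) {p q : ℕ}
    {x : X ⊗[ℝ] Grass m} {y : Y ⊗[ℝ] Grass m} (hx : x ∈ homog X m p) (hy : y ∈ homog Y m q)
    (z : Z ⊗[ℝ] Grass m) :
    gmul b₁ x (gmul b₂ y z) =
      gmul b₃ (gmul b₄ x y) z + (-1 : ℝ) ^ (p * q) • gmul b₅ y (gmul b₆ x z) := by
  induction hx, hy using Submodule.span_induction₂ with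
  | mem_mem x y hx hy =>
    obtain ⟨x, I, rfl⟩ := hx
    obtain ⟨y, J, rfl⟩ := hy
    induction z using TensorProduct.induction_on with
    | zero => simp
    | add z z' hz hz' => simp only [map_add, hz, hz', smul_add]; abel
    | tmul z c =>
      simp only [gmul_tmul, h, TensorProduct.add_tmul]
      rw [mul_assoc, ← TensorProduct.tmul_smul]
      congr 2
      rw [← mul_assoc, ← mul_assoc, theta_mul_theta, smul_mul_assoc]
  | zero_left y hy => simp
  | zero_right x hx => simp
  | add_left x y z _ _ _ hx hy =>
    simp only [map_add, LinearMap.add_apply, hx, hy, smul_add]; abel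
  | add_right x y z _ _ _ hx hy =>
    simp only [map_add, LinearMap.add_apply, hx, hy, smul_add]; abel
  | smul_left r x y _ _ h => simp only [map_smul, LinearMap.smul_apply, h, smul_add, smul_comm r]
  | smul_right r x y _ _ h => simp only [map_smul, LinearMap.smul_apply, h, smul_add, smul_comm r]

theorem gmul_zero_left (x : X ⊗[ℝ] Grass m) (y : Y ⊗[ℝ] Grass m) :
    gmul (0 : X →ₗ[ℝ] Y →ₗ[ℝ] Z) x y = 0 := by
  induction x using TensorProduct.induction_on with
  | zero => simp
  | add x x' hx hx' => simp only [map_add, LinearMap.add_apply, hx, hx', add_zero]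
  | tmul x a =>
  induction y using TensorProduct.induction_on with
  | zero => simp
  | add y y' hy hy' => simp only [map_add, hy, hy', add_zero]
  | tmul y c => simp

theorem gmul_left_comm (b₁ : X →ₗ[ℝ] V →ₗ[ℝ] W) (b₂ : Y →ₗ[ℝ] Z →ₗ[ℝ] V)
    (b₅ : Y →ₗ[ℝ] V' →ₗ[ℝ] W) (b₆ : X →ₗ[ℝ] Z →ₗ[ℝ] V')
    (h : ∀ x y z, b₁ x (b₂ y z) = b₅ y (b₆ x z)) {p q : ℕ}
    {x : X ⊗[ℝ] Grass m} {y : Y ⊗[ℝ] Grass m} (hx : x ∈ homog X m p) (hy : y ∈ homog Y m q)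
    (z : Z ⊗[ℝ] Grass m) :
    gmul b₁ x (gmul b₂ y z) = (-1 : ℝ) ^ (p * q) • gmul b₅ y (gmul b₆ x z) := by
  have := gmul_leibniz b₁ b₂ (0 : W →ₗ[ℝ] Z →ₗ[ℝ] W) 0 b₅ b₆ (by simpa using h) hx hy z
  rwa [gmul_zero_left, zero_add] at this

end Products

variable {R N : Type*} [CommRing R] [Algebra ℝ R] [AddCommGroup N] [Module R N] [Module ℝ N]

theorem exists_gevL_mem_homog {m p : ℕ} (ξ : Fin m → N) (P : N [⋀^Fin p]→ₗ[R] R) :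
    ∃ l, Even (l + p + 1) ∧ gevL ξ P ∈ homog _ m l := by
  cases p with
  -- A function has zero contraction, which is homogeneous of every degree; 1 is chosen for its
  -- parity.
  | zero => exact ⟨1, by decide, Submodule.zero_mem _⟩
  | succ p => exact ⟨p, ⟨p + 1, by ring⟩, gevL_mem_homog ξ P⟩

namespace DualAnchoredBracket

variable (𝓓 : DualAnchoredBracket R N)

/-- The Schouten bracket of generating functions `F` and `G`, with contractions `L` and `K`. -/
def form {m : ℕ} (ξ : Fin m → N) (F : R ⊗[ℝ] Grass m) (L : Module.Dual R N ⊗[ℝ] Grass m)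
    (G : R ⊗[ℝ] Grass m) (K : Module.Dual R N ⊗[ℝ] Grass m) : R ⊗[ℝ] Grass m :=
  gmul 𝓓.act L G - gmul 𝓓.act.flip F K - ∑ i, gmul (𝓓.diffR (ξ i)) (rgen _ i L) K

theorem gevS_eq_form {m p q : ℕ} (ξ : Fin m → N) (P : N [⋀^Fin p]→ₗ[R] R)
    (Q : N [⋀^Fin q]→ₗ[R] R) : 𝓓.gevS ξ P Q =
      𝓓.form ξ (gev ξ P) ((-1 : ℝ) ^ (p + 1) • gevL ξ P) (gev ξ Q) (gevL ξ Q) := rfl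

theorem form_add {m : ℕ} (ξ : Fin m → N) (F L) (G G' : R ⊗[ℝ] Grass m) (K K') :
    𝓓.form ξ F L (G + G') (K + K') = 𝓓.form ξ F L G K + 𝓓.form ξ F L G' K' := by
  simp only [form, map_add, Finset.sum_add_distrib]
  abel

theorem form_smul {m : ℕ} (ξ : Fin m → N) (F L) (c : ℝ) (G : R ⊗[ℝ] Grass m) (K) :
    𝓓.form ξ F L (c • G) (c • K) = c • 𝓓.form ξ F L G K := by
  simp only [form, map_smul, smul_sub, Finset.smul_sum]

/-- In the first term linear forms differentiate the product A B. In the other two only the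
contraction of A B occurs, and it splits as an antiderivation. All signs reduce to (−1)^((p+1)a)
because L has the parity of p + 1. -/
theorem form_leibniz {m p l a : ℕ} (ξ : Fin m → N) {F : R ⊗[ℝ] Grass m}
    {L : Module.Dual R N ⊗[ℝ] Grass m} {A : R ⊗[ℝ] Grass m} (hlp : Even (l + p + 1))
    (hF : F ∈ homog _ m p) (hL : L ∈ homog _ m l) (hA : A ∈ homog _ m a)
    (B : R ⊗[ℝ] Grass m) (KA KB) :
    𝓓.form ξ F L (gmul (LinearMap.mul ℝ R) A B)
      (gmul (smulDual R N).flip KA B + (-1 : ℝ) ^ a • gmul (smulDual R N) A KB) =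
    gmul (LinearMap.mul ℝ R) (𝓓.form ξ F L A KA) B +
      (-1 : ℝ) ^ ((p + 1) * a) • gmul (LinearMap.mul ℝ R) A (𝓓.form ξ F L B KB) := by
  have s1 : (-1 : ℝ) ^ (l * a) = (-1) ^ ((p + 1) * a) := by
    apply neg_one_pow_congr
    simp only [Nat.even_mul, Nat.even_add, Nat.not_even_one, iff_false] at hlp ⊢
    tauto
  have s2 : (-1 : ℝ) ^ a * (-1) ^ (p * a) = (-1) ^ ((p + 1) * a) := by ring
  have s3 : (-1 : ℝ) ^ a * (-1) ^ ((l + 1) * a) = (-1) ^ ((p + 1) * a) := by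
    rw [← s1, ← pow_add]
    exact neg_one_pow_congr (by simp only [Nat.even_mul, Nat.even_add, Nat.not_even_one]; tauto)
  have t1 := gmul_leibniz 𝓓.act (LinearMap.mul ℝ R) (LinearMap.mul ℝ R) 𝓓.act
    (LinearMap.mul ℝ R) 𝓓.act (fun φ f g => by simp; ring) hL hA B
  have t2 : gmul 𝓓.act.flip F (gmul (smulDual R N).flip KA B) =
      gmul (LinearMap.mul ℝ R) (gmul 𝓓.act.flip F KA) B :=
    (gmul_assoc _ _ _ _ (fun f φ g => by simp [mul_comm]) _ _ _).symm
  have t3 : gmul 𝓓.act.flip F (gmul (smulDual R N) A KB) =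
      (-1 : ℝ) ^ (p * a) • gmul (LinearMap.mul ℝ R) A (gmul 𝓓.act.flip F KB) :=
    gmul_left_comm _ _ _ _ (fun f g φ => by simp) hF hA _
  have t4 : ∀ i, gmul (𝓓.diffR (ξ i)) (rgen _ i L) (gmul (smulDual R N).flip KA B) =
      gmul (LinearMap.mul ℝ R) (gmul (𝓓.diffR (ξ i)) (rgen _ i L) KA) B := fun i =>
    (gmul_assoc _ _ _ _ (fun f φ g => by simp [mul_comm]) _ _ _).symm
  have t5 : ∀ i, gmul (𝓓.diffR (ξ i)) (rgen _ i L) (gmul (smulDual R N) A KB) =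
      (-1 : ℝ) ^ ((l + 1) * a) •
        gmul (LinearMap.mul ℝ R) A (gmul (𝓓.diffR (ξ i)) (rgen _ i L) KB) := fun i =>
    gmul_left_comm _ _ _ _ (fun f g φ => by simp) (rgen_mem i hL) hA _
  simp only [form, map_add, map_smul, t1, t2, t3, t4, t5, map_sub, LinearMap.sub_apply, map_sum,
    LinearMap.sum_apply, smul_sub, Finset.sum_add_distrib, smul_smul, s2, s3, s1, Finset.smul_sum]
  abel

/-- Sums of two products are allowed because the differential of a product has this form. -/
theorem gevS_of_gev_eq {m p n a₁ b₁ a₂ b₂ : ℕ} (P : N [⋀^Fin p]→ₗ[R] R) (Z : N [⋀^Fin n]→ₗ[R] R)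
    (A₁ : N [⋀^Fin a₁]→ₗ[R] R) (B₁ : N [⋀^Fin b₁]→ₗ[R] R) (A₂ : N [⋀^Fin a₂]→ₗ[R] R)
    (B₂ : N [⋀^Fin b₂]→ₗ[R] R) (c₁ c₂ : ℝ)
    (h : ∀ (m : ℕ) (ξ : Fin m → N), gev ξ Z =
      c₁ • gmul (LinearMap.mul ℝ R) (gev ξ A₁) (gev ξ B₁) +
      c₂ • gmul (LinearMap.mul ℝ R) (gev ξ A₂) (gev ξ B₂)) (ξ : Fin m → N) :
    𝓓.gevS ξ P Z =
      c₁ • (gmul (LinearMap.mul ℝ R) (𝓓.gevS ξ P A₁) (gev ξ B₁) +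
        (-1 : ℝ) ^ ((p + 1) * a₁) • gmul (LinearMap.mul ℝ R) (gev ξ A₁) (𝓓.gevS ξ P B₁)) +
      c₂ • (gmul (LinearMap.mul ℝ R) (𝓓.gevS ξ P A₂) (gev ξ B₂) +
        (-1 : ℝ) ^ ((p + 1) * a₂) • gmul (LinearMap.mul ℝ R) (gev ξ A₂) (𝓓.gevS ξ P B₂)) := by
  obtain ⟨l, hl, hL⟩ := exists_gevL_mem_homog ξ P
  have hL' := Submodule.smul_mem _ ((-1 : ℝ) ^ (p + 1)) hL
  simp only [gevS_eq_form]
  rw [h, gevL_of_gev_eq Z A₁ B₁ A₂ B₂ c₁ c₂ h, form_add, form_smul, form_smul,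
    𝓓.form_leibniz ξ hl (gev_mem_homog ξ _) hL' (gev_mem_homog ξ _),
    𝓓.form_leibniz ξ hl (gev_mem_homog ξ _) hL' (gev_mem_homog ξ _)]

/-- Exchanging P and Q interchanges the first two terms and, by skewness of dζ, maps the third to
itself up to sign. What remains is a parity count. -/
theorem gevS_skew {m p q : ℕ} (ξ : Fin m → N) (P : N [⋀^Fin p]→ₗ[R] R)
    (Q : N [⋀^Fin q]→ₗ[R] R) :
    𝓓.gevS ξ Q P = -(-1 : ℝ) ^ ((p + 1) * (q + 1)) • 𝓓.gevS ξ P Q := by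
  obtain ⟨l, hl, hL⟩ := exists_gevL_mem_homog ξ P
  obtain ⟨k, hk, hK⟩ := exists_gevL_mem_homog ξ Q
  have hd : ∀ ζ : N, (𝓓.diffR ζ).flip = -𝓓.diffR ζ := by
    intro ζ
    ext φ ψ
    simpa using 𝓓.skew ζ ψ φ
  have t1 : gmul 𝓓.act (gevL ξ Q) (gev ξ P) =
      (-1 : ℝ) ^ (k * p) • gmul 𝓓.act.flip (gev ξ P) (gevL ξ Q) :=
    gmul_comm _ hK (gev_mem_homog ξ _)
  have t2 : gmul 𝓓.act.flip (gev ξ Q) (gevL ξ P) =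
      (-1 : ℝ) ^ (q * l) • gmul 𝓓.act (gevL ξ P) (gev ξ Q) :=
    gmul_comm _ (gev_mem_homog ξ _) hL
  have t3 : ∀ i, gmul (𝓓.diffR (ξ i)) (rgen _ i (gevL ξ Q)) (gevL ξ P) =
      -((-1 : ℝ) ^ ((k + 1) * l) * (-1 : ℝ) ^ k) •
        gmul (𝓓.diffR (ξ i)) (rgen _ i (gevL ξ P)) (gevL ξ Q) := by
    intro i
    have e : rgen _ i (gevL ξ Q) = (-1 : ℝ) ^ k • lgen _ i (gevL ξ Q) := by
      rw [lgen_eq_rgen i hK, smul_smul, ← pow_add, Even.neg_one_pow ⟨_, rfl⟩, one_smul]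
    rw [gmul_comm _ (rgen_mem i hK) hL, hd, gmul_neg_left, e, map_smul, rgen_gmul, smul_neg,
      smul_smul, neg_smul]
  have s1 : (-1 : ℝ) ^ (q + 1) * (-1 : ℝ) ^ (k * p) = (-1 : ℝ) ^ ((p + 1) * (q + 1)) := by
    rw [← pow_add]
    apply neg_one_pow_congr
    simp only [Nat.even_mul, Nat.even_add, Nat.not_even_one, iff_false] at hk ⊢
    tauto
  have s2 : (-1 : ℝ) ^ (q * l) = (-1 : ℝ) ^ ((p + 1) * (q + 1)) * (-1) ^ (p + 1) := by
    rw [← pow_add]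
    apply neg_one_pow_congr
    simp only [Nat.even_mul, Nat.even_add, Nat.not_even_one, iff_false] at hl ⊢
    tauto
  have s3 : (-1 : ℝ) ^ (q + 1) * ((-1 : ℝ) ^ ((k + 1) * l) * (-1 : ℝ) ^ k) =
      (-1 : ℝ) ^ ((p + 1) * (q + 1)) * (-1) ^ (p + 1) := by
    rw [← pow_add, ← pow_add, ← pow_add]
    apply neg_one_pow_congr
    simp only [Nat.even_mul, Nat.even_add, Nat.not_even_one, iff_false] at hl hk ⊢
    have hl' : Even l ↔ ¬Even p := by tauto
    have hk' : Even k ↔ ¬Even q := by tauto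
    rw [hl', hk']
    by_cases hp : Even p <;> by_cases hq : Even q <;> simp [hp, hq]
  have t4 : ∀ i, gmul (𝓓.diffR (ξ i)) (rgen _ i ((-1 : ℝ) ^ (q + 1) • gevL ξ Q)) (gevL ξ P) =
      -(-1 : ℝ) ^ ((p + 1) * (q + 1)) •
        gmul (𝓓.diffR (ξ i)) (rgen _ i ((-1 : ℝ) ^ (p + 1) • gevL ξ P)) (gevL ξ Q) := by
    intro i
    rw [map_smul, map_smul, LinearMap.smul_apply, t3 i, smul_smul, mul_neg, s3, map_smul,
      map_smul, LinearMap.smul_apply, smul_smul, neg_mul]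
  have t5 : gmul 𝓓.act ((-1 : ℝ) ^ (q + 1) • gevL ξ Q) (gev ξ P) =
      (-1 : ℝ) ^ ((p + 1) * (q + 1)) • gmul 𝓓.act.flip (gev ξ P) (gevL ξ Q) := by
    rw [map_smul, LinearMap.smul_apply, t1, smul_smul, s1]
  have t6 : gmul 𝓓.act.flip (gev ξ Q) (gevL ξ P) =
      (-1 : ℝ) ^ ((p + 1) * (q + 1)) •
        gmul 𝓓.act ((-1 : ℝ) ^ (p + 1) • gevL ξ P) (gev ξ Q) := by
    rw [map_smul, LinearMap.smul_apply, t2, smul_smul, s2]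
  rw [gevS, gevS, t5, t6, Finset.sum_congr rfl fun i _ => t4 i, ← Finset.smul_sum]
  simp only [neg_smul, smul_sub]
  abel

theorem schouten_skew {p q n : ℕ} (h : n + 1 = p + q) (h' : n + 1 = q + p)
    (P : N [⋀^Fin p]→ₗ[R] R) (Q : N [⋀^Fin q]→ₗ[R] R) :
    ⇑(𝓓.schouten h' Q P) = fun v => -(-1 : ℝ) ^ ((p + 1) * (q + 1)) • 𝓓.schouten h P Q v := by
  have := alternating_ext_gev (P := 𝓓.schouten h' Q P)
    (Q := algebraMap ℝ R (-(-1 : ℝ) ^ ((p + 1) * (q + 1))) • 𝓓.schouten h P Q) fun ξ => by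
      rw [gev_schouten, gevS_skew, ← gev_schouten (h := h), ← gev_smul]
      congr 1
      ext1 v
      rw [AlternatingMap.smul_apply, algebraMap_smul]
  ext1 v
  rw [this, AlternatingMap.smul_apply, algebraMap_smul]

end DualAnchoredBracket

end SchoutenLeibniz

/-! ### The derivation defect and its reduction to low degree. -/

section Defect

open scoped TensorProduct

variable {R N : Type*} [CommRing R] [Algebra ℝ R] [AddCommGroup N] [Module R N]

theorem gev_coe_add {m p : ℕ} (ξ : Fin m → N) (P Q : N [⋀^Fin p]→ₗ[R] R) :
    gev ξ ⇑(P + Q) = gev ξ P + gev ξ Q := gev_add ξ P Q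

theorem gevL_add {m p : ℕ} (ξ : Fin m → N) (P Q : N [⋀^Fin p]→ₗ[R] R) :
    gevL ξ (P + Q) = gevL ξ P + gevL ξ Q := by
  cases p with
  | zero => exact (add_zero _).symm
  | succ p => exact gev_add ξ (slot P) (slot Q)

/-- A scalar, as an alternating map of degree zero. -/
abbrev constAlt (N : Type*) [AddCommGroup N] [Module R N] (f : R) : N [⋀^Fin 0]→ₗ[R] R :=
  AlternatingMap.constOfIsEmpty R N (Fin 0) f

/-- A linear form, as an alternating map of degree one. -/
abbrev formAlt (e : Module.Dual R N) : N [⋀^Fin 1]→ₗ[R] R :=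
  AlternatingMap.ofSubsingleton R N R (0 : Fin 1) e

theorem gev_constAlt {m : ℕ} (ξ : Fin m → N) (f : R) :
    gev ξ (constAlt N f) = f ⊗ₜ[ℝ] (1 : Grass m) := by
  rw [gev_zero_deg]; rfl

theorem gev_formAlt {m : ℕ} (ξ : Fin m → N) (e : Module.Dual R N) :
    gev ξ (formAlt e) = ∑ k, e (ξ k) ⊗ₜ[ℝ] gen k := by
  rw [gev, sum_insertNth 0]
  refine Finset.sum_congr rfl fun k _ => ?_
  rw [Fintype.sum_unique, Fin.insertNth_zero', theta_cons, theta_zero_arg, mul_one]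
  simp

theorem gev_smul_coe {m p : ℕ} (ξ : Fin m → N) (f : R) (P : N [⋀^Fin p]→ₗ[R] R) :
    gev ξ ⇑(f • P) = gmul (LinearMap.mul ℝ R) (gev ξ (constAlt N f)) (gev ξ P) := by
  rw [gev_constAlt, gmul_one_left, gev_map]
  rfl

/-- The wedge product with a linear form. -/
def wedgeForm {q : ℕ} (e : Module.Dual R N) (P : N [⋀^Fin q]→ₗ[R] R) : N [⋀^Fin (q + 1)]→ₗ[R] R :=
  AlternatingMap.alternatizeUncurryFin (e.smulRight P)

/-- Euler's identity for a frame that is dual up to f: contracting with the frame and wedging back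
with the coframe counts the q + 1 slots. -/
theorem sum_wedgeForm {q k : ℕ} (f : R) (e : Fin k → Module.Dual R N) (ε : Fin k → N)
    (h : ∀ ζ, f • ζ = ∑ i, e i ζ • ε i) (Q : N [⋀^Fin (q + 1)]→ₗ[R] R) :
    ∑ i, wedgeForm (e i) (Q.curryLeft (ε i)) = (q + 1) • f • Q := by
  have e1 : ∑ i, (e i).smulRight (Q.curryLeft (ε i)) = f • Q.curryLeft := by
    refine LinearMap.ext fun ζ => ?_
    rw [LinearMap.sum_apply, LinearMap.smul_apply, ← map_smul, h, map_sum]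
    simp
  have e2 : f • (q + 1) • Q = AlternatingMap.alternatizeUncurryFin (f • Q.curryLeft) := by
    rw [AlternatingMap.alternatizeUncurryFin_smul, AlternatingMap.alternatizeUncurryFin_curryLeft]
  rw [smul_comm, e2, ← e1]
  exact (map_sum (AlternatingMap.alternatizeUncurryFinLM (R := R) (M := N) (N := R) (n := q))
    (fun i => (e i).smulRight (Q.curryLeft (ε i))) Finset.univ).symm

variable [Module ℝ N] [IsScalarTower ℝ R N]

theorem gev_wedgeForm {m q : ℕ} (ξ : Fin m → N) (e : Module.Dual R N) (P : N [⋀^Fin q]→ₗ[R] R) :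
    gev ξ (wedgeForm e P) = gmul (LinearMap.mul ℝ R) (gev ξ (formAlt e)) (gev ξ P) := by
  let f : N →ₗ[ℝ] N [⋀^Fin q]→ₗ[ℝ] R :=
    { toFun := fun ζ => altReal (e ζ • P)
      map_add' := fun x y => by ext v; simp [add_mul]
      map_smul' := fun c x => by ext v; simp [LinearMap.map_smul_of_tower] }
  have h : ⇑(wedgeForm e P) = ⇑(AlternatingMap.alternatizeUncurryFin f) := by
    ext v
    rw [wedgeForm, AlternatingMap.alternatizeUncurryFin_apply,
      AlternatingMap.alternatizeUncurryFin_apply]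
    rfl
  rw [h, gev_alternatizeUncurryFin, gev_formAlt, map_sum, LinearMap.sum_apply]
  refine Finset.sum_congr rfl fun k _ => ?_
  have : gev ξ (f (ξ k)) = gmul (LinearMap.mul ℝ R) (e (ξ k) ⊗ₜ 1) (gev ξ P) := by
    rw [gmul_one_left, gev_map]
    rfl
  rw [this, lgen_gmul, lgen_tmul, mul_one]

variable (𝒜 : AnchoredBracket R N) (𝓓 : DualAnchoredBracket R N)

theorem AnchoredBracket.d_add {p : ℕ} (P Q : N [⋀^Fin p]→ₗ[R] R) :
    𝒜.d (P + Q) = 𝒜.d P + 𝒜.d Q := by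
  refine alternating_ext_gev fun ξ => ?_
  rw [gev_coe_add]
  simp only [AnchoredBracket.gev_d, gevL_add, gev_coe_add, map_add, Finset.sum_add_distrib,
    smul_add]
  abel

theorem AnchoredBracket.gev_d_smul {p : ℕ} {P Q : N [⋀^Fin p]→ₗ[R] R} (c : ℝ)
    (h : ∀ v, Q v = c • P v) {m : ℕ} (ξ : Fin m → N) :
    gev ξ (𝒜.d Q) = c • gev ξ (𝒜.d P) := by
  have hQ : Q = algebraMap ℝ R c • P := by
    ext v; rw [h, AlternatingMap.smul_apply, algebraMap_smul]
  have e1 : gev ξ Q = c • gev ξ P := by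
    rw [← gev_smul]; congr 1; ext1 v; exact h v
  have e2 : gevL ξ Q = c • gevL ξ P := by
    cases p with
    | zero => exact (smul_zero _).symm
    | succ p =>
      rw [gevL, gevL, ← gev_smul]; congr 1; ext v; exact h _
  simp only [AnchoredBracket.gev_d, e1, e2, map_smul, smul_sub, Finset.smul_sum, smul_comm c]

namespace DualAnchoredBracket

theorem gevS_add {m p q : ℕ} (ξ : Fin m → N) (P : N [⋀^Fin p]→ₗ[R] R) (Q Q' : N [⋀^Fin q]→ₗ[R] R) :
    𝓓.gevS ξ P (Q + Q') = 𝓓.gevS ξ P Q + 𝓓.gevS ξ P Q' := by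
  rw [gevS_eq_form, gev_coe_add, gevL_add, form_add]
  rfl

theorem schouten_add {p q n : ℕ} (h : n + 1 = p + q) (P : N [⋀^Fin p]→ₗ[R] R)
    (Q Q' : N [⋀^Fin q]→ₗ[R] R) :
    𝓓.schouten h P (Q + Q') = 𝓓.schouten h P Q + 𝓓.schouten h P Q' := by
  refine alternating_ext_gev fun ξ => ?_
  rw [gev_coe_add]
  simp only [gev_schouten, gevS_add]

/-- The generating function of `d [P, Q]`, which is zero if `P` and `Q` have degree zero. -/
def gevDS {m p q : ℕ} (ξ : Fin m → N) (P : N [⋀^Fin p]→ₗ[R] R) (Q : N [⋀^Fin q]→ₗ[R] R) :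
    R ⊗[ℝ] Grass m :=
  if h : 0 < p + q then gev ξ (𝒜.d (𝓓.schouten (n := p + q - 1) (by omega) P Q)) else 0

/-- The generating function of `d [P, Q] - [d P, Q] - (-1)^{p-1} [P, d Q]`. -/
def gevDefect {m p q : ℕ} (ξ : Fin m → N) (P : N [⋀^Fin p]→ₗ[R] R) (Q : N [⋀^Fin q]→ₗ[R] R) :
    R ⊗[ℝ] Grass m :=
  𝓓.gevDS 𝒜 ξ P Q - 𝓓.gevS ξ (𝒜.d P) Q - (-1 : ℝ) ^ (p + 1) • 𝓓.gevS ξ P (𝒜.d Q)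

variable {𝒜}

theorem gevDS_eq {m p q n : ℕ} (h : n + 1 = p + q) (ξ : Fin m → N) (P : N [⋀^Fin p]→ₗ[R] R)
    (Q : N [⋀^Fin q]→ₗ[R] R) : 𝓓.gevDS 𝒜 ξ P Q = gev ξ (𝒜.d (𝓓.schouten h P Q)) := by
  obtain rfl : n = p + q - 1 := by omega
  rw [gevDS, dif_pos (by omega)]

theorem gevDS_zero {m : ℕ} (ξ : Fin m → N) (P Q : N [⋀^Fin 0]→ₗ[R] R) :
    𝓓.gevDS 𝒜 ξ P Q = 0 := rfl

theorem gevS_zero {m : ℕ} (ξ : Fin m → N) (P Q : N [⋀^Fin 0]→ₗ[R] R) :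
    𝓓.gevS ξ P Q = 0 := by
  simp [gevS, gevL]

theorem gevDS_add {m p q : ℕ} (ξ : Fin m → N) (P : N [⋀^Fin p]→ₗ[R] R)
    (Q Q' : N [⋀^Fin q]→ₗ[R] R) :
    𝓓.gevDS 𝒜 ξ P (Q + Q') = 𝓓.gevDS 𝒜 ξ P Q + 𝓓.gevDS 𝒜 ξ P Q' := by
  unfold gevDS
  split_ifs
  · rw [schouten_add, AnchoredBracket.d_add, gev_coe_add]
  · rw [add_zero]

theorem gevDS_skew {m p q : ℕ} (ξ : Fin m → N) (P : N [⋀^Fin p]→ₗ[R] R)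
    (Q : N [⋀^Fin q]→ₗ[R] R) :
    𝓓.gevDS 𝒜 ξ Q P = -(-1 : ℝ) ^ ((p + 1) * (q + 1)) • 𝓓.gevDS 𝒜 ξ P Q := by
  by_cases h : p + q = 0
  · obtain rfl : p = 0 := by omega
    obtain rfl : q = 0 := by omega
    rw [gevDS_zero, gevDS_zero, smul_zero]
  · obtain ⟨n, hn⟩ : ∃ n, n + 1 = p + q := ⟨p + q - 1, by omega⟩
    rw [𝓓.gevDS_eq hn, 𝓓.gevDS_eq (hn.trans (add_comm _ _))]
    exact 𝒜.gev_d_smul _ (congrFun (𝓓.schouten_skew hn (hn.trans (add_comm _ _)) P Q)) ξ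

theorem gevDefect_add {m p q : ℕ} (ξ : Fin m → N) (P : N [⋀^Fin p]→ₗ[R] R)
    (Q Q' : N [⋀^Fin q]→ₗ[R] R) :
    𝓓.gevDefect 𝒜 ξ P (Q + Q') = 𝓓.gevDefect 𝒜 ξ P Q + 𝓓.gevDefect 𝒜 ξ P Q' := by
  simp only [gevDefect, gevDS_add, gevS_add, AnchoredBracket.d_add, smul_add]
  abel

theorem gevDefect_skew {m p q : ℕ} (ξ : Fin m → N) (P : N [⋀^Fin p]→ₗ[R] R)
    (Q : N [⋀^Fin q]→ₗ[R] R) :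
    𝓓.gevDefect 𝒜 ξ Q P = -(-1 : ℝ) ^ ((p + 1) * (q + 1)) • 𝓓.gevDefect 𝒜 ξ P Q := by
  have s1 : (-1 : ℝ) ^ ((p + 1) * (q + 1 + 1)) =
      (-1 : ℝ) ^ ((p + 1) * (q + 1)) * (-1 : ℝ) ^ (p + 1) := by ring
  have s2 : (-1 : ℝ) ^ (q + 1) * (-1 : ℝ) ^ ((p + 1 + 1) * (q + 1)) =
      (-1 : ℝ) ^ ((p + 1) * (q + 1)) := by
    rw [← pow_add]
    exact neg_one_pow_congr (by simp only [Nat.even_mul, Nat.even_add, Nat.not_even_one]; tauto)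
  rw [gevDefect, gevDefect, gevDS_skew, 𝓓.gevS_skew ξ P (𝒜.d Q), 𝓓.gevS_skew ξ (𝒜.d P) Q, s1,
    smul_smul _ _ (𝓓.gevS ξ (𝒜.d P) Q), mul_neg, s2]
  generalize 𝓓.gevDS 𝒜 ξ P Q = x
  generalize 𝓓.gevS ξ (𝒜.d P) Q = y
  generalize 𝓓.gevS ξ P (𝒜.d Q) = z
  module

/-- The Leibniz rule of [P, ·] is followed by that of d. The case distinctions are needed because
the bracket of two functions is zero but is not an alternating map of some degree. -/
theorem gevDS_of_gev_eq {p z a b : ℕ} (P : N [⋀^Fin p]→ₗ[R] R)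
    (Z : N [⋀^Fin z]→ₗ[R] R) (A : N [⋀^Fin a]→ₗ[R] R) (B : N [⋀^Fin b]→ₗ[R] R) (hz : z = a + b)
    (h : ∀ (m : ℕ) (ξ : Fin m → N),
      gev ξ Z = gmul (LinearMap.mul ℝ R) (gev ξ A) (gev ξ B)) {m : ℕ} (ξ : Fin m → N) :
    𝓓.gevDS 𝒜 ξ P Z =
      gmul (LinearMap.mul ℝ R) (𝓓.gevDS 𝒜 ξ P A) (gev ξ B) +
      (-1 : ℝ) ^ (p + a + 1) • gmul (LinearMap.mul ℝ R) (𝓓.gevS ξ P A) (gev ξ (𝒜.d B)) +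
      (-1 : ℝ) ^ ((p + 1) * a) • (gmul (LinearMap.mul ℝ R) (gev ξ (𝒜.d A)) (𝓓.gevS ξ P B) +
        (-1 : ℝ) ^ a • gmul (LinearMap.mul ℝ R) (gev ξ A) (𝓓.gevDS 𝒜 ξ P B)) := by
  have hS : ∀ (m : ℕ) (ξ : Fin m → N), 𝓓.gevS ξ P Z =
      gmul (LinearMap.mul ℝ R) (𝓓.gevS ξ P A) (gev ξ B) +
        (-1 : ℝ) ^ ((p + 1) * a) • gmul (LinearMap.mul ℝ R) (gev ξ A) (𝓓.gevS ξ P B) := by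
    intro m ξ
    have := 𝓓.gevS_of_gev_eq P Z A B A B 1 0 (m := m) (fun m ξ => by rw [h]; simp) ξ
    simpa using this
  have sq : ∀ k : ℕ, (-1 : ℝ) ^ (k + 1 + 1) = (-1) ^ k := fun k => by ring
  by_cases hpz : p + z = 0
  · obtain rfl : p = 0 := by omega
    obtain rfl : z = 0 := by omega
    obtain rfl : a = 0 := by omega
    obtain rfl : b = 0 := by omega
    simp only [gevDS_zero, gevS_zero, map_zero, LinearMap.zero_apply, smul_zero, add_zero]
  obtain ⟨n, hn⟩ : ∃ n, n + 1 = p + z := ⟨p + z - 1, by omega⟩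
  rw [𝓓.gevDS_eq hn]
  -- Here [P, A] is absent and only A ∧ [P, B] remains; it fills both pairs of the two-term rule,
  -- the second with coefficient 0.
  by_cases hpa : p + a = 0
  · obtain rfl : p = 0 := by omega
    obtain rfl : a = 0 := by omega
    have hb : n + 1 = 0 + b := by omega
    rw [𝒜.gev_d_of_gev_eq _ A (𝓓.schouten hb P B) A (𝓓.schouten hb P B) 1 0 (fun m ξ => by
      rw [gev_schouten, hS, gev_schouten, gevS_zero]; simp), 𝓓.gevDS_eq hb, gevDS_zero, gevS_zero,
      gev_schouten]
    simp
  by_cases hpb : p + b = 0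
  · obtain rfl : p = 0 := by omega
    obtain rfl : b = 0 := by omega
    have ha : n + 1 = 0 + a := by omega
    rw [𝒜.gev_d_of_gev_eq _ (𝓓.schouten ha P A) B (𝓓.schouten ha P A) B 1 0 (fun m ξ => by
      rw [gev_schouten, hS, gev_schouten, gevS_zero]; simp), 𝓓.gevDS_eq ha, gevDS_zero, gevS_zero,
      gev_schouten, ← ha, sq]
    simp
  obtain ⟨i, hi⟩ : ∃ i, i + 1 = p + a := ⟨p + a - 1, by omega⟩
  obtain ⟨j, hj⟩ : ∃ j, j + 1 = p + b := ⟨p + b - 1, by omega⟩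
  rw [𝒜.gev_d_of_gev_eq _ (𝓓.schouten hi P A) B A (𝓓.schouten hj P B) 1 ((-1) ^ ((p + 1) * a))
    (fun m ξ => by rw [gev_schouten, hS, gev_schouten, gev_schouten]; simp), 𝓓.gevDS_eq hi,
    𝓓.gevDS_eq hj, gev_schouten, gev_schouten, ← hi, sq, one_smul]

/-- The defect is the graded commutator of d with [P, ·], minus [dP, ·]. All of these are
derivations of the wedge product, so the mixed terms cancel and a derivation of parity p remains. -/
theorem gevDefect_of_gev_eq {p z a b : ℕ} (P : N [⋀^Fin p]→ₗ[R] R)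
    (Z : N [⋀^Fin z]→ₗ[R] R) (A : N [⋀^Fin a]→ₗ[R] R) (B : N [⋀^Fin b]→ₗ[R] R) (hz : z = a + b)
    (h : ∀ (m : ℕ) (ξ : Fin m → N),
      gev ξ Z = gmul (LinearMap.mul ℝ R) (gev ξ A) (gev ξ B)) {m : ℕ} (ξ : Fin m → N) :
    𝓓.gevDefect 𝒜 ξ P Z =
      gmul (LinearMap.mul ℝ R) (𝓓.gevDefect 𝒜 ξ P A) (gev ξ B) +
        (-1 : ℝ) ^ (p * a) • gmul (LinearMap.mul ℝ R) (gev ξ A) (𝓓.gevDefect 𝒜 ξ P B) := by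
  have e1 := 𝓓.gevS_of_gev_eq (𝒜.d P) Z A B A B 1 0 (m := m) (fun m ξ => by rw [h]; simp) ξ
  have e2 := 𝓓.gevS_of_gev_eq P (𝒜.d Z) (𝒜.d A) B A (𝒜.d B) 1 ((-1) ^ a) (m := m) (fun m ξ => by
    rw [𝒜.gev_d_of_gev_eq Z A B A B 1 0 (fun m ξ => by rw [h]; simp)]
    simp) ξ
  have e3 := 𝓓.gevDS_of_gev_eq (𝒜 := 𝒜) P Z A B hz h ξ
  simp only [zero_smul, add_zero, one_smul] at e1 e2
  have s1 : (-1 : ℝ) ^ ((p + 1) * a) * (-1) ^ a = (-1) ^ (p * a) := by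
    rw [← pow_add]
    exact neg_one_pow_congr (by simp only [Nat.even_mul, Nat.even_add, Nat.not_even_one]; tauto)
  have s2 : (-1 : ℝ) ^ ((p + 1 + 1) * a) = (-1) ^ (p * a) :=
    neg_one_pow_congr (by simp only [Nat.even_mul, Nat.even_add, Nat.not_even_one]; tauto)
  have s3 : (-1 : ℝ) ^ (p + 1) * (-1) ^ a = (-1) ^ (p + a + 1) := by ring
  have s4 : (-1 : ℝ) ^ (p + 1) * (-1) ^ ((p + 1) * (a + 1)) = (-1) ^ ((p + 1) * a) := by
    rw [← pow_add]
    exact neg_one_pow_congr (by simp only [Nat.even_mul, Nat.even_add, Nat.not_even_one]; tauto)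
  have s5 : (-1 : ℝ) ^ (p + 1) * ((-1) ^ a * (-1) ^ ((p + 1) * a)) =
      (-1) ^ (p * a) * (-1) ^ (p + 1) := by
    rw [← s1]; ring
  simp only [gevDefect, e1, e2, e3, map_sub, map_smul, LinearMap.sub_apply, LinearMap.smul_apply,
    smul_add, smul_sub, smul_smul, s1, s2, s3, s4, s5]
  abel

theorem gevDefect_eq_zero_right {p : ℕ} (P : N [⋀^Fin p]→ₗ[R] R) (I : Set R)
    (hI : ∀ r : R, (∀ f ∈ I, f * r = 0) → r = 0)
    (hframe : ∀ f ∈ I, ∃ (k : ℕ) (e : Fin k → Module.Dual R N) (ε : Fin k → N),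
      ∀ ζ, f • ζ = ∑ i, e i ζ • ε i)
    (h0 : ∀ (g : R) (m : ℕ) (ξ : Fin m → N), 𝓓.gevDefect 𝒜 ξ P (constAlt N g) = 0)
    (h1 : ∀ (e : Module.Dual R N) (m : ℕ) (ξ : Fin m → N), 𝓓.gevDefect 𝒜 ξ P (formAlt e) = 0) :
    ∀ {q : ℕ} (Q : N [⋀^Fin q]→ₗ[R] R) {m : ℕ} (ξ : Fin m → N), 𝓓.gevDefect 𝒜 ξ P Q = 0 := by
  intro q
  induction q with
  | zero =>
    intro Q m ξ
    have : Q = constAlt N (Q ![]) := by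
      ext v
      exact congrArg Q (Subsingleton.elim _ _)
    rw [this]
    exact h0 _ _ _
  | succ q ih =>
    intro Q m ξ
    refine eq_zero_of_forall_rTensor (K := I) (fun f => LinearMap.mulLeft ℝ (f : R))
      (fun r hr => hI r fun f hf => hr ⟨f, hf⟩) _ fun f => ?_
    obtain ⟨k, e, ε, he⟩ := hframe f f.2
    -- By Euler's identity (q + 1) f Q is a sum of products of a linear form with a map of degree q.
    -- The derivation rule, `h1` and the induction hypothesis kill the defect of each.
    have hsum : 𝓓.gevDefect 𝒜 ξ P ((q + 1) • (f : R) • Q) = 0 := by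
      rw [← sum_wedgeForm (f : R) e ε he Q]
      let Φ : (N [⋀^Fin (q + 1)]→ₗ[R] R) →+ R ⊗[ℝ] Grass m :=
        AddMonoidHom.mk' (fun Q => 𝓓.gevDefect 𝒜 ξ P Q) (𝓓.gevDefect_add ξ P)
      change Φ _ = 0
      rw [map_sum]
      refine Finset.sum_eq_zero fun i _ => ?_
      change 𝓓.gevDefect 𝒜 ξ P _ = 0
      rw [𝓓.gevDefect_of_gev_eq P _ _ _ (add_comm _ _) fun m ξ => gev_wedgeForm ξ (e i) _, h1, ih]
      simp
    -- The defect of the scalar f vanishes, so f can be taken out of the defect of f Q.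
    have hprod := 𝓓.gevDefect_of_gev_eq (𝒜 := 𝒜) P ((f : R) • Q) _ Q (zero_add _).symm
      (fun m ξ => gev_smul_coe ξ (f : R) Q) ξ
    rw [h0, map_zero, LinearMap.zero_apply, zero_add, mul_zero, pow_zero, one_smul, gev_constAlt,
      gmul_one_left] at hprod
    have hn : 𝓓.gevDefect 𝒜 ξ P ((q + 1) • (f : R) • Q) =
        (q + 1) • 𝓓.gevDefect 𝒜 ξ P ((f : R) • Q) :=
      map_nsmul (AddMonoidHom.mk' (fun Q => 𝓓.gevDefect 𝒜 ξ P Q) (𝓓.gevDefect_add ξ P)) _ _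
    rw [hn, ← Nat.cast_smul_eq_nsmul ℝ, smul_eq_zero, hprod] at hsum
    exact hsum.resolve_left (by positivity)

/-- A differential is a derivation of a Schouten bracket if it is one in degrees zero and one. -/
theorem gevDefect_eq_zero (I : Set R) (hI : ∀ r : R, (∀ f ∈ I, f * r = 0) → r = 0)
    (hframe : ∀ f ∈ I, ∃ (k : ℕ) (e : Fin k → Module.Dual R N) (ε : Fin k → N),
      ∀ ζ, f • ζ = ∑ i, e i ζ • ε i)
    (h00 : ∀ (f g : R) (m : ℕ) (ξ : Fin m → N),
      𝓓.gevDefect 𝒜 ξ (constAlt N f) (constAlt N g) = 0)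
    (h10 : ∀ (e : Module.Dual R N) (g : R) (m : ℕ) (ξ : Fin m → N),
      𝓓.gevDefect 𝒜 ξ (formAlt e) (constAlt N g) = 0)
    (h11 : ∀ (e e' : Module.Dual R N) (m : ℕ) (ξ : Fin m → N),
      𝓓.gevDefect 𝒜 ξ (formAlt e) (formAlt e') = 0)
    {p q : ℕ} (P : N [⋀^Fin p]→ₗ[R] R) (Q : N [⋀^Fin q]→ₗ[R] R) {m : ℕ} (ξ : Fin m → N) :
    𝓓.gevDefect 𝒜 ξ P Q = 0 := by
  -- The degree of Q is reduced first. Graded skewness then exchanges the arguments, and the degree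
  -- of P is reduced in the same way.
  refine 𝓓.gevDefect_eq_zero_right P I hI hframe (fun g m ξ => ?_) (fun e m ξ => ?_) Q ξ
  · rw [gevDefect_skew, 𝓓.gevDefect_eq_zero_right _ I hI hframe (h00 g) (fun e m ξ => ?_),
      smul_zero]
    rw [gevDefect_skew, h10, smul_zero]
  · rw [gevDefect_skew, 𝓓.gevDefect_eq_zero_right _ I hI hframe (h10 e) (h11 e), smul_zero]

end DualAnchoredBracket

end Defect

/-! ### The derivation rule in degrees zero and one. -/

section LowDegree

open scoped TensorProduct

variable {R N : Type*} [CommRing R] [Algebra ℝ R] [AddCommGroup N] [Module R N] [Module ℝ N]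
  [IsScalarTower ℝ R N]

section

variable (𝒜 : AnchoredBracket R N) (𝓓 : DualAnchoredBracket R N)

/-- The differential of a scalar, as a linear form. -/
def AnchoredBracket.dScalar (f : R) : Module.Dual R N where
  toFun ζ := 𝒜.anchor ζ f
  map_add' _ _ := by simp
  map_smul' _ _ := by simp

@[simp] theorem AnchoredBracket.dScalar_apply (f : R) (ζ : N) :
    𝒜.dScalar f ζ = 𝒜.anchor ζ f := rfl

theorem AnchoredBracket.d_constAlt (f : R) :
    𝒜.d (constAlt N f) = formAlt (𝒜.dScalar f) := by
  ext v
  rw [AnchoredBracket.coe_d, AnchoredBracket.dReal, AlternatingMap.alternatizeUncurryFin_apply]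
  simp

theorem AnchoredBracket.d_formAlt (e : Module.Dual R N) (v : Fin 2 → N) :
    𝒜.d (formAlt e) v = 𝒜.anchor (v 0) (e (v 1)) - 𝒜.anchor (v 1) (e (v 0)) -
      e (𝒜.bracket (v 0) (v 1)) := by
  rw [AnchoredBracket.coe_d, AnchoredBracket.dReal_succ_apply, Fin.sum_univ_two]
  simp [Fin.removeNth, Fin.tail, sub_eq_add_neg]

/-- The differential of a linear form, contracted with an element in its second slot. -/
def AnchoredBracket.dContract (e : Module.Dual R N) (η : N) : Module.Dual R N :=
  slot (𝒜.d (formAlt e)) ![η]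

theorem AnchoredBracket.dContract_apply (e : Module.Dual R N) (η ζ : N) :
    𝒜.dContract e η ζ = 𝒜.anchor ζ (e η) - 𝒜.anchor η (e ζ) - e (𝒜.bracket ζ η) := by
  rw [AnchoredBracket.dContract, slot_apply, AnchoredBracket.d_formAlt]
  rfl

namespace DualAnchoredBracket

/-- The bracket of linear forms. -/
def bracketForm (e e' : Module.Dual R N) : Module.Dual R N where
  toFun ζ := 𝓓.anchor e (e' ζ) - 𝓓.anchor e' (e ζ) - 𝓓.diff ζ e e'
  map_add' x y := by simp only [map_add, LinearMap.add_apply]; ring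
  map_smul' g x := by
    simp only [map_smul, 𝓓.leibniz, smul_eq_mul, Derivation.leibniz, RingHom.id_apply]
    ring

@[simp] theorem bracketForm_apply (e e' : Module.Dual R N) (ζ : N) :
    𝓓.bracketForm e e' ζ = 𝓓.anchor e (e' ζ) - 𝓓.anchor e' (e ζ) - 𝓓.diff ζ e e' := rfl

theorem slot_formAlt (e : Module.Dual R N) (v : Fin 0 → N) : slot (formAlt e) v = e := by
  ext ζ
  simp

theorem schouten_formAlt_constAlt (h : 0 + 1 = 1 + 0) (e : Module.Dual R N) (g : R) :
    𝓓.schouten h (formAlt e) (constAlt N g) = constAlt N (𝓓.anchor e g) := by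
  ext v
  change 𝓓.anchor ((-1 : ℝ) ^ 0 • slot (formAlt e) _) g = 𝓓.anchor e g
  rw [slot_formAlt, pow_zero, one_smul]

theorem schouten_constAlt_formAlt (h : 0 + 1 = 0 + 1) (f : R) (e : Module.Dual R N) :
    𝓓.schouten h (constAlt N f) (formAlt e) = constAlt N (-𝓓.anchor e f) := by
  ext v
  change -𝓓.anchor (slot (formAlt e) _) f = _
  rw [slot_formAlt]
  rfl

theorem schouten_two_constAlt (h : 1 + 1 = 2 + 0) (P : N [⋀^Fin 2]→ₗ[R] R) (g : R)
    (v : Fin 1 → N) :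
    𝓓.schouten h P (constAlt N g) v = -𝓓.anchor (slot P v) g := by
  change 𝓓.anchor ((-1 : ℝ) ^ 1 • slot P v) g = _
  simp

theorem schouten_formAlt_formAlt (h : 1 + 1 = 1 + 1) (e e' : Module.Dual R N) :
    𝓓.schouten h (formAlt e) (formAlt e') = formAlt (𝓓.bracketForm e e') := by
  ext v
  change antisymm _ v = _
  rw [antisymm, Fintype.sum_unique]
  simp only [pre, core, slot_formAlt]
  simp

/-- The weight 1/2 of the derivative along e is made up for by the two permutations, which give
equal terms; the other summands appear once for each order. -/
theorem schouten_formAlt_two (h : 2 + 1 = 1 + 2) (e : Module.Dual R N) (Q : N [⋀^Fin 2]→ₗ[R] R)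
    (v : Fin 2 → N) :
    𝓓.schouten h (formAlt e) Q v =
      𝓓.anchor e (Q v) - 𝓓.anchor (slot Q ![v 1]) (e (v 0)) + 𝓓.anchor (slot Q ![v 0]) (e (v 1)) -
        𝓓.diff (v 0) e (slot Q ![v 1]) + 𝓓.diff (v 1) e (slot Q ![v 0]) := by
  have hp : ∀ w : Fin 2 → N, 𝓓.pre (formAlt e) Q w = (1 / 2 : ℝ) • 𝓓.anchor e (Q w) -
      𝓓.anchor (slot Q ![w 1]) (e (w 0)) - 𝓓.diff (w 0) e (slot Q ![w 1]) := by
    intro w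
    have e1 : (fun j : Fin 1 => w (Fin.natAdd 1 j)) = ![w 1] := by
      ext j; fin_cases j; rfl
    have e2 : (Fin.cons (w 0) ![w 1] : Fin 2 → N) = w := by
      ext j; fin_cases j <;> rfl
    simp only [pre, core, slot_formAlt]
    erw [e1]
    have e3 : w (Fin.castAdd 1 (Fin.last 0)) = w 0 := rfl
    rw [slot_apply, e3, e2]
    simp
  have e4 : v ∘ Equiv.swap (0 : Fin 2) 1 = ![v 1, v 0] := by
    ext j; fin_cases j <;> simp
  have e5 : Q ![v 1, v 0] = -Q v := by
    rw [← e4]; exact Q.map_swap v (by decide)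
  change antisymm (fun w : Fin 2 → N => 𝓓.pre (formAlt e) Q w) v = _
  have : (Finset.univ : Finset (Equiv.Perm (Fin 2))) = {1, Equiv.swap 0 1} := by decide
  rw [antisymm, this, Finset.sum_pair (by decide), Equiv.Perm.sign_swap (by decide)]
  simp only [Equiv.Perm.coe_one, Function.comp_id, e4, hp, e5]
  simp only [map_one, Units.val_one, Int.cast_one, one_smul, Units.val_neg, Int.cast_neg, neg_smul,
    map_neg, smul_neg, Matrix.cons_val_zero, Matrix.cons_val_one]
  have h2 : ∀ x : R, (1 / 2 : ℝ) • x + (1 / 2 : ℝ) • x = x := by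
    intro x; rw [← add_smul]; norm_num
  linear_combination h2 (𝓓.anchor e (Q v))

variable {𝒜 𝓓}

theorem gevDefect_eq_gev {m p q n : ℕ} (h : n + 1 = p + q) (h₁ : n + 1 + 1 = p + 1 + q)
    (h₂ : n + 1 + 1 = p + (q + 1)) (ξ : Fin m → N) (P : N [⋀^Fin p]→ₗ[R] R)
    (Q : N [⋀^Fin q]→ₗ[R] R) :
    𝓓.gevDefect 𝒜 ξ P Q = gev ξ ⇑(𝒜.d (𝓓.schouten h P Q)) - gev ξ ⇑(𝓓.schouten h₁ (𝒜.d P) Q) -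
      (-1 : ℝ) ^ (p + 1) • gev ξ ⇑(𝓓.schouten h₂ P (𝒜.d Q)) := by
  rw [gevDefect, 𝓓.gevDS_eq h, gev_schouten, gev_schouten]

theorem gev_eq_zero_of_forall {m p : ℕ} (ξ : Fin m → N) {X : Type*} [AddCommGroup X] [Module ℝ X]
    {F : (Fin p → N) → X} (h : ∀ v, F v = 0) : gev ξ F = 0 := by
  rw [show F = fun _ => 0 from funext h, gev_zero]

theorem gev_coe_sub_smul {m p : ℕ} (ξ : Fin m → N) (P Q S : N [⋀^Fin p]→ₗ[R] R) (c : ℝ) :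
    gev ξ ⇑P - gev ξ ⇑Q - c • gev ξ ⇑S = gev ξ fun v => P v - Q v - c • S v := by
  have : (fun v => P v - Q v - c • S v) = fun v => P v + ((-1 : ℝ) • Q v + (-c) • S v) := by
    ext v; simp only [neg_smul, one_smul]; ring
  rw [this, gev_add ξ (fun v => P v) (fun v => (-1 : ℝ) • Q v + (-c) • S v),
    gev_add ξ (fun v => (-1 : ℝ) • Q v), gev_smul, gev_smul]
  module

/-- Since [f, g] = 0, the rule asks that [df, g] and [f, dg] agree, that is, that the bracket a(df)
g of functions be skew. -/
theorem gevDefect_constAlt_constAlt (f g : R)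
    (h : 𝓓.anchor (𝒜.dScalar f) g + 𝓓.anchor (𝒜.dScalar g) f = 0) {m : ℕ} (ξ : Fin m → N) :
    𝓓.gevDefect 𝒜 ξ (constAlt N f) (constAlt N g) = 0 := by
  rw [gevDefect, gevDS_zero, 𝒜.d_constAlt, 𝒜.d_constAlt]
  change 0 - 𝓓.gevS (p := 1) ξ (formAlt (𝒜.dScalar f)) (constAlt N g) -
    _ • 𝓓.gevS (q := 1) ξ (constAlt N f) (formAlt (𝒜.dScalar g)) = 0
  rw [← 𝓓.gev_schouten (p := 1) (q := 0) (n := 0) ξ rfl (formAlt _),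
    ← 𝓓.gev_schouten (p := 0) (q := 1) (n := 0) ξ rfl (constAlt N f), schouten_formAlt_constAlt,
    schouten_constAlt_formAlt,
    gev_constAlt, gev_constAlt, eq_neg_of_add_eq_zero_left h]
  simp

/-- The condition is d(a(e)g) = [de, g] + [e, dg], evaluated at ζ. -/
theorem gevDefect_formAlt_constAlt (e : Module.Dual R N) (g : R)
    (h : ∀ ζ, 𝒜.anchor ζ (𝓓.anchor e g) + 𝓓.anchor (𝒜.dContract e ζ) g =
      𝓓.bracketForm e (𝒜.dScalar g) ζ) {m : ℕ} (ξ : Fin m → N) :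
    𝓓.gevDefect 𝒜 ξ (formAlt e) (constAlt N g) = 0 := by
  rw [𝓓.gevDefect_eq_gev (p := 1) (q := 0) (n := 0) rfl rfl rfl ξ (formAlt e) (constAlt N g),
    gev_coe_sub_smul]
  refine gev_eq_zero_of_forall ξ fun v => ?_
  rw [schouten_formAlt_constAlt, 𝒜.d_constAlt, 𝒜.d_constAlt, schouten_formAlt_formAlt,
    schouten_two_constAlt]
  have hs : slot (𝒜.d (formAlt e)) v = 𝒜.dContract e (v 0) := by
    rw [AnchoredBracket.dContract]
    congr 1
    ext j; fin_cases j; rfl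
  rw [hs]
  have := h (v 0)
  simp only [AlternatingMap.ofSubsingleton_apply_apply, AnchoredBracket.dScalar_apply] at this ⊢
  simp only [Nat.reduceAdd, even_two, Even.neg_pow, one_pow, one_smul]
  linear_combination this

/-- The condition is the familiar compatibility of a Lie bialgebroid on two sections, evaluated at ζ
and η. -/
theorem gevDefect_formAlt_formAlt (e e' : Module.Dual R N)
    (h : ∀ ζ η, 𝒜.anchor ζ (𝓓.bracketForm e e' η) - 𝒜.anchor η (𝓓.bracketForm e e' ζ) -
        𝓓.bracketForm e e' (𝒜.bracket ζ η) =
      (𝓓.anchor e (𝒜.dContract e' η ζ) - 𝓓.anchor (𝒜.dContract e' η) (e ζ) +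
        𝓓.anchor (𝒜.dContract e' ζ) (e η) - 𝓓.diff ζ e (𝒜.dContract e' η) +
        𝓓.diff η e (𝒜.dContract e' ζ)) -
      (𝓓.anchor e' (𝒜.dContract e η ζ) - 𝓓.anchor (𝒜.dContract e η) (e' ζ) +
        𝓓.anchor (𝒜.dContract e ζ) (e' η) - 𝓓.diff ζ e' (𝒜.dContract e η) +
        𝓓.diff η e' (𝒜.dContract e ζ))) {m : ℕ} (ξ : Fin m → N) :
    𝓓.gevDefect 𝒜 ξ (formAlt e) (formAlt e') = 0 := by
  rw [𝓓.gevDefect_eq_gev (p := 1) (q := 1) (n := 1) rfl rfl rfl ξ (formAlt e) (formAlt e'),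
    gev_coe_sub_smul]
  refine gev_eq_zero_of_forall ξ fun v => ?_
  have hd : ∀ e : Module.Dual R N, 𝒜.d (formAlt e) v = 𝒜.dContract e (v 1) (v 0) := by
    intro e
    rw [AnchoredBracket.dContract, slot_apply]
    congr 1
    ext j; fin_cases j <;> rfl
  rw [schouten_formAlt_formAlt, 𝓓.schouten_skew (p := 1) (q := 2) (n := 2) rfl rfl (formAlt e')
    (𝒜.d (formAlt e)), AnchoredBracket.d_formAlt, schouten_formAlt_two]
  beta_reduce
  rw [schouten_formAlt_two, hd, hd]
  have := h (v 0) (v 1)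
  have hc : ∀ (e : Module.Dual R N) η, slot (𝒜.d (formAlt e)) ![η] = 𝒜.dContract e η :=
    fun _ _ => rfl
  -- The sign with which [de, e'] was turned into [e', de].
  have s1 : -(-1 : ℝ) ^ ((1 + 1) * (2 + 1)) = -1 := by norm_num
  have s2 : (-1 : ℝ) ^ (1 + 1) = 1 := by norm_num
  rw [hc, hc, hc, hc, s1, s2, neg_one_smul, one_smul]
  linear_combination this

end DualAnchoredBracket

end

end LowDegree

/-! ### Courant algebroids and Manin triples -/

section Courant

/-- A Courant algebroid, given by its module of sections. -/
structure CourantAlgebroid (R E : Type*) [CommRing R] [Algebra ℝ R] [AddCommGroup E] [Module R E]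
    [Module ℝ E] where
  /-- The pairing. -/
  pairing : E →ₗ[R] E →ₗ[R] R
  /-- The anchor. -/
  anchor : E →ₗ[R] Derivation ℝ R R
  /-- The Dorfman bracket. -/
  bracket : E →ₗ[ℝ] E →ₗ[ℝ] E
  /-- The exact sections. -/
  exact : R →ₗ[ℝ] E
  symm : ∀ x y, pairing x y = pairing y x
  jacobi : ∀ x y z, bracket x (bracket y z) = bracket (bracket x y) z + bracket y (bracket x z)
  invariant : ∀ x y z, anchor x (pairing y z) = pairing (bracket x y) z + pairing y (bracket x z)
  bracket_add_swap : ∀ x y, bracket x y + bracket y x = exact (pairing x y)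
  pairing_exact : ∀ f x, pairing (exact f) x = anchor x f
  anchor_exact : ∀ f, anchor (exact f) = 0
  anchor_bracket : ∀ x y f, anchor (bracket x y) f = anchor x (anchor y f) - anchor y (anchor x f)
  exact_bracket : ∀ f x, bracket (exact f) x = 0
  leibniz : ∀ x (f : R) y, bracket x (f • y) = f • bracket x y + anchor x f • y

variable {R E A A' : Type*} [CommRing R] [Algebra ℝ R] [AddCommGroup E] [Module R E] [Module ℝ E]
  [AddCommGroup A] [Module R A] [Module ℝ A] [AddCommGroup A'] [Module R A'] [Module ℝ A']

/-- An isotropic submodule of a Courant algebroid that is closed under the bracket, given as the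
image of a module `A`. -/
structure DiracStructure (𝒞 : CourantAlgebroid R E) (A : Type*) [AddCommGroup A] [Module R A]
    [Module ℝ A] where
  /-- The inclusion. -/
  incl : A →ₗ[R] E
  /-- The bracket. -/
  bracket : A →ₗ[ℝ] A →ₗ[ℝ] A
  injective : Function.Injective incl
  isotropic : ∀ x y, 𝒞.pairing (incl x) (incl y) = 0
  incl_bracket : ∀ x y, incl (bracket x y) = 𝒞.bracket (incl x) (incl y)

variable {𝒞 : CourantAlgebroid R E}

namespace DiracStructure

/-- The anchor and the bracket of a Dirac structure. -/
def toAnchoredBracket (𝒰 : DiracStructure 𝒞 A) : AnchoredBracket R A where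
  anchor := 𝒞.anchor ∘ₗ 𝒰.incl
  bracket := 𝒰.bracket
  skew x y := by
    apply 𝒰.injective
    rw [map_neg, 𝒰.incl_bracket, 𝒰.incl_bracket, eq_neg_iff_add_eq_zero, 𝒞.bracket_add_swap,
      𝒰.isotropic, map_zero]
  leibniz x f y := by
    apply 𝒰.injective
    simp [𝒰.incl_bracket, 𝒞.leibniz]

@[simp] theorem toAnchoredBracket_anchor (𝒰 : DiracStructure 𝒞 A) (x : A) :
    𝒰.toAnchoredBracket.anchor x = 𝒞.anchor (𝒰.incl x) := rfl

@[simp] theorem toAnchoredBracket_bracket (𝒰 : DiracStructure 𝒞 A) (x y : A) :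
    𝒰.toAnchoredBracket.bracket x y = 𝒰.bracket x y := rfl

end DiracStructure

variable [IsScalarTower ℝ R A] [IsScalarTower ℝ R A']

/-- The dual description of an anchored bracket, for a perfect pairing. -/
def AnchoredBracket.dual (𝒜 : AnchoredBracket R A) (B : A →ₗ[R] A' →ₗ[R] R)
    (s : Module.Dual R A' →ₗ[R] A) (hs : ∀ φ, B (s φ) = φ) :
    DualAnchoredBracket R A' where
  anchor := 𝒜.anchor ∘ₗ s
  diff :=
    { toFun := fun ζ => LinearMap.mk₂ R (fun φ ψ => 𝒜.anchor (s φ) (ψ ζ) - 𝒜.anchor (s ψ) (φ ζ) -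
        B (𝒜.bracket (s φ) (s ψ)) ζ)
        (fun φ φ' ψ => by simp; ring)
        (fun g φ ψ => by
          simp only [map_smul, Derivation.smul_apply, LinearMap.smul_apply, smul_eq_mul,
            Derivation.leibniz, 𝒜.leibniz_left, map_sub, LinearMap.sub_apply, hs]
          ring)
        (fun φ ψ ψ' => by simp; ring)
        (fun g φ ψ => by
          simp only [map_smul, Derivation.smul_apply, LinearMap.smul_apply, smul_eq_mul,
            Derivation.leibniz, 𝒜.leibniz, map_add, LinearMap.add_apply, hs]
          ring)
      map_add' := fun ζ ζ' => by ext; simp; ring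
      map_smul' := fun c ζ => by ext; simp [LinearMap.map_smul_of_tower, smul_sub] }
  skew ζ φ ψ := by simp [𝒜.skew (s φ)]; ring
  leibniz g ζ φ ψ := by simp; ring

theorem AnchoredBracket.dual_anchor (𝒜 : AnchoredBracket R A) (B : A →ₗ[R] A' →ₗ[R] R)
    (s) (hs) (φ) :
    (𝒜.dual B s hs).anchor φ = 𝒜.anchor (s φ) := rfl

theorem AnchoredBracket.dual_diff (𝒜 : AnchoredBracket R A) (B : A →ₗ[R] A' →ₗ[R] R) (s) (hs)
    (ζ φ ψ) : (𝒜.dual B s hs).diff ζ φ ψ =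
      𝒜.anchor (s φ) (ψ ζ) - 𝒜.anchor (s ψ) (φ ζ) - B (𝒜.bracket (s φ) (s ψ)) ζ := rfl

/-- The splitting of a Courant algebroid into two transversal Dirac structures. -/
structure ManinTriple (𝒰 : DiracStructure 𝒞 A) (𝒱 : DiracStructure 𝒞 A') where
  /-- The projection to `A`. -/
  fst : E → A
  /-- The projection to `A'`. -/
  snd : E → A'
  incl_fst_add : ∀ e, 𝒰.incl (fst e) + 𝒱.incl (snd e) = e
  eq_zero : ∀ x ζ, 𝒰.incl x + 𝒱.incl ζ = 0 → x = 0

/-! ### Manin triples satisfy the low-degree identities and induce a Poisson bracket. -/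

namespace ManinTriple

variable {𝒰 : DiracStructure 𝒞 A} {𝒱 : DiracStructure 𝒞 A'} (𝒯 : ManinTriple 𝒰 𝒱)

theorem eq_of_incl_add_eq (𝒯 : ManinTriple 𝒰 𝒱) {x x' : A} {ζ ζ' : A'}
    (h : 𝒰.incl x + 𝒱.incl ζ = 𝒰.incl x' + 𝒱.incl ζ') : x = x' := by
  refine sub_eq_zero.mp (𝒯.eq_zero (x - x') (ζ - ζ') ?_)
  rw [map_sub, map_sub, sub_add_sub_comm, h, sub_self]

/-- The pairing of two Dirac structures. -/
def pair (𝒰 : DiracStructure 𝒞 A) (𝒱 : DiracStructure 𝒞 A') : A →ₗ[R] A' →ₗ[R] R :=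
  𝒞.pairing.compl₁₂ 𝒰.incl 𝒱.incl

theorem pair_apply (x : A) (ζ : A') : pair 𝒰 𝒱 x ζ = 𝒞.pairing (𝒰.incl x) (𝒱.incl ζ) := rfl

theorem pairing_incl_fst (e : E) (ζ : A') :
    𝒞.pairing (𝒰.incl (𝒯.fst e)) (𝒱.incl ζ) = 𝒞.pairing e (𝒱.incl ζ) := by
  conv_rhs => rw [← 𝒯.incl_fst_add e, map_add, LinearMap.add_apply, 𝒱.isotropic, add_zero]

theorem pairing_incl_snd (e : E) (x : A) :
    𝒞.pairing (𝒱.incl (𝒯.snd e)) (𝒰.incl x) = 𝒞.pairing e (𝒰.incl x) := by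
  conv_rhs => rw [← 𝒯.incl_fst_add e, map_add, LinearMap.add_apply, 𝒰.isotropic, zero_add]

/-- Both summands are isotropic, so only the two mixed pairings of the components survive. -/
theorem pairing_split (e e' : E) : 𝒞.pairing (𝒰.incl (𝒯.fst e)) e' +
    𝒞.pairing e (𝒰.incl (𝒯.fst e')) = 𝒞.pairing e e' := by
  conv_rhs => rw [← 𝒯.incl_fst_add e, ← 𝒯.incl_fst_add e']
  conv_lhs => rw [← 𝒯.pairing_incl_snd e]
  conv_lhs => enter [1, 2]; rw [← 𝒯.incl_fst_add e']
  simp only [map_add, LinearMap.add_apply, 𝒰.isotropic, 𝒱.isotropic]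
  ring

theorem anchor_fst_add_snd (e : E) (f : R) :
    𝒞.anchor (𝒰.incl (𝒯.fst e)) f + 𝒞.anchor (𝒱.incl (𝒯.snd e)) f = 𝒞.anchor e f := by
  conv_rhs => rw [← 𝒯.incl_fst_add e, map_add, Derivation.add_apply]

theorem dScalar_eq (f : R) :
    𝒱.toAnchoredBracket.dScalar f = pair 𝒰 𝒱 (𝒯.fst (𝒞.exact f)) := by
  ext ζ
  rw [pair_apply, pairing_incl_fst, 𝒞.pairing_exact]
  rfl

theorem invariant_left (x : A) (ζ η : A') :
    𝒞.pairing (𝒞.bracket (𝒰.incl x) (𝒱.incl ζ)) (𝒱.incl η) =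
      -𝒞.pairing (𝒞.bracket (𝒰.incl x) (𝒱.incl η)) (𝒱.incl ζ) := by
  have := 𝒞.invariant (𝒰.incl x) (𝒱.incl ζ) (𝒱.incl η)
  rw [𝒱.isotropic, map_zero, 𝒞.symm (𝒱.incl ζ)] at this
  exact eq_neg_of_add_eq_zero_left this.symm

/-- Invariance moves the derivative along ζ into brackets, and [ζ, x] + [x, ζ] is the exact section
of ⟨x, ζ⟩, whose pairing with η is the derivative along η. -/
theorem differential_eq (x : A) (ζ η : A') :
    𝒞.anchor (𝒱.incl ζ) (pair 𝒰 𝒱 x η) - 𝒞.anchor (𝒱.incl η) (pair 𝒰 𝒱 x ζ) -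
      pair 𝒰 𝒱 x (𝒱.bracket ζ η) = -𝒞.pairing (𝒞.bracket (𝒰.incl x) (𝒱.incl ζ)) (𝒱.incl η) := by
  have h1 := 𝒞.invariant (𝒱.incl ζ) (𝒰.incl x) (𝒱.incl η)
  have h2 := 𝒞.pairing_exact (pair 𝒰 𝒱 x ζ) (𝒱.incl η)
  rw [pair_apply, ← 𝒞.bracket_add_swap, map_add, LinearMap.add_apply] at h2
  rw [pair_apply, pair_apply, pair_apply, 𝒱.incl_bracket, h1, ← h2]
  ring

/-- The contraction of d x with η is the 𝒰-component of the Dorfman bracket of x and η. The mixed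
bracket of the Courant algebroid thus encodes the differential. -/
theorem dContract_eq (x : A) (η : A') :
    𝒱.toAnchoredBracket.dContract (pair 𝒰 𝒱 x) η =
      pair 𝒰 𝒱 (𝒯.fst (𝒞.bracket (𝒰.incl x) (𝒱.incl η))) := by
  ext ζ
  have := differential_eq (𝒰 := 𝒰) (𝒱 := 𝒱) x ζ η
  rw [invariant_left, neg_neg] at this
  rw [AnchoredBracket.dContract_apply, pair_apply (𝒯.fst _), pairing_incl_fst, ← this]
  rfl

/-- The bracket of functions of a Manin triple. -/
def poisson (f g : R) : R := 𝒞.anchor (𝒰.incl (𝒯.fst (𝒞.exact f))) g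

/-- By `pairing_split` the sum is the pairing of two exact sections, which vanishes because exact
sections have zero anchor. -/
theorem poisson_skew (f g : R) : 𝒯.poisson f g + 𝒯.poisson g f = 0 := by
  rw [poisson, poisson, ← 𝒞.pairing_exact g, ← 𝒞.pairing_exact f, 𝒞.symm, 𝒯.pairing_split,
    𝒞.pairing_exact, 𝒞.anchor_exact]
  rfl

/-- Write the exact section of f as u + v. Exact sections bracket trivially from the left, so [u, ·]
= −[v, ·], and bracketing u with the two components of the exact section of g gives one term in each
Dirac structure. The sum is the exact section of {f, g}. -/
theorem fst_exact_poisson (f g : R) : 𝒯.fst (𝒞.exact (𝒯.poisson f g)) =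
    𝒰.bracket (𝒯.fst (𝒞.exact f)) (𝒯.fst (𝒞.exact g)) := by
  set u := 𝒯.fst (𝒞.exact f) with hu
  set v := 𝒯.snd (𝒞.exact f) with hv
  have h1 : 𝒞.exact (𝒯.poisson f g) = 𝒞.bracket (𝒰.incl u) (𝒞.exact g) := by
    rw [poisson, ← 𝒞.pairing_exact g, ← 𝒞.bracket_add_swap, 𝒞.exact_bracket, zero_add]
  have h2 : 𝒰.incl u = 𝒞.exact f - 𝒱.incl v := by
    rw [eq_sub_iff_add_eq, 𝒯.incl_fst_add]
  refine 𝒯.eq_of_incl_add_eq (ζ := 𝒯.snd (𝒞.exact (𝒯.poisson f g)))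
    (ζ' := -𝒱.bracket v (𝒯.snd (𝒞.exact g))) ?_
  rw [𝒯.incl_fst_add, h1, map_neg, 𝒰.incl_bracket, 𝒱.incl_bracket]
  conv_lhs => rw [← 𝒯.incl_fst_add (𝒞.exact g), map_add]
  congr 1
  rw [h2, map_sub, LinearMap.sub_apply, 𝒞.exact_bracket, zero_sub]

/-- By `fst_exact_poisson` the Hamiltonian section of {f, g} is the bracket of those of f and g, and
the anchor is compatible with brackets. -/
theorem poisson_jacobi (f g h : R) : 𝒯.poisson f (𝒯.poisson g h) + 𝒯.poisson g (𝒯.poisson h f) +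
    𝒯.poisson h (𝒯.poisson f g) = 0 := by
  have h1 : 𝒯.poisson (𝒯.poisson f g) h =
      𝒯.poisson f (𝒯.poisson g h) - 𝒯.poisson g (𝒯.poisson f h) := by
    rw [poisson, fst_exact_poisson, 𝒰.incl_bracket, 𝒞.anchor_bracket]
    rfl
  have h2 : 𝒯.poisson g (𝒯.poisson h f) = -𝒯.poisson g (𝒯.poisson f h) := by
    rw [eq_neg_of_add_eq_zero_left (𝒯.poisson_skew h f)]
    exact map_neg (𝒞.anchor _) _
  linear_combination 𝒯.poisson_skew (𝒯.poisson f g) h - h1 + h2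

section

variable (s : Module.Dual R A' →ₗ[R] A) (hs : ∀ φ, pair 𝒰 𝒱 (s φ) = φ)
  (hs' : ∀ x, s (pair 𝒰 𝒱 x) = x)

include hs' in
theorem dual_diff_pair (ζ : A') (x y : A) :
    (𝒰.toAnchoredBracket.dual (pair 𝒰 𝒱) s hs).diff ζ (pair 𝒰 𝒱 x) (pair 𝒰 𝒱 y) =
      𝒞.anchor (𝒰.incl x) (pair 𝒰 𝒱 y ζ) - 𝒞.anchor (𝒰.incl y) (pair 𝒰 𝒱 x ζ) -
        pair 𝒰 𝒱 (𝒰.bracket x y) ζ := by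
  rw [AnchoredBracket.dual_diff, hs', hs']
  rfl

include hs' in
theorem dual_anchor_pair (x : A) (f : R) :
    (𝒰.toAnchoredBracket.dual (pair 𝒰 𝒱) s hs).anchor (pair 𝒰 𝒱 x) f = 𝒞.anchor (𝒰.incl x) f := by
  rw [AnchoredBracket.dual_anchor, hs']
  rfl

include hs' in
theorem dual_bracketForm_pair (x y : A) :
    (𝒰.toAnchoredBracket.dual (pair 𝒰 𝒱) s hs).bracketForm (pair 𝒰 𝒱 x) (pair 𝒰 𝒱 y) =
      pair 𝒰 𝒱 (𝒰.bracket x y) := by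
  ext ζ
  rw [DualAnchoredBracket.bracketForm_apply, dual_diff_pair (hs' := hs'),
    dual_anchor_pair (hs' := hs'), dual_anchor_pair (hs' := hs')]
  ring

variable {m : ℕ}

include 𝒯 hs' in
-- The three low-degree conditions are Courant identities. Linear forms are written as pairings with
-- sections x, y of A, so that brackets, differentials and contractions all become Dorfman brackets.
theorem gevDefect_eq_zero (I : Set R) (hI : ∀ r : R, (∀ f ∈ I, f * r = 0) → r = 0)
    (hframe : ∀ f ∈ I, ∃ (k : ℕ) (e : Fin k → Module.Dual R A') (ε : Fin k → A'),
      ∀ ζ, f • ζ = ∑ i, e i ζ • ε i)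
    {p q : ℕ} (P : A' [⋀^Fin p]→ₗ[R] R) (Q : A' [⋀^Fin q]→ₗ[R] R) (ξ : Fin m → A') :
    (𝒰.toAnchoredBracket.dual (pair 𝒰 𝒱) s hs).gevDefect 𝒱.toAnchoredBracket ξ P Q = 0 := by
  refine DualAnchoredBracket.gevDefect_eq_zero _ I hI hframe (fun f g m ξ => ?_)
    (fun e g m ξ => ?_) (fun e e' m ξ => ?_) P Q ξ
  · refine DualAnchoredBracket.gevDefect_constAlt_constAlt f g ?_ ξ
    rw [𝒯.dScalar_eq, 𝒯.dScalar_eq, dual_anchor_pair (hs' := hs'), dual_anchor_pair (hs' := hs')]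
    exact 𝒯.poisson_skew f g
  · refine DualAnchoredBracket.gevDefect_formAlt_constAlt e g (fun ζ => ?_) ξ
    obtain ⟨x, rfl⟩ : ∃ x, e = pair 𝒰 𝒱 x := ⟨s e, (hs e).symm⟩
    rw [𝒯.dScalar_eq, dual_bracketForm_pair (hs' := hs'), 𝒯.dContract_eq,
      dual_anchor_pair (hs' := hs'), dual_anchor_pair (hs' := hs'), pair_apply, 𝒰.incl_bracket,
      DiracStructure.toAnchoredBracket_anchor]
    -- In degrees (1,0) the identity combines invariance, the anchor of [x, ζ], and the splitting of
    -- that section into its two components.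
    have h1 := 𝒞.invariant (𝒰.incl x) (𝒰.incl (𝒯.fst (𝒞.exact g))) (𝒱.incl ζ)
    rw [𝒯.pairing_incl_fst, 𝒞.pairing_exact] at h1
    have h2 := 𝒯.anchor_fst_add_snd (𝒞.bracket (𝒰.incl x) (𝒱.incl ζ)) g
    have h3 := 𝒞.anchor_bracket (𝒰.incl x) (𝒱.incl ζ) g
    have h4 := 𝒯.pairing_incl_snd (𝒞.bracket (𝒰.incl x) (𝒱.incl ζ)) (𝒯.fst (𝒞.exact g))
    rw [𝒞.symm, 𝒯.pairing_incl_fst, 𝒞.pairing_exact, 𝒞.symm] at h4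
    linear_combination h1 + h2 + h3 - h4
  · refine DualAnchoredBracket.gevDefect_formAlt_formAlt e e' (fun ζ η => ?_) ξ
    obtain ⟨x, rfl⟩ : ∃ x, e = pair 𝒰 𝒱 x := ⟨s e, (hs e).symm⟩
    obtain ⟨y, rfl⟩ : ∃ y, e' = pair 𝒰 𝒱 y := ⟨s e', (hs e').symm⟩
    rw [dual_bracketForm_pair (hs' := hs')]
    simp only [𝒯.dContract_eq, dual_anchor_pair s hs hs', dual_diff_pair s hs hs',
      DiracStructure.toAnchoredBracket_anchor, DiracStructure.toAnchoredBracket_bracket]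
    rw [differential_eq]
    simp only [pair_apply, 𝒰.incl_bracket, 𝒯.pairing_incl_fst]
    have hL : ∀ x y : A, ∀ ζ η : A',
        𝒞.pairing (𝒞.bracket (𝒰.incl x)
          (𝒰.incl (𝒯.fst (𝒞.bracket (𝒰.incl y) (𝒱.incl η))))) (𝒱.incl ζ) =
        𝒞.anchor (𝒰.incl x) (𝒞.pairing (𝒞.bracket (𝒰.incl y) (𝒱.incl η)) (𝒱.incl ζ)) -
        𝒞.pairing (𝒰.incl (𝒯.fst (𝒞.bracket (𝒰.incl y) (𝒱.incl η))))
          (𝒞.bracket (𝒰.incl x) (𝒱.incl ζ)) := by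
      intro x y ζ η
      have := 𝒞.invariant (𝒰.incl x) (𝒰.incl (𝒯.fst (𝒞.bracket (𝒰.incl y) (𝒱.incl η))))
        (𝒱.incl ζ)
      rw [𝒯.pairing_incl_fst] at this
      linear_combination -this
    simp only [hL]
    -- In degrees (1,1) the essential input is the Jacobi identity for x, y, ζ, paired with η.
    -- Invariance and `pairing_split` convert the remaining terms.
    have hJ : 𝒞.pairing (𝒞.bracket (𝒰.incl x) (𝒞.bracket (𝒰.incl y) (𝒱.incl ζ))) (𝒱.incl η) =
        𝒞.pairing (𝒞.bracket (𝒞.bracket (𝒰.incl x) (𝒰.incl y)) (𝒱.incl ζ)) (𝒱.incl η) +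
        𝒞.pairing (𝒞.bracket (𝒰.incl y) (𝒞.bracket (𝒰.incl x) (𝒱.incl ζ))) (𝒱.incl η) := by
      rw [𝒞.jacobi, map_add, LinearMap.add_apply]
    have i1 := 𝒞.invariant (𝒰.incl x) (𝒞.bracket (𝒰.incl y) (𝒱.incl ζ)) (𝒱.incl η)
    have i2 := 𝒞.invariant (𝒰.incl y) (𝒞.bracket (𝒰.incl x) (𝒱.incl ζ)) (𝒱.incl η)
    have sp1 := 𝒯.pairing_split (𝒞.bracket (𝒰.incl y) (𝒱.incl ζ)) (𝒞.bracket (𝒰.incl x) (𝒱.incl η))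
    have sp2 := 𝒯.pairing_split (𝒞.bracket (𝒰.incl x) (𝒱.incl ζ)) (𝒞.bracket (𝒰.incl y) (𝒱.incl η))
    rw [𝒞.symm (𝒞.bracket (𝒰.incl y) (𝒱.incl ζ)) (𝒰.incl _)] at sp1
    rw [𝒞.symm (𝒞.bracket (𝒰.incl x) (𝒱.incl ζ)) (𝒰.incl _)] at sp2
    have n1 : 𝒞.anchor (𝒰.incl x) (𝒞.pairing (𝒞.bracket (𝒰.incl y) (𝒱.incl η)) (𝒱.incl ζ)) =
      -𝒞.anchor (𝒰.incl x) (𝒞.pairing (𝒞.bracket (𝒰.incl y) (𝒱.incl ζ)) (𝒱.incl η)) := by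
      rw [invariant_left, map_neg]
    have n2 : 𝒞.anchor (𝒰.incl y) (𝒞.pairing (𝒞.bracket (𝒰.incl x) (𝒱.incl η)) (𝒱.incl ζ)) =
      -𝒞.anchor (𝒰.incl y) (𝒞.pairing (𝒞.bracket (𝒰.incl x) (𝒱.incl ζ)) (𝒱.incl η)) := by
      rw [invariant_left, map_neg]
    linear_combination hJ + i1 - i2 - sp1 + sp2 - n1 + n2

end

end ManinTriple

end Courant

/-! ### The standard Courant algebroid -/

section Cartan

/-- Vector fields and 1-forms over an algebra of functions, with the operations of Cartan
calculus. -/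
structure CartanCalculus (R X Ω : Type*) [CommRing R] [Algebra ℝ R] [AddCommGroup X] [Module R X]
    [AddCommGroup Ω] [Module R Ω] where
  /-- The value of 1-forms on vector fields. -/
  ev : Ω →ₗ[R] X →ₗ[R] R
  /-- The derivative of functions along vector fields. -/
  der : X →ₗ[R] Derivation ℝ R R
  /-- The Lie bracket. -/
  lie : X → X → X
  /-- The differential of functions. -/
  d : R → Ω
  ev_injective : Function.Injective ev
  ev_surjective : Function.Surjective ev
  der_injective : Function.Injective der
  der_lie : ∀ x y f, der (lie x y) f = der x (der y f) - der y (der x f)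
  ev_d : ∀ f x, ev (d f) x = der x f

namespace CartanCalculus

variable {R X Ω : Type*} [CommRing R] [Algebra ℝ R] [AddCommGroup X] [Module R X]
  [AddCommGroup Ω] [Module R Ω] [Module ℝ X] [IsScalarTower ℝ R X] [Module ℝ Ω]
  [IsScalarTower ℝ R Ω] (𝒦 : CartanCalculus R X Ω)

theorem ext_form {α β : Ω} (h : ∀ x, 𝒦.ev α x = 𝒦.ev β x) : α = β :=
  𝒦.ev_injective (LinearMap.ext h)

/-- The Lie bracket is known only through its action on functions, so its identities are all checked
there. -/
theorem ext_field {x y : X} (h : ∀ f, 𝒦.der x f = 𝒦.der y f) : x = y :=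
  𝒦.der_injective (Derivation.ext h)

theorem lie_add (x y z : X) : 𝒦.lie x (y + z) = 𝒦.lie x y + 𝒦.lie x z :=
  𝒦.ext_field fun f => by simp only [𝒦.der_lie, map_add, Derivation.add_apply]; ring

theorem lie_smul (x : X) (g : R) (y : X) : 𝒦.lie x (g • y) = g • 𝒦.lie x y + 𝒦.der x g • y :=
  𝒦.ext_field fun f => by
    simp only [𝒦.der_lie, map_add, map_smul, Derivation.add_apply, Derivation.smul_apply,
      smul_eq_mul, Derivation.leibniz]
    ring

theorem lie_skew (x y : X) : 𝒦.lie x y = -𝒦.lie y x :=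
  𝒦.ext_field fun f => by simp only [𝒦.der_lie, map_neg, Derivation.neg_apply]; ring

theorem lie_jacobi (x y z : X) :
    𝒦.lie x (𝒦.lie y z) = 𝒦.lie (𝒦.lie x y) z + 𝒦.lie y (𝒦.lie x z) :=
  𝒦.ext_field fun f => by simp only [𝒦.der_lie, map_add, map_sub, Derivation.add_apply]; ring

theorem add_lie (x y z : X) : 𝒦.lie (x + y) z = 𝒦.lie x z + 𝒦.lie y z := by
  rw [𝒦.lie_skew, lie_add, neg_add, ← lie_skew, ← lie_skew]

theorem der_algebraMap (x : X) (c : ℝ) : 𝒦.der x (algebraMap ℝ R c) = 0 :=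
  Derivation.map_algebraMap _ c

theorem lie_real_smul (x : X) (c : ℝ) (y : X) : 𝒦.lie x (c • y) = c • 𝒦.lie x y := by
  rw [← algebraMap_smul R c y, lie_smul, der_algebraMap, zero_smul, add_zero, algebraMap_smul]

theorem real_smul_lie (c : ℝ) (x y : X) : 𝒦.lie (c • x) y = c • 𝒦.lie x y := by
  rw [𝒦.lie_skew, lie_real_smul, ← smul_neg, ← lie_skew]

/-- The Lie derivative of a 1-form. -/
def lieForm (x : X) (β : Ω) : Ω :=
  (𝒦.ev_surjective
    { toFun := fun y => 𝒦.der x (𝒦.ev β y) - 𝒦.ev β (𝒦.lie x y)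
      map_add' := fun y z => by simp only [lie_add, map_add]; ring
      map_smul' := fun g y => by
        simp only [lie_smul, map_smul, map_add, smul_eq_mul, Derivation.leibniz, RingHom.id_apply]
        ring }).choose

@[simp] theorem ev_lieForm (x : X) (β : Ω) (y : X) :
    𝒦.ev (𝒦.lieForm x β) y = 𝒦.der x (𝒦.ev β y) - 𝒦.ev β (𝒦.lie x y) :=
  LinearMap.congr_fun (𝒦.ev_surjective _).choose_spec y

theorem ev_real_smul (c : ℝ) (α : Ω) (x : X) : 𝒦.ev (c • α) x = c • 𝒦.ev α x := by
  rw [LinearMap.map_smul_of_tower, LinearMap.smul_apply]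

theorem ev_real_smul' (c : ℝ) (α : Ω) (x : X) : 𝒦.ev α (c • x) = c • 𝒦.ev α x :=
  LinearMap.map_smul_of_tower _ _ _

theorem der_real_smul (c : ℝ) (x : X) (f : R) : 𝒦.der (c • x) f = c • 𝒦.der x f := by
  rw [LinearMap.map_smul_of_tower, Derivation.smul_apply]

/-- The differential as a linear map. -/
def dLin : R →ₗ[ℝ] Ω where
  toFun := 𝒦.d
  map_add' f g := 𝒦.ext_form fun x => by
    simp only [𝒦.ev_d, map_add, LinearMap.add_apply]
  map_smul' c f := 𝒦.ext_form fun x => by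
    simp only [𝒦.ev_d, RingHom.id_apply, ev_real_smul, Derivation.map_smul]

@[simp] theorem ev_dLin (f : R) (x : X) : 𝒦.ev (𝒦.dLin f) x = 𝒦.der x f := 𝒦.ev_d f x

/-- The form part of the Dorfman bracket. -/
def dorfmanForm (x y : X × Ω) : Ω :=
  𝒦.lieForm x.1 y.2 - 𝒦.lieForm y.1 x.2 + 𝒦.dLin (𝒦.ev x.2 y.1)

theorem ev_dorfmanForm (x y : X × Ω) (z : X) : 𝒦.ev (𝒦.dorfmanForm x y) z =
    (𝒦.der x.1 (𝒦.ev y.2 z) - 𝒦.ev y.2 (𝒦.lie x.1 z)) -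
      (𝒦.der y.1 (𝒦.ev x.2 z) - 𝒦.ev x.2 (𝒦.lie y.1 z)) + 𝒦.der z (𝒦.ev x.2 y.1) := by
  simp [dorfmanForm]

/-- The standard Courant algebroid, with the pairing multiplied by a constant. -/
def courant (c : ℝ) (hc : c ≠ 0) : CourantAlgebroid R (X × Ω) where
  pairing := LinearMap.mk₂ R (fun x y => c • (𝒦.ev x.2 y.1 + 𝒦.ev y.2 x.1))
    (fun x x' y => by simp; module)
    (fun g x y => by simp [mul_add])
    (fun x y y' => by simp; module)
    (fun g x y => by simp [mul_add])
  anchor := 𝒦.der ∘ₗ LinearMap.fst R X Ω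
  bracket := LinearMap.mk₂ ℝ (fun x y => (𝒦.lie x.1 y.1, 𝒦.dorfmanForm x y))
    (fun x x' y => Prod.ext (𝒦.add_lie _ _ _) (𝒦.ext_form fun z => by
      simp only [ev_dorfmanForm, Prod.fst_add, Prod.snd_add, map_add, LinearMap.add_apply,
        Derivation.add_apply, add_lie]; ring))
    (fun a x y => Prod.ext (𝒦.real_smul_lie _ _ _) (𝒦.ext_form fun z => by
      simp only [ev_dorfmanForm, Prod.smul_fst, Prod.smul_snd, ev_real_smul, real_smul_lie,
        ev_real_smul', der_real_smul, Derivation.map_smul]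
      module))
    (fun x y y' => Prod.ext (𝒦.lie_add _ _ _) (𝒦.ext_form fun z => by
      simp only [ev_dorfmanForm, Prod.fst_add, Prod.snd_add, map_add, LinearMap.add_apply,
        Derivation.add_apply, add_lie]; ring))
    (fun a x y => Prod.ext (𝒦.lie_real_smul _ _ _) (𝒦.ext_form fun z => by
      simp only [ev_dorfmanForm, Prod.smul_fst, Prod.smul_snd, ev_real_smul, real_smul_lie,
        ev_real_smul', der_real_smul, Derivation.map_smul]
      module))
  -- The factor c⁻¹ compensates the factor c of the pairing. The bracket itself is independent of c.
  exact := LinearMap.inr ℝ X Ω ∘ₗ (c⁻¹ • 𝒦.dLin)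
  symm x y := by simp [add_comm]
  jacobi x y z := Prod.ext (𝒦.lie_jacobi _ _ _) (𝒦.ext_form fun w => by
    simp only [LinearMap.mk₂_apply, Prod.snd_add, ev_dorfmanForm, map_add, LinearMap.add_apply,
      map_sub, 𝒦.der_lie]
    rw [𝒦.lie_jacobi x.1 y.1 w, 𝒦.lie_jacobi x.1 z.1 w, 𝒦.lie_jacobi y.1 z.1 w]
    simp only [map_add]
    ring)
  invariant x y z := by
    simp only [LinearMap.mk₂_apply, ev_dorfmanForm, LinearMap.comp_apply, LinearMap.fst_apply,
      Derivation.map_smul, map_add, ← smul_add]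
    rw [𝒦.lie_skew z.1 y.1, map_neg]
    congr 1
    ring
  bracket_add_swap x y := by
    refine Prod.ext ?_ (𝒦.ext_form fun z => ?_)
    · simpa using eq_neg_iff_add_eq_zero.mp (𝒦.lie_skew x.1 y.1)
    · simp only [LinearMap.mk₂_apply, Prod.snd_add, map_add, LinearMap.add_apply, ev_dorfmanForm,
        LinearMap.comp_apply, LinearMap.smul_apply, LinearMap.inr_apply, ev_dLin, ev_real_smul,
        Derivation.map_smul]
      rw [smul_smul, inv_mul_cancel₀ hc, one_smul]
      ring
  pairing_exact f x := by simp [smul_smul, hc]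
  anchor_exact f := by simp
  anchor_bracket x y f := by simp [𝒦.der_lie]
  exact_bracket f x := by
    refine Prod.ext ?_ (𝒦.ext_form fun z => ?_)
    -- Homogeneity with constant 0 gives that the bracket of the zero field vanishes.
    · have h := 𝒦.real_smul_lie 0 0 x.1
      simpa using h
    · have h := 𝒦.real_smul_lie 0 0 z
      simp only [zero_smul] at h
      simp only [LinearMap.mk₂_apply, ev_dorfmanForm, LinearMap.comp_apply, LinearMap.smul_apply,
        LinearMap.inr_apply, ev_dLin, ev_real_smul, Derivation.map_smul, h, map_zero,
        Derivation.zero_apply, 𝒦.der_lie, Prod.snd_zero, LinearMap.zero_apply, smul_sub]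
      ring
  leibniz x f y := by
    refine Prod.ext ?_ (𝒦.ext_form fun z => ?_)
    · simp [lie_smul]
    · have h : 𝒦.lie (f • y.1) z = f • 𝒦.lie y.1 z - 𝒦.der z f • y.1 := by
        rw [𝒦.lie_skew, lie_smul, 𝒦.lie_skew z]; module
      simp only [LinearMap.mk₂_apply, Prod.snd_add, Prod.smul_snd, Prod.smul_fst, map_add,
        LinearMap.add_apply, ev_dorfmanForm, LinearMap.comp_apply, LinearMap.fst_apply, map_smul,
        LinearMap.smul_apply, smul_eq_mul, Derivation.leibniz, h, map_sub, Derivation.smul_apply]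
      ring

theorem courant_bracket (c : ℝ) (hc : c ≠ 0) (x y : X × Ω) :
    (𝒦.courant c hc).bracket x y = (𝒦.lie x.1 y.1, 𝒦.dorfmanForm x y) := rfl

theorem courant_pairing (c : ℝ) (hc : c ≠ 0) (x y : X × Ω) :
    (𝒦.courant c hc).pairing x y = c • (𝒦.ev x.2 y.1 + 𝒦.ev y.2 x.1) := rfl

/-- A linear form that vanishes on exact 1-forms is zero. -/
theorem eq_zero_of_ev_d (hvec : ∀ φ : Module.Dual R Ω, ∃ x, ∀ α, 𝒦.ev α x = φ α)
    (φ : Module.Dual R Ω) (h : ∀ f, φ (𝒦.d f) = 0) : φ = 0 := by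
  obtain ⟨x, hx⟩ := hvec φ
  have : x = 0 := 𝒦.ext_field fun f => by
    rw [← 𝒦.ev_d, hx, h, map_zero, Derivation.zero_apply]
  ext α
  rw [← hx, this, map_zero, LinearMap.zero_apply]

/-! ### Graphs of Poisson tensors as Dirac structures. -/

section Poisson

variable (P : Ω →ₗ[R] X) (hP : ∀ α β, 𝒦.ev β (P α) = -𝒦.ev α (P β))

/-- The graph of a bivector field. -/
abbrev graph : Ω →ₗ[R] X × Ω := LinearMap.prod P LinearMap.id

/-- The bracket of 1-forms of a Poisson tensor. -/
def formBracket (α β : Ω) : Ω := 𝒦.dorfmanForm (P α, α) (P β, β)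

/-- The failure of the graph to be closed under the Dorfman bracket. -/
def torsion (α β γ : Ω) : R := 𝒦.ev γ (𝒦.lie (P α) (P β)) - 𝒦.ev γ (P (𝒦.formBracket P α β))

include hP in
-- Skewness of P moves it to the other side, which exhibits the torsion as the Courant tensor of the
-- graph. The Courant axioms then give the symmetries below.
theorem torsion_eq (α β γ : Ω) : 𝒦.torsion P α β γ =
    (𝒦.courant 1 one_ne_zero).pairing
      ((𝒦.courant 1 one_ne_zero).bracket (graph P α) (graph P β)) (graph P γ) := by
  rw [courant_pairing, courant_bracket, torsion, hP, one_smul]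
  change _ = 𝒦.ev (𝒦.formBracket P α β) (P γ) + 𝒦.ev γ (𝒦.lie (P α) (P β))
  ring

include hP in
theorem graph_isotropic (c : ℝ) (hc : c ≠ 0) (α β : Ω) :
    (𝒦.courant c hc).pairing (graph P α) (graph P β) = 0 := by
  rw [courant_pairing]
  simp [hP α β]

include hP in
theorem torsion_skew (α β γ : Ω) : 𝒦.torsion P α β γ = -𝒦.torsion P β α γ := by
  rw [torsion_eq 𝒦 P hP, torsion_eq 𝒦 P hP, eq_neg_iff_add_eq_zero, ← LinearMap.add_apply,
    ← map_add, CourantAlgebroid.bracket_add_swap, 𝒦.graph_isotropic P hP, map_zero, map_zero,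
    LinearMap.zero_apply]

include hP in
-- The graph is isotropic, so invariance of the pairing differentiates zero.
theorem torsion_skew' (α β γ : Ω) : 𝒦.torsion P α β γ = -𝒦.torsion P α γ β := by
  rw [torsion_eq 𝒦 P hP, torsion_eq 𝒦 P hP, eq_neg_iff_add_eq_zero,
    CourantAlgebroid.symm _ _ (graph P β), ← CourantAlgebroid.invariant,
    𝒦.graph_isotropic P hP, map_zero]

/-- The torsion as a linear form in its last argument. -/
def torsionForm (α β : Ω) : Module.Dual R Ω where
  toFun γ := 𝒦.torsion P α β γ
  map_add' _ _ := by simp only [torsion, map_add, LinearMap.add_apply]; ring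
  map_smul' _ _ := by simp only [torsion, map_smul, LinearMap.smul_apply, smul_sub]; rfl

variable (hJ : ∀ f g h : R, 𝒦.der (P (𝒦.d f)) (𝒦.der (P (𝒦.d g)) h) +
    𝒦.der (P (𝒦.d g)) (𝒦.der (P (𝒦.d h)) f) + 𝒦.der (P (𝒦.d h)) (𝒦.der (P (𝒦.d f)) g) = 0)

include hP hJ in
-- On exact forms the torsion is the Jacobiator of the bracket of functions.
theorem torsion_d (f g h : R) : 𝒦.torsion P (𝒦.d f) (𝒦.d g) (𝒦.d h) = 0 := by
  have hs : ∀ f g, 𝒦.der (P (𝒦.d f)) g = -𝒦.der (P (𝒦.d g)) f := fun f g => by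
    rw [← 𝒦.ev_d, hP, 𝒦.ev_d]
  rw [torsion, hP]
  simp only [formBracket, ev_dorfmanForm, 𝒦.ev_d, 𝒦.der_lie]
  have := hJ f g h
  have e1 : 𝒦.der (P (𝒦.d g)) (𝒦.der (P (𝒦.d h)) f) = -𝒦.der (P (𝒦.d g)) (𝒦.der (P (𝒦.d f)) h) := by
    rw [hs h f, map_neg]
  linear_combination this - e1

include hP hJ in
-- The torsion is function-linear in its last argument and totally skew, hence determined by its
-- values on exact forms in all three arguments.
theorem torsion_eq_zero (hvec : ∀ φ : Module.Dual R Ω, ∃ x, ∀ α, 𝒦.ev α x = φ α) (α β γ : Ω) :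
    𝒦.torsion P α β γ = 0 := by
  have key : ∀ α β, (∀ f, 𝒦.torsion P α β (𝒦.d f) = 0) → ∀ γ, 𝒦.torsion P α β γ = 0 :=
    fun α β h γ => LinearMap.congr_fun (𝒦.eq_zero_of_ev_d hvec (𝒦.torsionForm P α β) h) γ
  have h1 : ∀ f g γ, 𝒦.torsion P (𝒦.d f) (𝒦.d g) γ = 0 := fun f g =>
    key _ _ fun h => 𝒦.torsion_d P hP hJ f g h
  have h2 : ∀ f β γ, 𝒦.torsion P (𝒦.d f) β γ = 0 := fun f β =>
    key _ _ fun h => by rw [𝒦.torsion_skew' P hP, h1, neg_zero]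
  refine key _ _ (fun f => ?_) γ
  rw [𝒦.torsion_skew' P hP, 𝒦.torsion_skew P hP, h2, neg_zero, neg_zero]

/-- The graph of a Poisson tensor, as a Dirac structure. -/
def diracGraph (hvec : ∀ φ : Module.Dual R Ω, ∃ x, ∀ α, 𝒦.ev α x = φ α) (c : ℝ) (hc : c ≠ 0) :
    DiracStructure (𝒦.courant c hc) Ω where
  incl := graph P
  bracket := ((𝒦.courant c hc).bracket.compl₁₂ ((graph P).restrictScalars ℝ)
    ((graph P).restrictScalars ℝ)).compr₂ (LinearMap.snd ℝ X Ω)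
  injective α β h := congrArg Prod.snd h
  isotropic := 𝒦.graph_isotropic P hP c hc
  incl_bracket α β := by
    have h : P (𝒦.formBracket P α β) = 𝒦.lie (P α) (P β) := 𝒦.ext_field fun f => by
      have := 𝒦.torsion_eq_zero P hP hJ hvec α β (𝒦.d f)
      rw [torsion, 𝒦.ev_d, 𝒦.ev_d] at this
      exact (sub_eq_zero.mp this).symm
    exact Prod.ext h rfl

end Poisson

/-! ### The Manin triple of two transversal graphs. -/

section Triple

variable {P Q : Ω →ₗ[R] X} (hP : ∀ α β, 𝒦.ev β (P α) = -𝒦.ev α (P β))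
  (hQ : ∀ α β, 𝒦.ev β (Q α) = -𝒦.ev α (Q β))
  (hJP : ∀ f g h : R, 𝒦.der (P (𝒦.d f)) (𝒦.der (P (𝒦.d g)) h) +
    𝒦.der (P (𝒦.d g)) (𝒦.der (P (𝒦.d h)) f) + 𝒦.der (P (𝒦.d h)) (𝒦.der (P (𝒦.d f)) g) = 0)
  (hJQ : ∀ f g h : R, 𝒦.der (Q (𝒦.d f)) (𝒦.der (Q (𝒦.d g)) h) +
    𝒦.der (Q (𝒦.d g)) (𝒦.der (Q (𝒦.d h)) f) + 𝒦.der (Q (𝒦.d h)) (𝒦.der (Q (𝒦.d f)) g) = 0)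
  (hvec : ∀ φ : Module.Dual R Ω, ∃ x, ∀ α, 𝒦.ev α x = φ α) (c : ℝ) (hc : c ≠ 0)

/-- The Manin triple of two Poisson tensors with invertible difference. -/
def maninTriple (T : X → Ω) (hT : ∀ x, P (T x) - Q (T x) = x)
    (hT' : ∀ α, P α - Q α = 0 → α = 0) :
    ManinTriple (𝒦.diracGraph P hP hJP hvec c hc) (𝒦.diracGraph Q hQ hJQ hvec c hc) where
  -- Solving (x, α) = (Pβ, β) + (Qγ, γ) gives γ = α − β and (P − Q)β = x − Qα.
  fst e := T (e.1 - Q e.2)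
  snd e := e.2 - T (e.1 - Q e.2)
  incl_fst_add e := by
    refine Prod.ext ?_ ?_
    · change P (T (e.1 - Q e.2)) + Q (e.2 - T (e.1 - Q e.2)) = e.1
      have := hT (e.1 - Q e.2)
      rw [map_sub, ← sub_eq_zero]
      rw [← sub_eq_zero] at this
      rw [← this]
      abel
    · exact add_sub_cancel _ _
  eq_zero α β h := by
    have h1 : P α + Q β = 0 := congrArg Prod.fst h
    have h2 : α + β = 0 := congrArg Prod.snd h
    rw [eq_neg_of_add_eq_zero_right h2, map_neg, ← sub_eq_add_neg] at h1
    exact hT' _ h1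

/-- Skewness of Q turns the pairing of the graphs into the difference of the tensors. The constant c
is carried throughout so that both normalisations are covered. -/
theorem pair_diracGraph (α β : Ω) :
    ManinTriple.pair (𝒦.diracGraph P hP hJP hvec c hc) (𝒦.diracGraph Q hQ hJQ hvec c hc) α β =
      c • 𝒦.ev β (P α - Q α) := by
  change c • (𝒦.ev α (Q β) + 𝒦.ev β (P α)) = _
  rw [map_sub, hQ β α]
  congr 1
  ring

end Triple

end CartanCalculus

end Cartan

/-! ### Composition and inversion of bundle maps -/

section Bundles

open Bundle ContinuousLinearMap

variable {E : Type*} [NormedAddCommGroup E] [NormedSpace ℝ E]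
  {M : Type*} [TopologicalSpace M] [ChartedSpace E M]
  {F₁ : Type*} [NormedAddCommGroup F₁] [NormedSpace ℝ F₁]
  {A₁ : M → Type*} [TopologicalSpace (Bundle.TotalSpace F₁ A₁)]
  [∀ x, TopologicalSpace (A₁ x)] [FiberBundle F₁ A₁]
  [∀ x, AddCommGroup (A₁ x)] [∀ x, Module ℝ (A₁ x)] [VectorBundle ℝ F₁ A₁]
  {F₂ : Type*} [NormedAddCommGroup F₂] [NormedSpace ℝ F₂]
  {A₂ : M → Type*} [TopologicalSpace (Bundle.TotalSpace F₂ A₂)]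
  [∀ x, TopologicalSpace (A₂ x)] [FiberBundle F₂ A₂]
  [∀ x, AddCommGroup (A₂ x)] [∀ x, Module ℝ (A₂ x)] [VectorBundle ℝ F₂ A₂]
  {F₃ : Type*} [NormedAddCommGroup F₃] [NormedSpace ℝ F₃]
  {A₃ : M → Type*} [TopologicalSpace (Bundle.TotalSpace F₃ A₃)]
  [∀ x, TopologicalSpace (A₃ x)] [FiberBundle F₃ A₃]
  [∀ x, AddCommGroup (A₃ x)] [∀ x, Module ℝ (A₃ x)] [VectorBundle ℝ F₃ A₃]
  [∀ x, IsTopologicalAddGroup (A₁ x)] [∀ x, ContinuousSMul ℝ (A₁ x)]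
  [∀ x, IsTopologicalAddGroup (A₂ x)] [∀ x, ContinuousSMul ℝ (A₂ x)]
  [∀ x, IsTopologicalAddGroup (A₃ x)] [∀ x, ContinuousSMul ℝ (A₃ x)]

instance Sec.instIsScalarTowerFn : IsScalarTower ℝ (Fn E M) (Sec E F₁ A₁) :=
  ⟨fun c f s => by ext x; exact smul_assoc c (f x) (s x)⟩

theorem Sec.sum_apply {ι : Type*} (t : Finset ι) (s : ι → Sec E F₁ A₁) (x : M) :
    (∑ i ∈ t, s i) x = ∑ i ∈ t, s i x := by
  rw [← ContMDiffSection.coeAddHom_apply, map_sum, Finset.sum_apply]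
  rfl

theorem Fn.sum_apply {ι : Type*} (t : Finset ι) (f : ι → Fn E M) (x : M) :
    (∑ i ∈ t, f i) x = ∑ i ∈ t, f i x :=
  map_sum (⟨⟨fun g : Fn E M => g x, rfl⟩, fun _ _ => rfl⟩ : Fn E M →+ ℝ) f t

/-- The composition of smooth bundle maps. -/
def Sec.comp (ψ : Sec E (F₂ →L[ℝ] F₃) (fun x : M => A₂ x →L[ℝ] A₃ x))
    (φ : Sec E (F₁ →L[ℝ] F₂) (fun x : M => A₁ x →L[ℝ] A₂ x)) :
    Sec E (F₁ →L[ℝ] F₃) (fun x : M => A₁ x →L[ℝ] A₃ x) where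
  toFun x := ψ x ∘L φ x
  contMDiff_toFun x₀ := by
    rw [contMDiffAt_hom_bundle]
    refine ⟨contMDiffAt_id, ?_⟩
    have h1 := ((contMDiffAt_hom_bundle _).1 (φ.contMDiff x₀)).2
    have h2 := ((contMDiffAt_hom_bundle _).1 (ψ.contMDiff x₀)).2
    refine (h2.clm_comp h1).congr_of_eventuallyEq ?_
    have B₁ : (trivializationAt F₁ A₁ x₀).baseSet ∈ nhds x₀ :=
      (trivializationAt _ _ _).open_baseSet.mem_nhds (FiberBundle.mem_baseSet_trivializationAt' _)
    have B₂ : (trivializationAt F₂ A₂ x₀).baseSet ∈ nhds x₀ :=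
      (trivializationAt _ _ _).open_baseSet.mem_nhds (FiberBundle.mem_baseSet_trivializationAt' _)
    have B₃ : (trivializationAt F₃ A₃ x₀).baseSet ∈ nhds x₀ :=
      (trivializationAt _ _ _).open_baseSet.mem_nhds (FiberBundle.mem_baseSet_trivializationAt' _)
    filter_upwards [B₁, B₂, B₃] with x hx₁ hx₂ hx₃
    rw [inCoordinates_eq hx₁ hx₃, inCoordinates_eq hx₁ hx₂, inCoordinates_eq hx₂ hx₃]
    ext v
    simp [Trivialization.symm_apply_apply_mk _ hx₂]

/-- The inverse of a pointwise invertible smooth bundle map. -/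
def Sec.inverse [CompleteSpace F₁] (φ : Sec E (F₁ →L[ℝ] F₂) (fun x : M => A₁ x →L[ℝ] A₂ x))
    (hφ : ∀ x, (φ x).IsInvertible) :
    Sec E (F₂ →L[ℝ] F₁) (fun x : M => A₂ x →L[ℝ] A₁ x) where
  toFun x := (φ x).inverse
  contMDiff_toFun x₀ := by
    rw [contMDiffAt_hom_bundle]
    refine ⟨contMDiffAt_id, ?_⟩
    have h1 := ((contMDiffAt_hom_bundle _).1 (φ.contMDiff x₀)).2
    have h2 : ContMDiffAt 𝓘(ℝ, F₁ →L[ℝ] F₂) 𝓘(ℝ, F₂ →L[ℝ] F₁) ∞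
        (ContinuousLinearMap.inverse : (F₁ →L[ℝ] F₂) → (F₂ →L[ℝ] F₁))
        (inCoordinates F₁ A₁ F₂ A₂ x₀ x₀ x₀ x₀ (φ x₀)) := by
      apply ContDiffAt.contMDiffAt
      apply IsInvertible.contDiffAt_map_inverse
      rw [inCoordinates_eq (FiberBundle.mem_baseSet_trivializationAt' x₀)
        (FiberBundle.mem_baseSet_trivializationAt' x₀)]
      exact isInvertible_equiv.comp ((hφ x₀).comp isInvertible_equiv)
    refine (ContMDiffAt.comp x₀ h2 h1).congr_of_eventuallyEq ?_
    have B₁ : (trivializationAt F₁ A₁ x₀).baseSet ∈ nhds x₀ :=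
      (trivializationAt _ _ _).open_baseSet.mem_nhds (FiberBundle.mem_baseSet_trivializationAt' _)
    have B₂ : (trivializationAt F₂ A₂ x₀).baseSet ∈ nhds x₀ :=
      (trivializationAt _ _ _).open_baseSet.mem_nhds (FiberBundle.mem_baseSet_trivializationAt' _)
    filter_upwards [B₁, B₂] with x hx₁ hx₂
    simp only [Function.comp_apply]
    rw [inCoordinates_eq hx₁ hx₂, inCoordinates_eq hx₂ hx₁]
    simp only [inverse_equiv_comp, inverse_comp_equiv, ContinuousLinearEquiv.symm_symm]
    rfl

/-- Near a point where f does not vanish, the section is the smooth section t divided by f. -/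
theorem contMDiff_section_of_smul (s : ∀ x, A₁ x)
    (h : ∀ x₀, ∃ (f : Fn E M) (t : Sec E F₁ A₁), f x₀ ≠ 0 ∧ ∀ x, f x • s x = t x) :
    ContMDiff 𝓘(ℝ, E) (𝓘(ℝ, E).prod 𝓘(ℝ, F₁)) ∞ (fun x => TotalSpace.mk' F₁ x (s x)) := by
  intro x₀
  obtain ⟨f, t, hf, hft⟩ := h x₀
  have h1 : ContMDiffAt 𝓘(ℝ, E) 𝓘(ℝ, ℝ) ∞ (fun x => (f x)⁻¹) x₀ :=
    ContMDiffAt.inv₀ (f.contMDiff x₀) hf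
  refine (h1.smul_section (t.contMDiff x₀)).congr_of_eventuallyEq ?_
  have : ∀ᶠ x in nhds x₀, f x ≠ 0 := f.contMDiff.continuous.continuousAt.eventually_ne hf
  filter_upwards [this] with x hx
  congr 1
  simp only [Pi.smul_apply', ← hft, smul_smul, inv_mul_cancel₀ hx, one_smul]

variable [FiniteDimensional ℝ E] [T2Space M] [IsManifold 𝓘(ℝ, E) ∞ M]

theorem exists_section_trivialization [ContMDiffVectorBundle ∞ F₁ A₁ 𝓘(ℝ, E)] (x₀ : M)
    (ρ : SmoothBumpFunction 𝓘(ℝ, E) x₀)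
    (e : Trivialization F₁ (TotalSpace.proj : TotalSpace F₁ A₁ → M)) [MemTrivializationAtlas e]
    (hρ : tsupport ρ ⊆ e.baseSet) (v : F₁) :
    ∃ s : Sec E F₁ A₁, ∀ x, s x = ρ x • e.symm x v := by
  refine ⟨⟨fun x => ρ x • e.symm x v, ContMDiffOn.smul_section_of_tsupport
    (u := e.baseSet) ρ.contMDiff.contMDiffOn e.open_baseSet hρ ?_⟩, fun x => rfl⟩
  rw [Trivialization.contMDiffOn_section_baseSet_iff]
  refine (contMDiffOn_const (c := v)).congr fun x hx => ?_
  rw [e.apply_mk_symm hx]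

end Bundles

/-! ### Cartan calculus on a manifold -/

section CartanManifold

open Bundle ContinuousLinearMap VectorField

variable {E : Type*} [NormedAddCommGroup E] [NormedSpace ℝ E] [FiniteDimensional ℝ E]
  {M : Type*} [TopologicalSpace M] [T2Space M] [ChartedSpace E M] [IsManifold 𝓘(ℝ, E) ∞ M]

/-- A local frame and its dual coframe are each cut off by the same bump function. The result is a
global identity, trivially true outside the trivialisation, with a factor that is nonzero at x₀. -/
theorem exists_frame (x₀ : M) : ∃ (f : Fn E M) (e : Fin (Module.finrank ℝ E) → VectorFields E M)
    (ε : Fin (Module.finrank ℝ E) → OneForms E M), f x₀ ≠ 0 ∧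
      ∀ (x : M) (v : TangentSpace 𝓘(ℝ, E) x), f x • v = ∑ i, ε i x v • e i x := by
  let τ := trivializationAt E (fun x : M => TangentSpace 𝓘(ℝ, E) x) x₀
  let τ' := trivializationAt (E →L[ℝ] ℝ) (fun x : M => TangentSpace 𝓘(ℝ, E) x →L[ℝ] ℝ) x₀
  have hτ : τ.baseSet ∈ nhds x₀ :=
    τ.open_baseSet.mem_nhds (FiberBundle.mem_baseSet_trivializationAt' _)
  have hττ : τ'.baseSet = τ.baseSet := Set.inter_univ _
  obtain ⟨ρ, -, hρ⟩ := (SmoothBumpFunction.nhds_basis_tsupport (I := 𝓘(ℝ, E)) x₀).mem_iff.1 hτ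
  let b := Module.finBasis ℝ E
  choose e he using fun i => exists_section_trivialization x₀ ρ τ hρ (b i)
  choose ε hε using fun i => exists_section_trivialization x₀ ρ τ' (hττ ▸ hρ)
    (LinearMap.toContinuousLinearMap (b.coord i))
  -- The square appears because both the field and the form carry a factor ρ.
  refine ⟨⟨fun x => ρ x * ρ x, ρ.contMDiff.mul ρ.contMDiff⟩, e, ε, ?_, fun x v => ?_⟩
  · change ρ x₀ * ρ x₀ ≠ 0
    simp
  · change (ρ x * ρ x) • v = _
    simp only [he, hε]
    by_cases hx : x ∈ τ.baseSet
    · have hsymm : ∀ φ : E →L[ℝ] ℝ, τ'.symm x φ v = φ (τ.continuousLinearMapAt ℝ x v) := by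
        intro φ
        have := Pretrivialization.continuousLinearMap_symm_apply' (σ := RingHom.id ℝ) (e₁ := τ)
          (e₂ := trivializationAt ℝ (Bundle.Trivial M ℝ) x₀) (b := x) ⟨hx, Set.mem_univ x⟩ φ
        refine (DFunLike.congr_fun this v).trans ?_
        simp
      have hv : v = τ.symmL ℝ x (∑ i, b.repr (τ.continuousLinearMapAt ℝ x v) i • b i) := by
        rw [b.sum_repr, τ.symmL_continuousLinearMapAt hx]
      conv_lhs => rw [hv]
      rw [map_sum, Finset.smul_sum]
      refine Finset.sum_congr rfl fun i _ => ?_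
      rw [map_smul, smul_apply, hsymm]
      simp only [LinearMap.coe_toContinuousLinearMap', Module.Basis.coord_apply, smul_smul,
        smul_eq_mul]
      rw [Trivialization.symmL_apply _ hx]
      congr 1
      ring
    · have h0 : ρ x = 0 := image_eq_zero_of_notMem_tsupport fun h => hx (hρ h)
      simp [h0]

/-- By `exists_frame`, a multiple of Y that is nonzero at a given point is a combination of smooth
fields with coefficients ε i(Y), which are smooth by hypothesis. -/
theorem contMDiff_vectorField (Y : ∀ x : M, TangentSpace 𝓘(ℝ, E) x)
    (h : ∀ α : OneForms E M, ContMDiff 𝓘(ℝ, E) 𝓘(ℝ, ℝ) ∞ fun x => α x (Y x)) :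
    ContMDiff 𝓘(ℝ, E) (𝓘(ℝ, E).prod 𝓘(ℝ, E)) ∞
      (fun x => (TotalSpace.mk' E x (Y x) : TangentBundle 𝓘(ℝ, E) M)) := by
  refine contMDiff_section_of_smul Y fun x₀ => ?_
  obtain ⟨f, e, ε, hf, hfe⟩ := exists_frame (E := E) x₀
  refine ⟨f, ∑ i, (show Fn E M from ⟨_, h (ε i)⟩) • e i, hf, fun x => ?_⟩
  rw [hfe, ← ContMDiffSection.coeAddHom_apply, map_sum, Finset.sum_apply]
  rfl

theorem contMDiff_oneForm (α : ∀ x : M, TangentSpace 𝓘(ℝ, E) x →L[ℝ] ℝ)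
    (h : ∀ Y : VectorFields E M, ContMDiff 𝓘(ℝ, E) 𝓘(ℝ, ℝ) ∞ fun x => α x (Y x)) :
    ContMDiff 𝓘(ℝ, E) (𝓘(ℝ, E).prod 𝓘(ℝ, E →L[ℝ] ℝ)) ∞
      (fun x => TotalSpace.mk' (E →L[ℝ] ℝ) (E := fun x : M => TangentSpace 𝓘(ℝ, E) x →L[ℝ] ℝ)
        x (α x)) := by
  refine contMDiff_section_of_smul α fun x₀ => ?_
  obtain ⟨f, e, ε, hf, hfe⟩ := exists_frame (E := E) x₀
  refine ⟨f, ∑ i, (show Fn E M from ⟨_, h (e i)⟩) • ε i, hf, fun x => ?_⟩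
  rw [← ContMDiffSection.coeAddHom_apply, map_sum, Finset.sum_apply]
  ext v
  rw [smul_apply, ← map_smul, hfe, map_sum, sum_apply]
  refine Finset.sum_congr rfl fun i _ => ?_
  rw [map_smul, smul_eq_mul, mul_comm]
  rfl

theorem contMDiff_lieDerivFn (Y : VectorFields E M) (f : Fn E M) :
    ContMDiff 𝓘(ℝ, E) 𝓘(ℝ, ℝ) ∞ (lieDerivFn Y f) := by
  have h := (f.contMDiff.contMDiff_tangentMap (m := ∞) (by simp)).comp Y.contMDiff
  intro x
  have hx := h x
  rw [contMDiffAt_totalSpace] at hx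
  have h2 := hx.2
  simp only [Function.comp_apply, tangentMap, trivializationAt_model_space_apply] at h2
  exact h2

/-- The derivative of functions along a vector field, as a derivation. -/
def derivationOfField (Y : VectorFields E M) : Derivation ℝ (Fn E M) (Fn E M) :=
  Derivation.mk'
    { toFun := fun f => ⟨lieDerivFn Y f, contMDiff_lieDerivFn Y f⟩
      map_add' := fun f g => by
        ext x
        exact DFunLike.congr_fun (mvfderiv_add f.mdifferentiableAt g.mdifferentiableAt) (Y x)
      map_smul' := fun c f => by
        ext x
        exact DFunLike.congr_fun (const_smul_mfderiv f.mdifferentiableAt c) (Y x) }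
    fun f g => by
      ext x
      refine (DFunLike.congr_fun
        (mvfderiv_mul f.mdifferentiableAt g.mdifferentiableAt) (Y x)).trans ?_
      rfl

/-- A vector field, read in a chart. -/
def chartField (x₀ : M) (Y : VectorFields E M) (y : E) : E :=
  mpullback 𝓘(ℝ, E) 𝓘(ℝ, E) (extChartAt 𝓘(ℝ, E) x₀).symm (fun x => Y x) y

theorem mdifferentiableAt_extChartAt_symm (x₀ : M) {y : E}
    (hy : y ∈ (extChartAt 𝓘(ℝ, E) x₀).target) :
    MDifferentiableAt 𝓘(ℝ, E) 𝓘(ℝ, E) (extChartAt 𝓘(ℝ, E) x₀).symm y := by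
  rw [← mdifferentiableWithinAt_univ]
  have := mdifferentiableWithinAt_extChartAt_symm (I := 𝓘(ℝ, E)) hy
  rwa [modelWithCornersSelf_coe, Set.range_id] at this

theorem fderiv_chartField (x₀ : M) (Y : VectorFields E M) (f : Fn E M) {y : E}
    (hy : y ∈ (extChartAt 𝓘(ℝ, E) x₀).target) :
    fderiv ℝ (f ∘ (extChartAt 𝓘(ℝ, E) x₀).symm) y (chartField x₀ Y y) =
      lieDerivFn Y f ((extChartAt 𝓘(ℝ, E) x₀).symm y) := by
  have hi := isInvertible_mfderivWithin_extChartAt_symm (I := 𝓘(ℝ, E)) hy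
  simp only [modelWithCornersSelf_coe, Set.range_id, mfderivWithin_univ] at hi
  rw [← mfderiv_eq_fderiv, mfderiv_comp y f.mdifferentiableAt
    (mdifferentiableAt_extChartAt_symm x₀ hy)]
  obtain ⟨N, hN⟩ := hi
  change mfderiv 𝓘(ℝ, E) 𝓘(ℝ, ℝ) f _ (mfderiv 𝓘(ℝ, E) 𝓘(ℝ, E) (extChartAt 𝓘(ℝ, E) x₀).symm y
    ((mfderiv 𝓘(ℝ, E) 𝓘(ℝ, E) (extChartAt 𝓘(ℝ, E) x₀).symm y).inverse _)) = _
  rw [← hN, ContinuousLinearMap.inverse_equiv]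
  erw [N.apply_symm_apply]
  rfl

/-- In the chart at x₀ the formula is the symmetry of the second derivative. It is carried back
because the derivative of the chart at its own base point is the identity. -/
theorem lieDerivFn_bracket (X Y : VectorFields E M) (f : Fn E M) (x₀ : M) :
    mfderiv 𝓘(ℝ, E) 𝓘(ℝ, ℝ) f x₀ (vfBracket X Y x₀) =
      lieDerivFn X (lieDerivFn Y f) x₀ - lieDerivFn Y (lieDerivFn X f) x₀ := by
  let φ := extChartAt 𝓘(ℝ, E) x₀
  have hx : x₀ ∈ φ.source := mem_extChartAt_source x₀
  have hy : φ x₀ ∈ φ.target := mem_extChartAt_target x₀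
  have hφ : φ.symm (φ x₀) = x₀ := extChartAt_to_inv x₀
  have hnhds : φ.target ∈ nhds (φ x₀) := by
    have := extChartAt_target_mem_nhds (I := 𝓘(ℝ, E)) x₀
    exact this
  have hd : ∀ Z : VectorFields E M, DifferentiableAt ℝ (chartField x₀ Z) (φ x₀) := by
    intro Z
    have := MDifferentiableWithinAt.differentiableWithinAt_mpullbackWithin_vectorField
      (I := 𝓘(ℝ, E)) (s := Set.univ) (x := x₀) Z.mdifferentiableAt.mdifferentiableWithinAt
    rw [modelWithCornersSelf_coe, Set.range_id, Set.preimage_univ, Set.univ_inter,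
      mpullbackWithin_univ] at this
    exact differentiableWithinAt_univ.1 this
  have hf : ContDiffAt ℝ 2 (f ∘ φ.symm) (φ x₀) := by
    have h1 := contMDiffWithinAt_extChartAt_symm_range (I := 𝓘(ℝ, E)) (n := ∞) x₀ hy
    simp only [modelWithCornersSelf_coe, Set.range_id, contMDiffWithinAt_univ] at h1
    have h2 := ContMDiffAt.comp (φ x₀) (f.contMDiff _) h1
    exact (contMDiffAt_iff_contDiffAt.1 h2).of_le (by norm_cast)
  have key : ∀ Z Z' : VectorFields E M,
      fderiv ℝ (fun y => fderiv ℝ (f ∘ φ.symm) y (chartField x₀ Z' y)) (φ x₀)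
        (chartField x₀ Z (φ x₀)) = lieDerivFn Z (lieDerivFn Z' f) x₀ := by
    intro Z Z'
    have he : (fun y => fderiv ℝ (f ∘ φ.symm) y (chartField x₀ Z' y)) =ᶠ[nhds (φ x₀)]
        (derivationOfField Z' f) ∘ φ.symm := by
      filter_upwards [hnhds] with y hy
      exact fderiv_chartField x₀ Z' f hy
    rw [he.fderiv_eq]
    have := fderiv_chartField x₀ Z (derivationOfField Z' f) hy
    rw [hφ] at this
    exact this
  have h3 := fderiv_apply_lieBracket hf (by simp) (hd Y) (hd X)
  rw [key, key] at h3
  rw [← h3]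
  have h4 : vfBracket X Y x₀ =
      lieBracket ℝ (chartField x₀ X) (chartField x₀ Y) (φ x₀) := by
    rw [vfBracket, ← mlieBracketWithin_univ, mlieBracketWithin_apply, mfderiv_extChartAt_self]
    simp only [modelWithCornersSelf_coe, Set.range_id, Set.preimage_univ, Set.univ_inter,
      mpullbackWithin_univ]
    refine (DFunLike.congr_fun (ContinuousLinearMap.inverse_id (R := ℝ)
      (M := TangentSpace 𝓘(ℝ, E) x₀)) _).trans ?_
    change lieBracketWithin ℝ (chartField x₀ X) (chartField x₀ Y) Set.univ (φ x₀) = _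
    rw [lieBracketWithin_univ]
  have h5 : fderiv ℝ (f ∘ φ.symm) (φ x₀) = mfderiv 𝓘(ℝ, E) 𝓘(ℝ, ℝ) f x₀ := by
    have h6 := mfderivWithin_range_extChartAt_symm (I := 𝓘(ℝ, E)) (x := x₀)
    rw [modelWithCornersSelf_coe, Set.range_id, mfderivWithin_univ] at h6
    rw [← mfderiv_eq_fderiv, mfderiv_comp _ f.mdifferentiableAt
      (mdifferentiableAt_extChartAt_symm x₀ hy), h6, hφ]
    rfl
  rw [h4, h5]
  rfl

/-- The Lie bracket of smooth vector fields is smooth. -/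
def fieldBracket (X Y : VectorFields E M) : VectorFields E M :=
  haveI : IsManifold 𝓘(ℝ, E) (minSmoothness ℝ 2) M :=
    IsManifold.of_le (n := ∞) (by simp only [minSmoothness_of_isRCLikeNormedField]; norm_cast)
  haveI : IsManifold 𝓘(ℝ, E) (((⊤ : ℕ∞) : WithTop ℕ∞) + 1) M := ‹IsManifold 𝓘(ℝ, E) ∞ M›
  ⟨vfBracket X Y, fun x => ContMDiffAt.mlieBracket_vectorField (m := ⊤) (n := ⊤)
    (X.contMDiff x) (Y.contMDiff x) (by simp)⟩

/-- The differential of a function. -/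
def differential (f : Fn E M) : OneForms E M :=
  ⟨fun x => mfderiv 𝓘(ℝ, E) 𝓘(ℝ, ℝ) f x,
    contMDiff_oneForm _ fun Y => contMDiff_lieDerivFn Y f⟩

/-- A function together with a frame of vector fields and its dual frame, up to that function. -/
structure ScaledFrame (f : Fn E M) (n : ℕ) (e : Fin n → VectorFields E M)
    (ε : Fin n → OneForms E M) : Prop where
  field : ∀ Y : VectorFields E M, f • Y = ∑ i, evalForm (ε i) Y • e i
  form : ∀ α : OneForms E M, f • α = ∑ i, evalForm α (e i) • ε i

theorem exists_scaledFrame (x₀ : M) :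
    ∃ (f : Fn E M) (n : ℕ) (e : _) (ε : _), f x₀ ≠ 0 ∧ ScaledFrame f n e ε := by
  obtain ⟨f, e, ε, hf, h⟩ := exists_frame (E := E) x₀
  refine ⟨f, _, e, ε, hf, ⟨fun Y => ?_, fun α => ?_⟩⟩
  · ext x
    rw [Sec.sum_apply]
    exact h x (Y x)
  · ext x v
    rw [Sec.sum_apply, sum_apply]
    change f x * α x v = ∑ i, α x (e i x) * ε i x v
    rw [← smul_eq_mul, ← map_smul, h, map_sum]
    refine Finset.sum_congr rfl fun i _ => ?_
    rw [map_smul, smul_eq_mul, mul_comm]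

/-- A function-linear φ is tensorial: expanding f Y in the scaled frame shows that φ(Y) at x depends
only on the value of Y at x. -/
theorem exists_oneForm (φ : VectorFields E M →ₗ[Fn E M] Fn E M) :
    ∃ α : OneForms E M, evalForm α = φ := by
  choose f n e ε hf hfr using fun x : M => exists_scaledFrame (E := E) x
  let α : ∀ x : M, TangentSpace 𝓘(ℝ, E) x →L[ℝ] ℝ := fun x =>
    (f x x)⁻¹ • ∑ i, φ (e x i) x • ε x i x
  have hα : ∀ (Y : VectorFields E M) (x : M), α x (Y x) = φ Y x := by
    intro Y x
    have h := congrArg (fun r : Fn E M => r x) (congrArg φ ((hfr x).field Y))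
    rw [map_smul, map_sum] at h
    simp only [Fn.sum_apply, map_smul] at h
    change f x x * φ Y x = ∑ i, ε x i x (Y x) * φ (e x i) x at h
    change (f x x)⁻¹ * (∑ i, φ (e x i) x • ε x i x) (Y x) = _
    rw [sum_apply, inv_mul_eq_iff_eq_mul₀ (hf x), h]
    exact Finset.sum_congr rfl fun i _ => mul_comm _ _
  refine ⟨⟨α, contMDiff_oneForm α fun Y => ?_⟩, ?_⟩
  · exact (φ Y).contMDiff.congr (hα Y)
  · ext Y x
    exact hα Y x

theorem exists_vectorField (φ : OneForms E M →ₗ[Fn E M] Fn E M) :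
    ∃ Y : VectorFields E M, ∀ α, evalForm α Y = φ α := by
  choose f n e ε hf hfr using fun x : M => exists_scaledFrame (E := E) x
  let Y : ∀ x : M, TangentSpace 𝓘(ℝ, E) x := fun x => (f x x)⁻¹ • ∑ i, φ (ε x i) x • e x i x
  have hY : ∀ (α : OneForms E M) (x : M), α x (Y x) = φ α x := by
    intro α x
    have h := congrArg (fun r : Fn E M => r x) (congrArg φ ((hfr x).form α))
    rw [map_smul, map_sum] at h
    simp only [Fn.sum_apply, map_smul] at h
    change f x x * φ α x = ∑ i, α x (e x i x) * φ (ε x i) x at h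
    rw [map_smul, map_sum, smul_eq_mul, inv_mul_eq_iff_eq_mul₀ (hf x), h]
    refine Finset.sum_congr rfl fun i _ => ?_
    rw [map_smul, smul_eq_mul, mul_comm]
  refine ⟨⟨Y, contMDiff_vectorField Y fun α => ?_⟩, fun α => ?_⟩
  · exact (φ α).contMDiff.congr (hY α)
  · ext x
    exact hY α x

theorem eq_of_evalForm_eq {α β : OneForms E M} (h : ∀ Y, evalForm α Y = evalForm β Y) :
    α = β := by
  ext1 x
  obtain ⟨f, n, e, ε, hf, hfr⟩ := exists_scaledFrame (E := E) x
  have : f • α = f • β := by rw [hfr.form, hfr.form]; simp only [h]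
  have := congrArg (fun s : OneForms E M => s x) this
  exact smul_right_injective _ hf this

/-- A linear functional read in the chart at x₀ and cut off by a bump function is a global function
whose differential at x₀ is that functional. Such functionals separate tangent vectors. -/
theorem eq_of_lieDerivFn_eq {X Y : VectorFields E M}
    (h : ∀ f : Fn E M, lieDerivFn X f = lieDerivFn Y f) : X = Y := by
  ext1 x₀
  have key : ∀ φ : E →L[ℝ] ℝ, φ (X x₀) = φ (Y x₀) := by
    intro φ
    obtain ⟨ρ⟩ : Nonempty (SmoothBumpFunction 𝓘(ℝ, E) x₀) := inferInstance
    have hg : ContMDiffOn 𝓘(ℝ, E) 𝓘(ℝ, ℝ) ∞ (fun x => φ (extChartAt 𝓘(ℝ, E) x₀ x))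
        (chartAt E x₀).source :=
      φ.contMDiff.comp_contMDiffOn (contMDiffOn_extChartAt)
    let f : Fn E M := ⟨_, ρ.contMDiff_smul hg⟩
    have hf : mfderiv 𝓘(ℝ, E) 𝓘(ℝ, ℝ) f x₀ = φ := by
      have he : (f : M → ℝ) =ᶠ[nhds x₀] φ ∘ (extChartAt 𝓘(ℝ, E) x₀) := by
        filter_upwards [ρ.eventuallyEq_one] with x hx
        change ρ x • φ _ = _
        rw [hx]
        exact one_smul _ _
      rw [he.mfderiv_eq, mfderiv_comp x₀ φ.mdifferentiableAt (mdifferentiableAt_extChartAt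
        (mem_chart_source E x₀)), mfderiv_extChartAt_self, mfderiv_eq_fderiv, φ.fderiv]
      rfl
    have := congrFun (h f) x₀
    rw [lieDerivFn, lieDerivFn, hf] at this
    exact this
  exact (SeparatingDual.eq_iff_forall_dual_eq (R := ℝ) (V := E)).2 key

/-- Cartan calculus on a manifold. -/
def cartanCalculus (E : Type*) [NormedAddCommGroup E] [NormedSpace ℝ E] [FiniteDimensional ℝ E]
    (M : Type*) [TopologicalSpace M] [T2Space M] [ChartedSpace E M] [IsManifold 𝓘(ℝ, E) ∞ M] :
    CartanCalculus (Fn E M) (VectorFields E M) (OneForms E M) where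
  ev :=
    { toFun := evalForm
      map_add' := fun α β => rfl
      map_smul' := fun f α => rfl }
  der :=
    { toFun := derivationOfField
      map_add' := fun X Y => by
        ext f x
        exact map_add (mfderiv 𝓘(ℝ, E) 𝓘(ℝ, ℝ) f x) (X x) (Y x)
      map_smul' := fun g X => by
        ext f x
        exact map_smul (mfderiv 𝓘(ℝ, E) 𝓘(ℝ, ℝ) f x) (g x) (X x) }
  lie := fieldBracket
  d := differential
  ev_injective α β h := eq_of_evalForm_eq fun Y => LinearMap.congr_fun h Y
  ev_surjective := exists_oneForm
  der_injective X Y h := eq_of_lieDerivFn_eq fun f =>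
    congrArg (fun D : Derivation ℝ (Fn E M) (Fn E M) => (D f : M → ℝ)) h
  der_lie X Y f := by
    ext x
    exact lieDerivFn_bracket X Y f x
  ev_d f Y := rfl

end CartanManifold

/-! ### Lie bialgebroids from algebraic data -/

section Slots

variable {R N : Type*} [CommRing R] [Algebra ℝ R] [AddCommGroup N] [Module R N]

theorem toLinearMap_zero {q : ℕ} (Q : N [⋀^Fin (q + 1)]→ₗ[R] R) (v : Fin (q + 1) → N) :
    Q.toMultilinearMap.toLinearMap v 0 = slot Q fun j => v j.succ := by
  ext ζ
  change Q (Function.update v 0 ζ) = Q (Fin.cons ζ _)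
  congr 1
  conv_lhs => rw [← Fin.cons_self_tail v, Fin.update_cons_zero]
  rfl

/-- Moving the last slot to the front is a cycle of sign (−1)^p. -/
theorem toLinearMap_last {p : ℕ} (P : N [⋀^Fin (p + 1)]→ₗ[R] R) (v : Fin (p + 1) → N) :
    P.toMultilinearMap.toLinearMap v (Fin.last p) =
      (-1 : ℝ) ^ p • slot P fun i => v i.castSucc := by
  ext ζ
  change P (Function.update v (Fin.last p) ζ) = (-1 : ℝ) ^ p • P (Fin.cons ζ _)
  have h : Function.update v (Fin.last p) ζ =
      (Fin.cons ζ fun i : Fin p => v i.castSucc : Fin (p + 1) → N) ∘ (Fin.last p).cycleRange := by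
    rw [Fin.cons_comp_cycleRange, Fin.insertNth_last']
    conv_lhs => rw [← Fin.snoc_init_self v, Fin.update_snoc_last]
    rfl
  rw [h, P.map_perm, Fin.sign_cycleRange, Units.smul_def, ← Int.cast_smul_eq_zsmul ℝ]
  push_cast
  rfl

end Slots

/-! ### Comparison of the operations on sections with the algebraic ones. -/

section Bridge

variable {E : Type*} [NormedAddCommGroup E] [NormedSpace ℝ E]
  {M : Type*} [TopologicalSpace M] [ChartedSpace E M] [IsManifold 𝓘(ℝ, E) ∞ M]
  {F : Type*} [NormedAddCommGroup F] [NormedSpace ℝ F]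
  {A : M → Type*} [TopologicalSpace (Bundle.TotalSpace F A)]
  [∀ x, TopologicalSpace (A x)] [FiberBundle F A]
  [∀ x, AddCommGroup (A x)] [∀ x, Module ℝ (A x)] [VectorBundle ℝ F A]
  [ContMDiffVectorBundle ∞ F A 𝓘(ℝ, E)]
  [∀ x, IsTopologicalAddGroup (A x)] [∀ x, ContinuousSMul ℝ (A x)]
  {F' : Type*} [NormedAddCommGroup F'] [NormedSpace ℝ F']
  {A' : M → Type*} [TopologicalSpace (Bundle.TotalSpace F' A')]
  [∀ x, TopologicalSpace (A' x)] [FiberBundle F' A']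
  [∀ x, AddCommGroup (A' x)] [∀ x, Module ℝ (A' x)] [VectorBundle ℝ F' A']
  [ContMDiffVectorBundle ∞ F' A' 𝓘(ℝ, E)]
  [∀ x, IsTopologicalAddGroup (A' x)] [∀ x, ContinuousSMul ℝ (A' x)]

/-- The anchor and the bracket of a Lie algebroid, on sections. -/
structure LieAlgebroid.IsModelledBy (𝒜 : LieAlgebroid E F A)
    (𝔞 : AnchoredBracket (Fn E M) (Sec E F A)) : Prop where
  anchor : ∀ (X : Sec E F A) (f : Fn E M) (x : M), 𝔞.anchor X f x = 𝒜.deriv X f x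
  bracket : ∀ X Y : Sec E F A, 𝔞.bracket X Y = 𝒜.bracket X Y

theorem Fn.neg_one_pow_smul (k : ℕ) (f : Fn E M) (x : M) :
    ((-1 : ℝ) ^ k • f) x = (-1 : ℝ) ^ k * f x := rfl

theorem LieAlgebroid.IsModelledBy.differentialValue_eq {𝒜' : LieAlgebroid E F' A'}
    {𝔞' : AnchoredBracket (Fn E M) (Sec E F' A')} (h : 𝒜'.IsModelledBy 𝔞') {k : ℕ}
    (P : Multi E F' A' k) (ξ : Fin (k + 1) → Sec E F' A') (x : M) :
    𝔞'.d P ξ x = differentialValue 𝒜' P ξ x := by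
  rw [AnchoredBracket.coe_d]
  cases k with
  | zero =>
    rw [differentialValue, ← h.anchor]
    have h1 : ∀ v : Fin 0 → Sec E F' A', P v = P ![] := fun v => congrArg P (Subsingleton.elim _ _)
    simp [AnchoredBracket.dReal, AlternatingMap.alternatizeUncurryFin_apply, h1]
  | succ k =>
    rw [AnchoredBracket.dReal_succ_apply, differentialValue]
    change (∑ i, _ : Fn E M) x - (∑ i, _ : Fn E M) x = _
    rw [Fn.sum_apply, Fn.sum_apply, sub_eq_add_neg]
    congr 1
    · refine Finset.sum_congr rfl fun i _ => ?_
      rw [← h.anchor]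
      rfl
    · rw [Fin.sum_univ_castSucc (n := k + 1), ← Finset.sum_neg_distrib]
      -- The last index i admits no l ≥ i; dropping it matches the two ranges of summation.
      have h0 : (∑ l : Fin (k + 1), if ((Fin.last (k + 1) : Fin (k + 2)) : ℕ) ≤ (l : ℕ) then
          (-1 : ℝ) ^ (((Fin.last (k + 1) : Fin (k + 2)) : ℕ) + ((l : ℕ) + 1)) *
            P (Fin.cons (𝒜'.bracket (ξ (Fin.last (k + 1))) (ξ l.succ))
              (l.removeNth ((Fin.last (k + 1)).removeNth ξ))) x else 0) = 0 := by
        refine Finset.sum_eq_zero fun l _ => if_neg ?_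
        have := l.isLt
        simp only [Fin.val_last]
        omega
      rw [h0, add_zero]
      refine Finset.sum_congr rfl fun i _ => ?_
      rw [Fn.sum_apply, ← Finset.sum_neg_distrib, ← Finset.sum_filter]
      refine Finset.sum_congr ?_ fun l _ => ?_
      · ext l
        rw [Finset.mem_Ici, Finset.mem_filter, Fin.val_castSucc, Fin.le_def]
        exact ⟨fun h => ⟨Finset.mem_univ _, h⟩, fun h => h.2⟩
      · rw [Fn.neg_one_pow_smul, h.bracket, Fin.val_castSucc, ← add_assoc, pow_succ]
        ring

variable {B : Sec E F A →ₗ[Fn E M] Sec E F' A' →ₗ[Fn E M] Fn E M}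

theorem apply_toPerfPair_symm [B.IsPerfPair] (φ : Module.Dual (Fn E M) (Sec E F' A')) :
    B (B.toPerfPair.symm φ) = φ :=
  B.toPerfPair.apply_symm_apply φ

/-- The overlapping argument lists share the entry v_p, which is the shared argument of `pre`.
Contraction in the last slot of P is contraction in the first with the sign (−1)^p. -/
theorem LieAlgebroid.IsModelledBy.schoutenValue_eq {𝒜 : LieAlgebroid E F A}
    {𝔞 : AnchoredBracket (Fn E M) (Sec E F A)} (h𝒜 : 𝒜.IsModelledBy 𝔞) [B.IsPerfPair]
    {p q n : ℕ} (h : n + 1 = p + q) (P : Multi E F' A' p) (Q : Multi E F' A' q)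
    (ξ : Fin n → Sec E F' A') (x : M) :
    (𝔞.dual B B.toPerfPair.symm.toLinearMap apply_toPerfPair_symm).schouten h P Q ξ x =
      schoutenValue B 𝒜 h P Q ξ x := by
  match p, q, n, h, P, Q, ξ with
  | 0, 0, _, h, _, _, _ => omega
  | 0, q + 1, n, h, f, Q, ξ =>
    rw [schoutenValue, ← h𝒜.anchor, sharp, toLinearMap_zero]
    simp only [Fin.cons_succ]
    rfl
  | p + 1, 0, n, h, P, g, ξ =>
    rw [schoutenValue, ← h𝒜.anchor, sharp, toLinearMap_last]
    simp only [Fin.snoc_castSucc]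
    rfl
  | p + 1, q + 1, 0, h, _, _, _ => omega
  | p + 1, q + 1, n + 1, h, P, Q, ξ =>
    rw [schoutenValue]
    change (∑ σ : Equiv.Perm (Fin (n + 1)), _ : Fn E M) x = _
    rw [Fn.sum_apply]
    refine Finset.sum_congr rfl fun σ _ => ?_
    simp only [← h𝒜.anchor, sharp, toLinearMap_zero, toLinearMap_last, dTwo, ← h𝒜.bracket]
    have hζ : ∀ (k : ℕ) (hk : k = p) (hk' : k < n + 1), ξ (σ ⟨k, hk'⟩) =
        (ξ ∘ σ) (Fin.cast (by omega) (Fin.castAdd q (Fin.last p))) :=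
      fun k hk hk' => congrArg (fun i => ξ (σ i)) (Fin.ext hk)
    have hψ : (slot Q fun j : Fin q => ξ (σ ⟨p + ↑j.succ, by omega⟩)) =
        slot Q fun j => ((ξ ∘ σ) ∘ Fin.cast (by omega)) (Fin.natAdd (p + 1) j) := by
      congr 1
      funext j
      exact congrArg (fun i => ξ (σ i)) (Fin.ext (by simp; omega))
    have hQ : (Q fun j => ξ (σ ⟨p + ↑j, by omega⟩)) =
        slot Q (fun j : Fin q => ξ (σ ⟨p + ↑j.succ, by omega⟩)) (ξ (σ ⟨p, by omega⟩)) := by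
      rw [← toLinearMap_zero Q fun j : Fin (q + 1) => ξ (σ ⟨p + ↑j, by omega⟩)]
      exact congrArg Q (Function.update_eq_self _ _).symm
    have hP : (P fun i => ξ (σ ⟨↑i, by omega⟩)) =
        ((-1 : ℝ) ^ p • slot P fun i : Fin p => ξ (σ ⟨↑i.castSucc, by omega⟩))
          (ξ (σ ⟨p, by omega⟩)) := by
      rw [← toLinearMap_last P fun j : Fin (p + 1) => ξ (σ ⟨↑j, by omega⟩)]
      exact congrArg P (Function.update_eq_self _ _).symm
    have hB : ∀ φ, B (B.toPerfPair.symm φ) = φ := apply_toPerfPair_symm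
    rw [hQ, hP]
    simp only [hB, hψ, DualAnchoredBracket.pre, DualAnchoredBracket.core]
    simp only [AnchoredBracket.dual_anchor, AnchoredBracket.dual_diff, div_eq_inv_mul]
    rfl

/-- The vanishing defect is an equality of generating functions, and by `alternating_ext_gev` an
equality of alternating maps. For two functions the term d[f, g] is zero by convention. -/
theorem LieAlgebroid.IsModelledBy.isLieBialgebroid {𝒜 : LieAlgebroid E F A}
    {𝒜' : LieAlgebroid E F' A'} {𝔞 : AnchoredBracket (Fn E M) (Sec E F A)}
    {𝔞' : AnchoredBracket (Fn E M) (Sec E F' A')} (h𝒜 : 𝒜.IsModelledBy 𝔞)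
    (h𝒜' : 𝒜'.IsModelledBy 𝔞') [B.IsPerfPair]
    (hdefect : ∀ {m p q : ℕ} (P : Multi E F' A' p) (Q : Multi E F' A' q)
      (ξ : Fin m → Sec E F' A'),
      (𝔞.dual B B.toPerfPair.symm.toLinearMap apply_toPerfPair_symm).gevDefect 𝔞' ξ P Q = 0) :
    IsLieBialgebroid B 𝒜 𝒜' := by
  have hpow : ∀ (k : ℕ) (f : Fn E M), (-1 : Fn E M) ^ k • f = (-1 : ℝ) ^ k • f := fun k f => by
    rw [Algebra.smul_def ((-1 : ℝ) ^ k), map_pow, map_neg, map_one, smul_eq_mul]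
  refine ⟨inferInstance, fun {k} P => 𝔞'.d P, fun {p q n} h P Q =>
    (𝔞.dual B B.toPerfPair.symm.toLinearMap apply_toPerfPair_symm).schouten h P Q,
    fun k P ξ x => h𝒜'.differentialValue_eq P ξ x,
    fun p q n h P Q ξ x => h𝒜.schoutenValue_eq h P Q ξ x, fun p q n h P Q => ?_, fun f g => ?_⟩
  · refine sub_eq_zero.1 (alternating_ext_gev fun ξ => ?_)
    have := hdefect P Q ξ
    rw [DualAnchoredBracket.gevDefect_eq_gev h (by omega) (by omega),
      DualAnchoredBracket.gev_coe_sub_smul] at this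
    rw [DualAnchoredBracket.gev_eq_zero_of_forall ξ (F := (0 : Multi E F' A' (n + 1)))
      fun _ => rfl, ← this]
    congr 1
    funext v
    simp only [AlternatingMap.sub_apply, AlternatingMap.add_apply, AlternatingMap.smul_apply, hpow]
    ring
  · refine sub_eq_zero.1 (alternating_ext_gev fun ξ => ?_)
    have := hdefect f g ξ
    rw [DualAnchoredBracket.gevDefect, DualAnchoredBracket.gevDS_zero,
      ← DualAnchoredBracket.gev_schouten (h := (by omega : 0 + 1 = (0 + 1) + 0)),
      ← DualAnchoredBracket.gev_schouten (h := (by omega : 0 + 1 = 0 + (0 + 1))),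
      ← DualAnchoredBracket.gev_eq_zero_of_forall ξ (F := (0 : Multi E F' A' 0)) fun _ => rfl,
      DualAnchoredBracket.gev_coe_sub_smul] at this
    rw [← this]
    congr 1
    funext v
    simp only [AlternatingMap.sub_apply, AlternatingMap.add_apply, AlternatingMap.smul_apply, hpow]
    ring

end Bridge

/-! ### The Lie bialgebroid of two Poisson tensors -/

section Cotangent

variable {E : Type*} [NormedAddCommGroup E] [NormedSpace ℝ E] [FiniteDimensional ℝ E]
  {M : Type*} [TopologicalSpace M] [T2Space M] [ChartedSpace E M] [IsManifold 𝓘(ℝ, E) ∞ M]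

variable {U V : SharpMaps E M}

theorem IsPoisson.ev_skew (hU : IsPoisson U) (α β : OneForms E M) :
    (cartanCalculus E M).ev β (onSections U α) = -(cartanCalculus E M).ev α (onSections U β) := by
  ext x
  exact hU.skew x (α x) (β x)

theorem IsPoisson.der_jacobi (hU : IsPoisson U) (f g h : Fn E M) :
    (cartanCalculus E M).der (onSections U ((cartanCalculus E M).d f))
        ((cartanCalculus E M).der (onSections U ((cartanCalculus E M).d g)) h) +
      (cartanCalculus E M).der (onSections U ((cartanCalculus E M).d g))
        ((cartanCalculus E M).der (onSections U ((cartanCalculus E M).d h)) f) +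
      (cartanCalculus E M).der (onSections U ((cartanCalculus E M).d h))
        ((cartanCalculus E M).der (onSections U ((cartanCalculus E M).d f)) g) = 0 := by
  ext x
  exact hU.jacobi f g h x

/-- The graph of a Poisson tensor in the standard Courant algebroid. -/
def IsPoisson.dirac (hU : IsPoisson U) (c : ℝ) (hc : c ≠ 0) :
    DiracStructure ((cartanCalculus E M).courant c hc) (OneForms E M) :=
  (cartanCalculus E M).diracGraph (onSections U) hU.ev_skew hU.der_jacobi exists_vectorField c hc

/-- The cotangent Lie algebroid of a Poisson tensor. -/
def IsPoisson.cotangentAlgebroid (hU : IsPoisson U) :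
    LieAlgebroid E (M := M) (E →L[ℝ] ℝ) (fun x => TangentSpace 𝓘(ℝ, E) x →L[ℝ] ℝ) where
  anchor := U
  bracket α β := (hU.dirac 1 one_ne_zero).bracket α β
  bracket_add α β γ := map_add _ _ _
  bracket_smul c α β := map_smul _ _ _
  bracket_skew := (hU.dirac 1 one_ne_zero).toAnchoredBracket.skew
  bracket_jacobi α β γ := by
    have h : (hU.dirac 1 one_ne_zero).bracket α ((hU.dirac 1 one_ne_zero).bracket β γ) =
        (hU.dirac 1 one_ne_zero).bracket ((hU.dirac 1 one_ne_zero).bracket α β) γ +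
          (hU.dirac 1 one_ne_zero).bracket β ((hU.dirac 1 one_ne_zero).bracket α γ) := by
      apply (hU.dirac 1 one_ne_zero).injective
      simp only [map_add, DiracStructure.incl_bracket]
      exact CourantAlgebroid.jacobi _ _ _ _
    have hs := (hU.dirac 1 one_ne_zero).toAnchoredBracket.skew
    simp only [DiracStructure.toAnchoredBracket_bracket] at hs
    rw [h, hs _ γ, hs α γ, map_neg]
    abel
  anchor_bracket α β x := by
    have h := congrArg Prod.fst ((hU.dirac 1 one_ne_zero).incl_bracket α β)
    exact congrArg (fun Y : VectorFields E M => Y x) h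
  bracket_fn_smul α f β x := by
    have h := (hU.dirac 1 one_ne_zero).toAnchoredBracket.leibniz α f β
    exact congrArg (fun Y : OneForms E M => Y x) h

theorem IsPoisson.isCotangentAlgebroid (hU : IsPoisson U) :
    IsCotangentAlgebroid U hU.cotangentAlgebroid where
  anchor_eq := rfl
  bracket_eq ξ η Y x := DFunLike.congr_fun ((cartanCalculus E M).ev_dorfmanForm
    (onSections U ξ, ξ) (onSections U η, η) Y) x

/-- The Dorfman bracket and the anchor do not involve c, so one cotangent algebroid serves every
normalisation. -/
theorem IsPoisson.isModelledBy (hU : IsPoisson U) (c : ℝ) (hc : c ≠ 0) :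
    hU.cotangentAlgebroid.IsModelledBy (hU.dirac c hc).toAnchoredBracket :=
  ⟨fun _ _ _ => rfl, fun _ _ => rfl⟩

theorem isInvertible_of_bijective (hUV : ∀ x : M, Function.Bijective (U x - V x)) (x : M) :
    ((U - V) x).IsInvertible := by
  have : FiniteDimensional ℝ (TangentSpace 𝓘(ℝ, E) x) := inferInstanceAs (FiniteDimensional ℝ E)
  have : T2Space (TangentSpace 𝓘(ℝ, E) x) := inferInstanceAs (T2Space E)
  exact ⟨(LinearEquiv.ofBijective (U x - V x).toLinearMap (hUV x)).toContinuousLinearEquiv, rfl⟩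

/-- The inverse of the difference of two Poisson tensors. -/
def flatMap (hUV : ∀ x : M, Function.Bijective (U x - V x)) :
    Sec E (E →L[ℝ] (E →L[ℝ] ℝ))
      (fun x : M => TangentSpace 𝓘(ℝ, E) x →L[ℝ] (TangentSpace 𝓘(ℝ, E) x →L[ℝ] ℝ)) :=
  Sec.inverse (U - V) (isInvertible_of_bijective hUV)

end Cotangent

/-! ### The Lie bialgebroid of two Poisson tensors -/

section Difference

variable {E : Type*} [NormedAddCommGroup E] [NormedSpace ℝ E] [FiniteDimensional ℝ E]
  {M : Type*} [TopologicalSpace M] [T2Space M] [ChartedSpace E M] [IsManifold 𝓘(ℝ, E) ∞ M]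

variable {U V : SharpMaps E M} (hUV : ∀ x : M, Function.Bijective (U x - V x))

theorem sub_flatMap_apply (x : M) (Y : TangentSpace 𝓘(ℝ, E) x) :
    U x (flatMap hUV x Y) - V x (flatMap hUV x Y) = Y :=
  (isInvertible_of_bijective hUV x).self_apply_inverse Y

theorem sub_onSections_flatMap (Y : VectorFields E M) :
    onSections U (onSections (flatMap hUV) Y) - onSections V (onSections (flatMap hUV) Y) = Y := by
  ext x
  exact sub_flatMap_apply hUV x (Y x)

include hUV in
theorem eq_zero_of_onSections_sub (α : OneForms E M)
    (h : onSections U α - onSections V α = 0) : α = 0 := by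
  ext1 x
  refine (hUV x).1 ?_
  rw [ContMDiffSection.coe_zero, Pi.zero_apply, map_zero]
  exact congrArg (fun Y : VectorFields E M => Y x) h

theorem bivectorPairing_smul_sub (c : ℝ) (α β : OneForms E M) :
    bivectorPairing (c • (U - V)) α β = c • evalForm β (onSections U α - onSections V α) := by
  ext x
  exact map_smul (β x) c _

theorem evalForm_smul_real (c : ℝ) (α : OneForms E M) (Y : VectorFields E M) :
    evalForm α (c • Y) = c • evalForm α Y :=
  LinearMap.map_smul_of_tower _ _ _

theorem evalForm_neg_skew {P : SharpMaps E M} (hP : IsPoisson P) (α β : OneForms E M) :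
    evalForm β (onSections P α) = -evalForm α (onSections P β) :=
  hP.ev_skew α β

theorem bivectorPairing_skew (hU : IsPoisson U) (hV : IsPoisson V) (c : ℝ) (α β : OneForms E M) :
    bivectorPairing (c • (U - V)) α β = -bivectorPairing (c • (U - V)) β α := by
  rw [bivectorPairing_smul_sub, bivectorPairing_smul_sub, map_sub, map_sub,
    evalForm_neg_skew hU α, evalForm_neg_skew hV α, ← smul_neg]
  congr 1
  ring

theorem bivectorPairing_flatMap (c : ℝ) (hc : c ≠ 0) (Y : VectorFields E M) (β : OneForms E M) :
    bivectorPairing (c • (U - V)) (onSections (flatMap hUV) (c⁻¹ • Y)) β = evalForm β Y := by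
  rw [bivectorPairing_smul_sub, sub_onSections_flatMap, evalForm_smul_real, smul_smul,
    mul_inv_cancel₀ hc, one_smul]

include hUV in
theorem bivectorPairing_bijective (c : ℝ) (hc : c ≠ 0) :
    Function.Bijective (bivectorPairing (c • (U - V))) := by
  refine ⟨(injective_iff_map_eq_zero _).2 fun α h => eq_zero_of_onSections_sub hUV α ?_,
    fun φ => ?_⟩
  · refine (cartanCalculus E M).ext_field fun f => ?_
    have hf := LinearMap.congr_fun h ((cartanCalculus E M).d f)
    rw [bivectorPairing_smul_sub, LinearMap.zero_apply, smul_eq_zero_iff_right hc] at hf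
    rw [← (cartanCalculus E M).ev_d, map_zero, Derivation.zero_apply]
    exact hf
  · obtain ⟨Y, hY⟩ := exists_vectorField φ
    exact ⟨onSections (flatMap hUV) (c⁻¹ • Y), LinearMap.ext fun β =>
      (bivectorPairing_flatMap hUV c hc Y β).trans (hY β)⟩

include hUV in
-- The pairing is skew, so bijectivity on the right is bijectivity on the left up to sign.
theorem bivectorPairing_isPerfPair (hU : IsPoisson U) (hV : IsPoisson V) (c : ℝ) (hc : c ≠ 0) :
    (bivectorPairing (c • (U - V))).IsPerfPair where
  bijective_left := bivectorPairing_bijective hUV c hc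
  bijective_right := by
    have h : ⇑(bivectorPairing (c • (U - V))).flip = Neg.neg ∘ bivectorPairing (c • (U - V)) := by
      funext α
      ext1 β
      exact bivectorPairing_skew hU hV c β α
    rw [h]
    exact neg_involutive.bijective.comp (bivectorPairing_bijective hUV c hc)

/-- The functions that admit a frame dual to a family of 1-forms, up to that function. -/
def frameFunctions (E : Type*) [NormedAddCommGroup E] [NormedSpace ℝ E]
    (M : Type*) [TopologicalSpace M] [ChartedSpace E M] [IsManifold 𝓘(ℝ, E) ∞ M] :
    Set (Fn E M) :=
  {f | ∃ (k : ℕ) (e : Fin k → Module.Dual (Fn E M) (OneForms E M)) (ε : Fin k → OneForms E M),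
    ∀ ζ, f • ζ = ∑ i, e i ζ • ε i}

theorem eq_zero_of_frameFunctions_mul (r : Fn E M) (h : ∀ f ∈ frameFunctions E M, f * r = 0) :
    r = 0 := by
  ext x₀
  obtain ⟨f, n, e, ε, hf, hfr⟩ := exists_scaledFrame (E := E) x₀
  have := congrArg (fun g : Fn E M => g x₀)
    (h f ⟨n, fun i => (cartanCalculus E M).ev.flip (e i), ε, hfr.form⟩)
  exact (mul_eq_zero.1 this).resolve_left hf

variable (hU : IsPoisson U) (hV : IsPoisson V) (c : ℝ) (hc : c ≠ 0)

/-- The Manin triple of the graphs of two Poisson tensors with nondegenerate difference. -/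
def poissonTriple : ManinTriple (hU.dirac c hc) (hV.dirac c hc) :=
  (cartanCalculus E M).maninTriple hU.ev_skew hV.ev_skew hU.der_jacobi hV.der_jacobi
    exists_vectorField c hc (onSections (flatMap hUV)) (sub_onSections_flatMap hUV)
    (eq_zero_of_onSections_sub hUV)

theorem bivectorPairing_eq_pair :
    bivectorPairing (c • (U - V)) = ManinTriple.pair (hU.dirac c hc) (hV.dirac c hc) := by
  refine LinearMap.ext₂ fun α β => ?_
  rw [bivectorPairing_smul_sub]
  exact ((cartanCalculus E M).pair_diracGraph hU.ev_skew hV.ev_skew hU.der_jacobi hV.der_jacobi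
    exists_vectorField c hc α β).symm

include hUV hc in
theorem isLieBialgebroid_cotangent :
    IsLieBialgebroid (bivectorPairing (c • (U - V))) hU.cotangentAlgebroid
      hV.cotangentAlgebroid := by
  have hB := bivectorPairing_isPerfPair hUV hU hV c hc
  revert hB
  rw [bivectorPairing_eq_pair hU hV c hc]
  intro hB
  exact (hU.isModelledBy c hc).isLieBialgebroid (hV.isModelledBy c hc) fun P Q ξ =>
    (poissonTriple hUV hU hV c hc).gevDefect_eq_zero _ apply_toPerfPair_symm
      (fun x => LinearEquiv.symm_apply_apply _ x) (frameFunctions E M)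
      eq_zero_of_frameFunctions_mul (fun _ h => h) P Q ξ

/-- The bundle map `-c⁻¹ U (U - V)⁻¹ V`. -/
def inducedTensor : SharpMaps E M :=
  -(c⁻¹ • Sec.comp U (Sec.comp (flatMap hUV) V))

theorem inducedTensor_apply (x : M) (α : TangentSpace 𝓘(ℝ, E) x →L[ℝ] ℝ) :
    inducedTensor hUV c x α = -c⁻¹ • U x ((U x - V x).inverse (V x α)) :=
  (neg_smul c⁻¹ (U x ((U x - V x).inverse (V x α)))).symm

theorem onSections_inducedTensor (α : OneForms E M) :
    onSections (inducedTensor hUV c) α =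
      onSections U (onSections (flatMap hUV) (c⁻¹ • -onSections V α)) := by
  ext x
  change -(c⁻¹ • U x (flatMap hUV x (V x (α x)))) = U x (flatMap hUV x (c⁻¹ • -V x (α x)))
  simp only [map_smul, map_neg, smul_neg]

include hU hV in
-- Since U (U − V)⁻¹ V = V + V (U − V)⁻¹ V, skewness follows from that of U and V.
theorem inducedTensor_skew (x : M) (α β : TangentSpace 𝓘(ℝ, E) x →L[ℝ] ℝ) :
    β (inducedTensor hUV c x α) = -α (inducedTensor hUV c x β) := by
  have h : ∀ α, inducedTensor hUV c x α = -(c⁻¹ • U x (flatMap hUV x (V x α))) := fun _ => rfl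
  rw [h, h]
  have ha := sub_flatMap_apply hUV x (V x α)
  have hb := sub_flatMap_apply hUV x (V x β)
  set a := flatMap hUV x (V x α)
  set b := flatMap hUV x (V x β)
  have h1 : β (U x a) - β (V x a) = β (V x α) := by rw [← map_sub, ha]
  have h2 : α (U x b) - α (V x b) = α (V x β) := by rw [← map_sub, hb]
  have h3 : b (U x a) - b (V x a) = b (V x α) := by rw [← map_sub, ha]
  have h4 : a (U x b) - a (V x b) = a (V x β) := by rw [← map_sub, hb]
  simp only [map_neg, map_smul, smul_eq_mul]
  have e1 := hV.skew x a β
  have e2 := hV.skew x b α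
  have e3 := hV.skew x α β
  have e4 := hU.skew x a b
  have e5 := hV.skew x a b
  linear_combination (-c⁻¹) * (h1 + h2 + h3 + h4 + e1 + e2 + e3 - e4 + e5)

include hU hV in
-- The exact section of f is (0, c⁻¹ df). Its component along the graph of U has anchor −c⁻¹ U (U −
-- V)⁻¹ V df, so the bracket is that of the Manin triple and Jacobi holds by `poisson_jacobi`.
theorem inducedTensor_isPoisson (hc : c ≠ 0) : IsPoisson (inducedTensor hUV c) where
  skew := inducedTensor_skew hUV hU hV c
  jacobi f g h x := by
    have key : ∀ f g : Fn E M, ∀ x, poissonBracket (inducedTensor hUV c) f g x =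
        (poissonTriple hUV hU hV c hc).poisson f g x := fun f g x => by
      have h := onSections_inducedTensor hUV c (differential f)
      change (cartanCalculus E M).der (onSections (inducedTensor hUV c) (differential f)) g x = _
      rw [h, smul_neg, ← LinearMap.map_smul_of_tower, ← zero_sub]
      rfl
    have hfun : ∀ f g : Fn E M, poissonBracket (inducedTensor hUV c) f g =
        (poissonTriple hUV hU hV c hc).poisson f g := fun f g => funext (key f g)
    simp only [hfun]
    exact DFunLike.congr_fun ((poissonTriple hUV hU hV c hc).poisson_jacobi f g h) x

/-- The dual of the anchor V sends α to the section that pairs with β to ⟨α, Vβ⟩ = −⟨β, Vα⟩. By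
`bivectorPairing_flatMap` this is c⁻¹ (U − V)⁻¹(−Vα). -/
theorem isInducedPoisson_inducedTensor (hc : c ≠ 0) (h : IsLieBialgebroid
      (bivectorPairing (c • (U - V))) hU.cotangentAlgebroid hV.cotangentAlgebroid) :
    h.IsInducedPoisson (inducedTensor hUV c) where
  isPoisson := inducedTensor_isPoisson hUV hU hV c hc
  eq_inducedMap α := by
    have := h.perfect
    rw [onSections_inducedTensor]
    refine congrArg (onSections U) (((LinearEquiv.symm_apply_eq _).2 ?_).symm)
    ext1 β
    refine Eq.trans ?_ (bivectorPairing_flatMap hUV c hc (-onSections V α) β).symm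
    rw [map_neg]
    exact evalForm_neg_skew hV β α

end Difference

end PoissonBialgebroid

end

theorem proposition6p6
    {E : Type*} [NormedAddCommGroup E] [NormedSpace ℝ E] [FiniteDimensional ℝ E]
    {M : Type*} [TopologicalSpace M] [T2Space M] [SecondCountableTopology M]
    [ChartedSpace E M] [IsManifold 𝓘(ℝ, E) ∞ M]
    (U V : PoissonBialgebroid.SharpMaps E M)
    (hU : PoissonBialgebroid.IsPoisson U) (hV : PoissonBialgebroid.IsPoisson V)
    (hUV : ∀ x : M, Function.Bijective (U x - V x)) :
    ∃ 𝒜U 𝒜V : PoissonBialgebroid.LieAlgebroid E (M := M) (E →L[ℝ] ℝ)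
        (fun x => TangentSpace 𝓘(ℝ, E) x →L[ℝ] ℝ),
      PoissonBialgebroid.IsCotangentAlgebroid U 𝒜U ∧
      PoissonBialgebroid.IsCotangentAlgebroid V 𝒜V ∧
      (∃ h : PoissonBialgebroid.IsLieBialgebroid
            (PoissonBialgebroid.bivectorPairing (U - V)) 𝒜U 𝒜V,
        ∃ π : PoissonBialgebroid.SharpMaps E M, h.IsInducedPoisson π ∧
          ∀ x : M, π x = -(U x ∘L (U x - V x).inverse ∘L V x)) ∧
      (∃ h : PoissonBialgebroid.IsLieBialgebroid
            (PoissonBialgebroid.bivectorPairing ((1 / 2 : ℝ) • (U - V))) 𝒜U 𝒜V,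
        ∃ π : PoissonBialgebroid.SharpMaps E M, h.IsInducedPoisson π ∧
          ∀ x : M, π x = -(2 : ℝ) • (U x ∘L (U x - V x).inverse ∘L V x)) := by
  refine ⟨hU.cotangentAlgebroid, hV.cotangentAlgebroid, hU.isCotangentAlgebroid,
    hV.isCotangentAlgebroid, ?_, ?_⟩
  -- The first claim is the normalisation c = 1.
  · rw [← one_smul ℝ (U - V)]
    refine ⟨PoissonBialgebroid.isLieBialgebroid_cotangent hUV hU hV 1 one_ne_zero, _,
      PoissonBialgebroid.isInducedPoisson_inducedTensor hUV hU hV 1 one_ne_zero _, fun x => ?_⟩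
    ext1 α
    rw [PoissonBialgebroid.inducedTensor_apply, inv_one, neg_smul, one_smul]
    rfl
  -- The second claim is c = 1/2, whose inverse is the factor 2 of the induced tensor.
  · have h2 : (1 / 2 : ℝ) ≠ 0 := by norm_num
    refine ⟨PoissonBialgebroid.isLieBialgebroid_cotangent hUV hU hV _ h2, _,
      PoissonBialgebroid.isInducedPoisson_inducedTensor hUV hU hV _ h2 _, fun x => ?_⟩
    ext1 α
    rw [PoissonBialgebroid.inducedTensor_apply, one_div, inv_inv]
    rfl
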